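/- Let $\mathbf X$ be a finite-dimensional smooth manifold and let $\Sigma\rightrightarrows\mathbf X$ be a Lie groupoid, either finite dimensional or strict pro-finite dimensional, i.e. the inverse limit of a tower $\cdots\to\Sigma_1\to\Sigma_0$ of finite-dimensional Lie groupoids over $\mathbf X$ and surjective submersions which are groupoid morphisms over $\mathrm{id}_{\mathbf X}$ (maps, forms and distributions on $\Sigma$ being smooth when each of their components comes from a smooth object at a finite level of the tower). Let $\mathcal C\subset T\Sigma$ be a subbundle such that $(\Sigma,\mathcal C)$ is a flat Cartan groupoid: $\mathcal C$ is an Ehresmann connection for the target map $t$ (it is complementary to $\ker dt$), it is multiplicative (a subgroupoid of $T\Sigma\rightrightarrows T\mathbf X$ with object space $T\mathbf X$), and it is involutive. Let $\Sigma^{(p)}$ be the space of strings $(g_1,\dots,g_p)$ of composable arrows ($\Sigma^{(0)}=\mathbf X$), with $t(g_1,\dots,g_p)=t(g_1)$, faces $d_i:\Sigma^{(p+1)}\to\Sigma^{(p)}$ (drop $g_1$, compose $g_ig_{i+1}$, drop $g_{p+1}$; for $p=0$: $d_0=s$, $d_1=t$) and degeneracies $s_i$ (insert a unit). Put $$C^{p,q}=\Omega^q_{\mathrm{hor}}(\Sigma^{(p)})=\Gamma(\Sigma^{(p)},t^*\Lambda^qT^*\mathbf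 X),$$ the smooth $q$-forms on $\Sigma^{(p)}$ that vanish on vectors tangent to the fibres of $t$. Let $\mathcal C^{(p)}$ be the Ehresmann connection on $t:\Sigma^{(p)}\to\mathbf X$ consisting of the tangent vectors all of whose components lie in $\mathcal C$, and let $\mathrm{hor}$ be its horizontal lift. Consider on $C^{*,*}$ the wedge product, the differential $d_{\mathcal C}c\,(v^0,\dots,v^q)=(d_{DR}c)(\mathrm{hor}\,v^0,\dots,\mathrm{hor}\,v^q)$, and the pull-backs along the face and degeneracy maps restricted to horizontal vectors, $(d_i^*c)(v^1,\dots,v^q)=c_{d_i(g)}\big(d(t\circ d_i)(\mathrm{hor}_g v^1),\dots,d(t\circ d_i)(\mathrm{hor}_g v^q)\big)$ at $g\in\Sigma^{(p+1)}$, and likewise $s_i^*$. (Thus $\delta=\sum_i(-1)^id_i^*$ is the differential of groupoid cochains with values in $\Lambda^qT^*\mathbf X$, for the action of $\Sigma$ induced by $\lambda_g^*=ds\circ\mathrm{hor}_g:T_{t(g)}\mathbf X\to T_{s(g)}\mathbf X$.) Then these operations are well defined on $C^{*,*}$ (they preserve smooth horizontal forms, and are uniquely determined by the formulas), and they make $C^{*,*}$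 a cosimplicial DGA: for each $p$, $(C^{p,*},\wedge,d_{\mathcal C})$ is a differential graded algebra, the $d_i^*$ and $s_i^*$ are morphisms of differential graded algebras, and they satisfy the cosimplicial identities. In particular, with $\delta=\sum_i(-1)^id_i^*$ and $\omega\cup\omega'=\mathrm{first}_p^*(\omega)\wedge\mathrm{last}_{p'}^*(\omega')$ for $\omega\in C^{p,q}$, $\omega'\in C^{p',q'}$ (where $\mathrm{first}_p$ and $\mathrm{last}_{p'}$ keep the first $p$, respectively the last $p'$, of $p+p'$ arrows, and pull-backs along them are composites of the $d_i^*$), $(C^{*,*},\delta,d_{\mathcal C})$ is a double complex ($\delta^2=0$, $d_{\mathcal C}^2=0$, $\delta d_{\mathcal C}=d_{\mathcal C}\delta$), $\cup$ is an associative, unital, bigraded product, and $$\delta(\omega\cup\omega')=\delta\omega\cup\omega'+(-1)^p\,\omega\cup\delta\omega',\qquad d_{\mathcal C}(\omega\cup\omega')=d_{\mathcal C}\omega\cup\omega'+(-1)^q\,\omega\cup d_{\mathcal C}\omega'.$$ On the total space $\bigoplus_{p,q}C^{p,q}$, with $D_{\mathrm{tot}}=\delta+(-1)^pd_{\mathcal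 C}$ on $C^{p,q}$ and $\omega\cup_{\mathrm{tot}}\omega'=(-1)^{qp'}\omega\cup\omega'$, one has $D_{\mathrm{tot}}^2=0$, $\cup_{\mathrm{tot}}$ is associative, and $D_{\mathrm{tot}}(\omega\cup_{\mathrm{tot}}\omega')=D_{\mathrm{tot}}\omega\cup_{\mathrm{tot}}\omega'+(-1)^k\omega\cup_{\mathrm{tot}}D_{\mathrm{tot}}\omega'$ for $\omega$ of total degree $k$. -/

import Mathlib

open scoped Manifold ContDiff Topology DirectSum

noncomputable section

namespace Haefliger

/-! ## Algebra: cosimplicial DGAs and double DGAs -/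

section Algebra

variable {C : ℕ → ℕ → Type*} [∀ p q, AddCommGroup (C p q)] [∀ p q, Module ℝ (C p q)]

/-- Transport of an element of a bigraded vector space along equalities of the degrees. -/
def degCast {p p' q q' : ℕ} (hp : p = p') (hq : q = q') : C p q →ₗ[ℝ] C p' q' := by
  subst hp; subst hq; exact LinearMap.id

/-- A cosimplicial DGA with underlying bigraded real vector space `C`: for every `p`, the graded
space `C p *` is a differential graded algebra `(wedge, one, d)` (associative and unital, with `d`
of degree one), and these are related by morphisms of DGAs, the cofaces `face i` and the
codegeneracies `degen i`, that satisfy the cosimplicial identities. -/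
@[ext]
structure CosimplicialDGA (C : ℕ → ℕ → Type*) [∀ p q, AddCommGroup (C p q)]
    [∀ p q, Module ℝ (C p q)] where
  wedge : ∀ {p q r : ℕ}, C p q →ₗ[ℝ] C p r →ₗ[ℝ] C p (q + r)
  one : ∀ p : ℕ, C p 0
  d : ∀ {p q : ℕ}, C p q →ₗ[ℝ] C p (q + 1)
  face : ∀ {p q : ℕ} (_ : Fin (p + 2)), C p q →ₗ[ℝ] C (p + 1) q
  degen : ∀ {p q : ℕ} (_ : Fin (p + 1)), C (p + 1) q →ₗ[ℝ] C p q
  -- each row is a DGA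
  wedge_assoc : ∀ {p q r s : ℕ} (a : C p q) (b : C p r) (c : C p s),
    degCast rfl (Nat.add_assoc q r s) (wedge (wedge a b) c) = wedge a (wedge b c)
  one_wedge : ∀ {p q : ℕ} (a : C p q), degCast rfl (Nat.zero_add q) (wedge (one p) a) = a
  wedge_one : ∀ {p q : ℕ} (a : C p q), wedge a (one p) = a
  d_d : ∀ {p q : ℕ} (a : C p q), d (d a) = 0
  d_wedge : ∀ {p q r : ℕ} (a : C p q) (b : C p r),
    d (wedge a b) = degCast rfl (Nat.add_right_comm q 1 r) (wedge (d a) b)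
      + (-1 : ℝ) ^ q • degCast rfl (Nat.add_assoc q r 1).symm (wedge a (d b))
  -- cofaces and codegeneracies are morphisms of DGAs
  face_wedge : ∀ {p q r : ℕ} (i : Fin (p + 2)) (a : C p q) (b : C p r),
    face i (wedge a b) = wedge (face i a) (face i b)
  face_one : ∀ {p : ℕ} (i : Fin (p + 2)), face i (one p) = one (p + 1)
  face_d : ∀ {p q : ℕ} (i : Fin (p + 2)) (a : C p q), face i (d a) = d (face i a)
  degen_wedge : ∀ {p q r : ℕ} (i : Fin (p + 1)) (a : C (p + 1) q) (b : C (p + 1) r),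
    degen i (wedge a b) = wedge (degen i a) (degen i b)
  degen_one : ∀ {p : ℕ} (i : Fin (p + 1)), degen i (one (p + 1)) = one p
  degen_d : ∀ {p q : ℕ} (i : Fin (p + 1)) (a : C (p + 1) q), degen i (d a) = d (degen i a)
  -- cosimplicial identities
  face_face : ∀ {p q : ℕ} (i j : Fin (p + 2)), i ≤ j → ∀ a : C p q,
    face j.succ (face i a) = face i.castSucc (face j a)
  degen_face_of_le : ∀ {p q : ℕ} (i : Fin (p + 2)) (j : Fin (p + 1)), i ≤ j.castSucc →
    ∀ a : C (p + 1) q, degen j.succ (face i.castSucc a) = face i (degen j a)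
  degen_face_self : ∀ {p q : ℕ} (i : Fin (p + 1)) (a : C p q), degen i (face i.castSucc a) = a
  degen_face_succ : ∀ {p q : ℕ} (i : Fin (p + 1)) (a : C p q), degen i (face i.succ a) = a
  degen_face_of_gt : ∀ {p q : ℕ} (i : Fin (p + 2)) (j : Fin (p + 1)), j.castSucc < i →
    ∀ a : C (p + 1) q, degen j.castSucc (face i.succ a) = face i (degen j a)
  degen_degen : ∀ {p q : ℕ} (i j : Fin (p + 1)), i ≤ j → ∀ a : C (p + 1 + 1) q,
    degen j (degen i.castSucc a) = degen i (degen j.succ a)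

namespace CosimplicialDGA

variable (Ω : CosimplicialDGA C)

/-- The differential `δ = ∑ (-1)^i d_i^*` of a cosimplicial DGA. -/
def δ {p q : ℕ} : C p q →ₗ[ℝ] C (p + 1) q :=
  ∑ i : Fin (p + 2), (-1 : ℝ) ^ (i : ℕ) • Ω.face i

/-- Pull-back along the map that keeps the first `p` of `p + p'` arrows. -/
def first {p q : ℕ} : (p' : ℕ) → C p q →ₗ[ℝ] C (p + p') q
  | 0 => LinearMap.id
  | p' + 1 => Ω.face (Fin.last (p + p' + 1)) ∘ₗ first p'

/-- Pull-back along the map that drops the first `p` of `p' + p` arrows. -/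
def dropFirst {p' q : ℕ} : (p : ℕ) → C p' q →ₗ[ℝ] C (p' + p) q
  | 0 => LinearMap.id
  | p + 1 => Ω.face 0 ∘ₗ dropFirst p

/-- Pull-back along the map that keeps the last `p'` of `p + p'` arrows. -/
def last {p' q : ℕ} (p : ℕ) : C p' q →ₗ[ℝ] C (p + p') q :=
  degCast (Nat.add_comm p' p) rfl ∘ₗ Ω.dropFirst p

/-- The cup product `a ∪ b = first_p^*(a) ∧ last_{p'}^*(b)`. -/
def cup {p q p' q' : ℕ} : C p q →ₗ[ℝ] C p' q' →ₗ[ℝ] C (p + p') (q + q') :=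
  Ω.wedge.compl₁₂ (Ω.first p') (Ω.last p)

/-- The total space of a bigraded vector space. -/
abbrev Tot (C : ℕ → ℕ → Type*) [∀ p q, AddCommGroup (C p q)] : Type _ :=
  ⨁ pq : ℕ × ℕ, C pq.1 pq.2

/-- The inclusion of the component of bidegree `(p, q)` into the total space. -/
def toTot (p q : ℕ) : C p q →ₗ[ℝ] Tot C :=
  DirectSum.lof ℝ (ℕ × ℕ) (fun pq => C pq.1 pq.2) (p, q)

/-- The total differential, `D = δ + (-1)^p d` on the component of bidegree `(p, q)`. -/
def totD : Tot C →ₗ[ℝ] Tot C :=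
  DirectSum.toModule ℝ (ℕ × ℕ) (Tot C) fun pq =>
    toTot (pq.1 + 1) pq.2 ∘ₗ Ω.δ + (-1 : ℝ) ^ pq.1 • (toTot pq.1 (pq.2 + 1) ∘ₗ Ω.d)

/-- The total product, `a ∪_tot b = (-1)^(q p') a ∪ b` for `a` of bidegree `(p, q)` and `b` of
bidegree `(p', q')`. -/
def totCup : Tot C →ₗ[ℝ] Tot C →ₗ[ℝ] Tot C :=
  DirectSum.toModule ℝ (ℕ × ℕ) (Tot C →ₗ[ℝ] Tot C) fun pq => LinearMap.flip <|
    DirectSum.toModule ℝ (ℕ × ℕ) (C pq.1 pq.2 →ₗ[ℝ] Tot C) fun rs =>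
      (-1 : ℝ) ^ (pq.2 * rs.1) •
        (Ω.cup.compr₂ (toTot (pq.1 + rs.1) (pq.2 + rs.2))).flip

/-- The part of total degree `k` of the total space. -/
def IsTotDegree (k : ℕ) (a : Tot C) : Prop := ∀ pq : ℕ × ℕ, a pq ≠ 0 → pq.1 + pq.2 = k

/-- The structure `(∪, δ, d)` is that of a double complex with a bigraded, associative and unital
product for which `δ`, `d` and the total differential satisfy the Leibniz identities. -/
structure IsDoubleDGA : Prop where
  δ_δ : ∀ {p q : ℕ} (a : C p q), Ω.δ (Ω.δ a) = 0
  d_d : ∀ {p q : ℕ} (a : C p q), Ω.d (Ω.d a) = 0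
  d_δ : ∀ {p q : ℕ} (a : C p q), Ω.d (Ω.δ a) = Ω.δ (Ω.d a)
  cup_assoc : ∀ {p q p' q' p'' q'' : ℕ} (a : C p q) (b : C p' q') (c : C p'' q''),
    degCast (Nat.add_assoc p p' p'') (Nat.add_assoc q q' q'') (Ω.cup (Ω.cup a b) c)
      = Ω.cup a (Ω.cup b c)
  one_cup : ∀ {p q : ℕ} (a : C p q),
    degCast (Nat.zero_add p) (Nat.zero_add q) (Ω.cup (Ω.one 0) a) = a
  cup_one : ∀ {p q : ℕ} (a : C p q), Ω.cup a (Ω.one 0) = a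
  δ_cup : ∀ {p q p' q' : ℕ} (a : C p q) (b : C p' q'),
    Ω.δ (Ω.cup a b) = degCast (Nat.add_right_comm p 1 p') rfl (Ω.cup (Ω.δ a) b)
      + (-1 : ℝ) ^ p • degCast (Nat.add_assoc p p' 1).symm rfl (Ω.cup a (Ω.δ b))
  d_cup : ∀ {p q p' q' : ℕ} (a : C p q) (b : C p' q'),
    Ω.d (Ω.cup a b) = degCast rfl (Nat.add_right_comm q 1 q') (Ω.cup (Ω.d a) b)
      + (-1 : ℝ) ^ q • degCast rfl (Nat.add_assoc q q' 1).symm (Ω.cup a (Ω.d b))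
  totD_totD : ∀ a : Tot C, Ω.totD (Ω.totD a) = 0
  totCup_assoc : ∀ a b c : Tot C, Ω.totCup (Ω.totCup a b) c = Ω.totCup a (Ω.totCup b c)
  totD_totCup : ∀ (k : ℕ) (a b : Tot C), IsTotDegree k a →
    Ω.totD (Ω.totCup a b) = Ω.totCup (Ω.totD a) b + (-1 : ℝ) ^ k • Ω.totCup a (Ω.totD b)

end CosimplicialDGA

end Algebra

/-! ## The wedge product of alternating forms -/

section Wedge

variable {V : Type*} [NormedAddCommGroup V] [NormedSpace ℝ V]

/-- The wedge product of alternating forms (the signed sum over shuffles). -/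
def wedge {q r : ℕ} (a : V [⋀^Fin q]→L[ℝ] ℝ) (b : V [⋀^Fin r]→L[ℝ] ℝ) :
    V [⋀^Fin (q + r)]→L[ℝ] ℝ :=
  { ((LinearMap.mul' ℝ ℝ).compAlternatingMap
      (a.toAlternatingMap.domCoprod b.toAlternatingMap)).domDomCongr finSumFinEquiv with
    cont := by
      change Continuous fun v : Fin (q + r) → V => LinearMap.mul' ℝ ℝ
        ((a.toAlternatingMap.domCoprod b.toAlternatingMap) fun i => v (finSumFinEquiv i))
      simp only [AlternatingMap.domCoprod_apply, sum_apply, map_sum]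
      refine continuous_finsetSum _ fun σ _ => ?_
      induction σ using Quotient.inductionOn' with
      | h σ =>
        have ha : Continuous fun v : Fin (q + r) → V =>
            a fun i => v (finSumFinEquiv (σ (Sum.inl i))) := a.cont.comp (by fun_prop)
        have hb : Continuous fun v : Fin (q + r) → V =>
            b fun i => v (finSumFinEquiv (σ (Sum.inr i))) := b.cont.comp (by fun_prop)
        convert (ha.mul hb).const_smul (Equiv.Perm.sign σ : ℤˣ) using 2 with v
        rcases Int.units_eq_one_or (Equiv.Perm.sign σ) with h | h <;>
          simp [AlternatingMap.domCoprod.summand, h, MultilinearMap.domDomCongr_apply,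
            MultilinearMap.domCoprod_apply] }

end Wedge

/-! ## Groupoids and their nerves -/

/-- A groupoid with set of objects `X` and set of arrows `A`. An arrow `g` goes from `src g` to
`tgt g`, and `mul g h` is the composite `g ∘ h`; it is meaningful only if `src g = tgt h`, and
nothing is required of it otherwise. -/
structure SetGroupoid (X A : Type*) where
  src : A → X
  tgt : A → X
  unit : X → A
  inv : A → A
  mul : A → A → A
  src_unit : ∀ x, src (unit x) = x
  tgt_unit : ∀ x, tgt (unit x) = x
  src_inv : ∀ g, src (inv g) = tgt g
  tgt_inv : ∀ g, tgt (inv g) = src g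
  src_mul : ∀ g h, src g = tgt h → src (mul g h) = src h
  tgt_mul : ∀ g h, src g = tgt h → tgt (mul g h) = tgt g
  mul_assoc : ∀ g h k, src g = tgt h → src h = tgt k → mul (mul g h) k = mul g (mul h k)
  unit_mul : ∀ g, mul (unit (tgt g)) g = g
  mul_unit : ∀ g, mul g (unit (src g)) = g
  inv_mul : ∀ g, mul (inv g) g = unit (src g)
  mul_inv : ∀ g, mul g (inv g) = unit (tgt g)

/-- The strings `x₀ ⟵ x₁ ⟵ ⋯ ⟵ x_p` of `p` composable arrows `g₁, …, g_p` of a groupoid; the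
objects are recorded so that strings of length `0` are the objects. The arrow `arr i` is
`g_{i+1}`, and the target `t(g₁)` of the string is `obj 0`. -/
@[ext]
structure SetGroupoid.Nerve {X A : Type*} (G : SetGroupoid X A) (p : ℕ) where
  obj : Fin (p + 1) → X
  arr : Fin p → A
  tgt_arr : ∀ i, G.tgt (arr i) = obj i.castSucc
  src_arr : ∀ i, G.src (arr i) = obj i.succ

namespace SetGroupoid

variable {X A : Type*} (G : SetGroupoid X A)

/-- The face map `d_i`: it omits the object `x_i`, composes the two arrows that meet there, and
drops the first (last) arrow for `i = 0` (`i = p + 1`). -/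
def face {p : ℕ} (i : Fin (p + 2)) (g : G.Nerve (p + 1)) : G.Nerve p where
  obj j := g.obj (i.succAbove j)
  arr j :=
    if (j : ℕ) + 1 < i then g.arr j.castSucc
    else if (j : ℕ) + 1 = i then G.mul (g.arr j.castSucc) (g.arr j.succ)
    else g.arr j.succ
  tgt_arr j := by
    split_ifs with h h'
    · rw [g.tgt_arr, Fin.succAbove_of_castSucc_lt _ _ (by rw [Fin.lt_def]; simp; omega)]
    · rw [G.tgt_mul _ _ (by rw [g.src_arr, g.tgt_arr, Fin.succ_castSucc]), g.tgt_arr,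
        Fin.succAbove_of_castSucc_lt _ _ (by rw [Fin.lt_def]; simp; omega)]
    · rw [g.tgt_arr, Fin.succAbove_of_le_castSucc _ _ (by rw [Fin.le_def]; simp; omega),
        Fin.succ_castSucc]
  src_arr j := by
    split_ifs with h h'
    · rw [g.src_arr, Fin.succAbove_of_castSucc_lt _ _ (by rw [Fin.lt_def]; simpa using h),
        Fin.succ_castSucc]
    · rw [G.src_mul _ _ (by rw [g.src_arr, g.tgt_arr, Fin.succ_castSucc]), g.src_arr,
        Fin.succAbove_of_le_castSucc _ _ (by rw [Fin.le_def]; simp; omega)]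
    · rw [g.src_arr, Fin.succAbove_of_le_castSucc _ _ (by rw [Fin.le_def]; simp; omega)]

/-- The degeneracy map `s_i`: it inserts the unit arrow at the object `x_i`. -/
def degen {p : ℕ} (i : Fin (p + 1)) (g : G.Nerve p) : G.Nerve (p + 1) where
  obj j := g.obj (i.predAbove j)
  arr j :=
    if h : (j : ℕ) < i then g.arr ⟨j, by omega⟩
    else if h' : (i : ℕ) < j then g.arr ⟨j - 1, by omega⟩
    else G.unit (g.obj i)
  tgt_arr j := by
    split_ifs with h h'
    · rw [g.tgt_arr]
      congr 1
      ext
      rw [Fin.predAbove_of_le_castSucc _ _ (by rw [Fin.le_def]; simp; omega)]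
      simp
    · rw [g.tgt_arr]
      congr 1
      ext
      rw [Fin.predAbove_of_castSucc_lt _ _ (by rw [Fin.lt_def]; simpa using h')]
      simp
    · rw [G.tgt_unit]
      congr 1
      ext
      rw [Fin.predAbove_of_le_castSucc _ _ (by rw [Fin.le_def]; simp; omega)]
      simp
      omega
  src_arr j := by
    split_ifs with h h'
    · rw [g.src_arr]
      congr 1
      ext
      rw [Fin.predAbove_of_le_castSucc _ _ (by rw [Fin.le_def]; simp; omega)]
      simp
    · rw [g.src_arr]
      congr 1
      ext
      rw [Fin.predAbove_of_castSucc_lt _ _ (by rw [Fin.lt_def]; simp; omega)]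
      simp
      omega
    · rw [G.src_unit]
      congr 1
      ext
      rw [Fin.predAbove_of_castSucc_lt _ _ (by rw [Fin.lt_def]; simp; omega)]
      simp
      omega

end SetGroupoid

/-! ## Lie groupoids and smooth horizontal forms on their nerves -/

/-- A Lie groupoid `A ⇉ X`: a groupoid for which `X` (modelled on `E`) and `A` (modelled on `F`)
are smooth manifolds, all structure maps are smooth, and source and target are (automatically
surjective) submersions. -/
structure LieGroupoid (E X F A : Type*) [NormedAddCommGroup E] [NormedSpace ℝ E]
    [TopologicalSpace X] [ChartedSpace E X] [NormedAddCommGroup F] [NormedSpace ℝ F]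
    [TopologicalSpace A] [ChartedSpace F A] extends SetGroupoid X A where
  submersion_src : Manifold.IsSubmersion 𝓘(ℝ, F) 𝓘(ℝ, E) ∞ src
  submersion_tgt : Manifold.IsSubmersion 𝓘(ℝ, F) 𝓘(ℝ, E) ∞ tgt
  smooth_unit : ContMDiff 𝓘(ℝ, E) 𝓘(ℝ, F) ∞ unit
  smooth_inv : ContMDiff 𝓘(ℝ, F) 𝓘(ℝ, F) ∞ inv
  smooth_mul : ContMDiffOn (𝓘(ℝ, F).prod 𝓘(ℝ, F)) 𝓘(ℝ, F) ∞ (fun a : A × A => mul a.1 a.2)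
    {a : A × A | src a.1 = tgt a.2}

namespace LieGroupoid

variable {E X F A : Type*} [NormedAddCommGroup E] [NormedSpace ℝ E]
    [TopologicalSpace X] [ChartedSpace E X] [NormedAddCommGroup F] [NormedSpace ℝ F]
    [TopologicalSpace A] [ChartedSpace F A] (G : LieGroupoid E X F A)

/-- The differential of the multiplication of the tangent groupoid, `(v, w) ↦ dm(v, w)`, at a
composable pair `(g, h)`; it is meaningful for tangent vectors with `ds(v) = dt(w)`. -/
def tangentMul (g h : A) (v : TangentSpace 𝓘(ℝ, F) g) (w : TangentSpace 𝓘(ℝ, F) h) :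
    TangentSpace 𝓘(ℝ, F) (G.mul g h) :=
  mfderivWithin (𝓘(ℝ, F).prod 𝓘(ℝ, F)) 𝓘(ℝ, F) (fun a : A × A => G.mul a.1 a.2)
    {a : A × A | G.src a.1 = G.tgt a.2} (g, h) (v, w)

variable {p q n : ℕ}

/-- A smooth map from an open subset `U` of `ℝⁿ` to the manifold of strings of `p` composable
arrows, which is a submanifold of the product of `p + 1` copies of `X` and `p` copies of `A`. (The
values outside of `U` play no role.) -/
structure IsPlot (ξ : EuclideanSpace ℝ (Fin n) → G.Nerve p) (U : Set (EuclideanSpace ℝ (Fin n))) :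
    Prop where
  isOpen : IsOpen U
  smooth_obj : ∀ i, ContMDiffOn 𝓘(ℝ, EuclideanSpace ℝ (Fin n)) 𝓘(ℝ, E) ∞
    (fun u => (ξ u).obj i) U
  smooth_arr : ∀ i, ContMDiffOn 𝓘(ℝ, EuclideanSpace ℝ (Fin n)) 𝓘(ℝ, F) ∞
    (fun u => (ξ u).arr i) U

/-- Let `θ` be a `t`-horizontal `q`-form on the manifold of strings of `p` arrows, that is, a
section of `t^* Λ^q T^*X`: its value at `g` is an alternating form on `T_{t(g)} X`, a space that is
by definition a copy of `E`. This is the pull-back of `θ` along a smooth map `ξ`, the form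
`u ↦ θ_{ξ(u)}(d(t ∘ ξ)_u ·, …, d(t ∘ ξ)_u ·)`. -/
def pullback (θ : G.Nerve p → E [⋀^Fin q]→L[ℝ] ℝ) (ξ : EuclideanSpace ℝ (Fin n) → G.Nerve p) :
    EuclideanSpace ℝ (Fin n) → EuclideanSpace ℝ (Fin n) [⋀^Fin q]→L[ℝ] ℝ :=
  fun u => (θ (ξ u)).compContinuousLinearMap
    (mfderiv 𝓘(ℝ, EuclideanSpace ℝ (Fin n)) 𝓘(ℝ, E) (fun u' => (ξ u').obj 0) u)

/-- A horizontal form on the manifold of strings of `p` arrows is smooth if its pull-backs along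
all smooth maps from open subsets of Euclidean spaces (for instance along local parametrizations)
are smooth. -/
def IsSmoothForm (θ : G.Nerve p → E [⋀^Fin q]→L[ℝ] ℝ) : Prop :=
  ∀ (n : ℕ) (ξ : EuclideanSpace ℝ (Fin n) → G.Nerve p) (U : Set (EuclideanSpace ℝ (Fin n))),
    G.IsPlot ξ U → ContDiffOn ℝ ∞ (G.pullback θ ξ) U

end LieGroupoid

/-! ## Pro-finite dimensional Lie groupoids over a finite dimensional base -/

/-- A strict pro-finite dimensional Lie groupoid over the finite dimensional manifold `X`, given by
a normal strict atlas: a tower `⋯ → A 2 → A 1 → A 0` of Lie groupoids over `X` and surjective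
submersions that are morphisms of groupoids over the identity of `X`; the groupoid itself is the
inverse limit. An ordinary Lie groupoid is the same as a constant tower. -/
structure LieGroupoidTower (E X : Type*) (F A : ℕ → Type*) [NormedAddCommGroup E]
    [NormedSpace ℝ E] [TopologicalSpace X] [ChartedSpace E X] [∀ k, NormedAddCommGroup (F k)]
    [∀ k, NormedSpace ℝ (F k)] [∀ k, TopologicalSpace (A k)] [∀ k, ChartedSpace (F k) (A k)] where
  level : ∀ k, LieGroupoid E X (F k) (A k)
  proj : ∀ k, A (k + 1) → A k
  proj_surjective : ∀ k, Function.Surjective (proj k)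
  proj_submersion : ∀ k, Manifold.IsSubmersion 𝓘(ℝ, F (k + 1)) 𝓘(ℝ, F k) ∞ (proj k)
  src_proj : ∀ k g, (level k).src (proj k g) = (level (k + 1)).src g
  tgt_proj : ∀ k g, (level k).tgt (proj k g) = (level (k + 1)).tgt g
  proj_unit : ∀ k x, proj k ((level (k + 1)).unit x) = (level k).unit x
  proj_inv : ∀ k g, proj k ((level (k + 1)).inv g) = (level k).inv (proj k g)
  proj_mul : ∀ k g h, (level (k + 1)).src g = (level (k + 1)).tgt h →
    proj k ((level (k + 1)).mul g h) = (level k).mul (proj k g) (proj k h)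

namespace LieGroupoidTower

variable {E X : Type*} {F A : ℕ → Type*} [NormedAddCommGroup E]
    [NormedSpace ℝ E] [TopologicalSpace X] [ChartedSpace E X] [∀ k, NormedAddCommGroup (F k)]
    [∀ k, NormedSpace ℝ (F k)] [∀ k, TopologicalSpace (A k)] [∀ k, ChartedSpace (F k) (A k)]
    (T : LieGroupoidTower E X F A)

/-- The projection from level `k + n` to level `k`. -/
def projAdd (k : ℕ) : (n : ℕ) → A (k + n) → A k
  | 0 => id
  | n + 1 => projAdd k n ∘ T.proj (k + n)

/-- The arrows of the inverse limit: compatible sequences of arrows. -/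
@[ext]
structure Arrow where
  comp : ∀ k, A k
  proj_comp : ∀ k, T.proj k (comp (k + 1)) = comp k

variable {T} in
theorem Arrow.src_comp (g : T.Arrow) (k : ℕ) :
    (T.level k).src (g.comp k) = (T.level 0).src (g.comp 0) := by
  induction k with
  | zero => rfl
  | succ k ih => rw [← ih, ← g.proj_comp k, T.src_proj]

variable {T} in
theorem Arrow.tgt_comp (g : T.Arrow) (k : ℕ) :
    (T.level k).tgt (g.comp k) = (T.level 0).tgt (g.comp 0) := by
  induction k with
  | zero => rfl
  | succ k ih => rw [← ih, ← g.proj_comp k, T.tgt_proj]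

variable {T} in
/-- The levelwise composite of two composable arrows. -/
def Arrow.mul (g h : T.Arrow) (H : (T.level 0).src (g.comp 0) = (T.level 0).tgt (h.comp 0)) :
    T.Arrow where
  comp k := (T.level k).mul (g.comp k) (h.comp k)
  proj_comp k := by
    rw [T.proj_mul k _ _ (by rw [g.src_comp, h.tgt_comp, H]), g.proj_comp, h.proj_comp]

open Classical in
/-- The inverse limit groupoid; all its structure maps are computed levelwise. -/
def limit : SetGroupoid X T.Arrow where
  src g := (T.level 0).src (g.comp 0)
  tgt g := (T.level 0).tgt (g.comp 0)
  unit x := ⟨fun k => (T.level k).unit x, fun k => T.proj_unit k x⟩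
  inv g := ⟨fun k => (T.level k).inv (g.comp k), fun k => by rw [T.proj_inv, g.proj_comp]⟩
  mul g h := if H : (T.level 0).src (g.comp 0) = (T.level 0).tgt (h.comp 0) then g.mul h H else g
  src_unit x := (T.level 0).src_unit x
  tgt_unit x := (T.level 0).tgt_unit x
  src_inv g := (T.level 0).src_inv _
  tgt_inv g := (T.level 0).tgt_inv _
  src_mul g h H := by rw [dif_pos H]; exact (T.level 0).src_mul _ _ H
  tgt_mul g h H := by rw [dif_pos H]; exact (T.level 0).tgt_mul _ _ H
  mul_assoc g h k H H' := by
    have h1 : (T.level 0).src ((g.mul h H).comp 0) = (T.level 0).tgt (k.comp 0) :=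
      ((T.level 0).src_mul _ _ H).trans H'
    have h2 : (T.level 0).src (g.comp 0) = (T.level 0).tgt ((h.mul k H').comp 0) :=
      H.trans ((T.level 0).tgt_mul _ _ H').symm
    rw [dif_pos H, dif_pos H', dif_pos h1, dif_pos h2]
    ext l
    exact (T.level l).mul_assoc _ _ _ (by rw [g.src_comp, h.tgt_comp, H])
      (by rw [h.src_comp, k.tgt_comp, H'])
  unit_mul g := by
    rw [dif_pos ((T.level 0).src_unit _)]
    ext l
    change (T.level l).mul ((T.level l).unit _) (g.comp l) = _
    rw [← g.tgt_comp l, (T.level l).unit_mul]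
  mul_unit g := by
    rw [dif_pos ((T.level 0).tgt_unit _).symm]
    ext l
    change (T.level l).mul (g.comp l) ((T.level l).unit _) = _
    rw [← g.src_comp l, (T.level l).mul_unit]
  inv_mul g := by
    rw [dif_pos ((T.level 0).src_inv _)]
    ext l
    change (T.level l).mul ((T.level l).inv (g.comp l)) (g.comp l) = (T.level l).unit _
    rw [← g.src_comp l, (T.level l).inv_mul]
  mul_inv g := by
    rw [dif_pos ((T.level 0).tgt_inv _).symm]
    ext l
    change (T.level l).mul (g.comp l) ((T.level l).inv (g.comp l)) = (T.level l).unit _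
    rw [← g.tgt_comp l, (T.level l).mul_inv]

/-- The component at level `k` of a string of composable arrows. -/
def nerveComp (k : ℕ) {p : ℕ} (g : T.limit.Nerve p) : (T.level k).Nerve p where
  obj := g.obj
  arr i := (g.arr i).comp k
  tgt_arr i := ((g.arr i).tgt_comp k).trans (g.tgt_arr i)
  src_arr i := ((g.arr i).src_comp k).trans (g.src_arr i)

/-- The projection of strings from level `k + 1` to level `k`. -/
def nerveProj (k : ℕ) {p : ℕ} (g : (T.level (k + 1)).Nerve p) : (T.level k).Nerve p where
  obj := g.obj
  arr i := T.proj k (g.arr i)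
  tgt_arr i := (T.tgt_proj k _).trans (g.tgt_arr i)
  src_arr i := (T.src_proj k _).trans (g.src_arr i)

theorem nerveProj_nerveComp (k : ℕ) {p : ℕ} (g : T.limit.Nerve p) :
    T.nerveProj k (T.nerveComp (k + 1) g) = T.nerveComp k g := by
  ext i
  · rfl
  · exact (g.arr i).proj_comp k

/-- The horizontal form `c` on the manifold of strings of composable arrows of the inverse limit
is represented by the smooth form `θ` at level `k`. -/
def IsRepresentedBy {p q : ℕ} (c : T.limit.Nerve p → E [⋀^Fin q]→L[ℝ] ℝ) (k : ℕ)
    (θ : (T.level k).Nerve p → E [⋀^Fin q]→L[ℝ] ℝ) : Prop :=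
  (T.level k).IsSmoothForm θ ∧ ∀ g, c g = θ (T.nerveComp k g)

variable {T} in
theorem IsRepresentedBy.succ {p q k : ℕ} {c : T.limit.Nerve p → E [⋀^Fin q]→L[ℝ] ℝ}
    {θ : (T.level k).Nerve p → E [⋀^Fin q]→L[ℝ] ℝ} (h : T.IsRepresentedBy c k θ) :
    T.IsRepresentedBy c (k + 1) (θ ∘ T.nerveProj k) := by
  refine ⟨fun n ξ U hξ => ?_, fun g => ?_⟩
  · exact h.1 n (T.nerveProj k ∘ ξ) U ⟨hξ.isOpen, hξ.smooth_obj, fun i =>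
      (T.proj_submersion k).contMDiff.comp_contMDiffOn (hξ.smooth_arr i)⟩
  · rw [h.2, Function.comp_apply, nerveProj_nerveComp]

variable {T} in
theorem IsRepresentedBy.add {p q k : ℕ} {c : T.limit.Nerve p → E [⋀^Fin q]→L[ℝ] ℝ}
    {θ : (T.level k).Nerve p → E [⋀^Fin q]→L[ℝ] ℝ} (h : T.IsRepresentedBy c k θ) (m : ℕ) :
    ∃ θ', T.IsRepresentedBy c (k + m) θ' := by
  induction m with
  | zero => exact ⟨θ, h⟩
  | succ m ih => exact ⟨_, ih.choose_spec.succ⟩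

/-- The space `C^{p,q} = C^p(Σ, Λ^q T^*X)` of smooth `t`-horizontal `q`-forms on the (pro-finite
dimensional) manifold of strings of `p` composable arrows, that is, of smooth sections of
`t^* Λ^q T^*X`: those that come from a smooth form at a finite level. -/
def cochains (p q : ℕ) : Submodule ℝ (T.limit.Nerve p → E [⋀^Fin q]→L[ℝ] ℝ) where
  carrier := {c | ∃ k θ, T.IsRepresentedBy c k θ}
  zero_mem' := ⟨0, 0, fun n ξ U _ => by
    have : (T.level 0).pullback (0 : (T.level 0).Nerve p → E [⋀^Fin q]→L[ℝ] ℝ) ξ =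
      fun _ => 0 := rfl
    rw [this]; exact contDiffOn_const, fun _ => rfl⟩
  add_mem' := by
    rintro c c' ⟨k, θ, h⟩ ⟨k', θ', h'⟩
    obtain ⟨η, hη⟩ := h.add k'
    obtain ⟨η', hη'⟩ : ∃ η', T.IsRepresentedBy c' (k + k') η' := Nat.add_comm k' k ▸ h'.add k
    refine ⟨k + k', η + η', fun n ξ U hξ => (hη.1 n ξ U hξ).add (hη'.1 n ξ U hξ), fun g => ?_⟩
    rw [Pi.add_apply, hη.2, hη'.2]; rfl
  smul_mem' := by
    rintro r c ⟨k, θ, h⟩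
    refine ⟨k, r • θ, fun n ξ U hξ => (h.1 n ξ U hξ).const_smul r, fun g => ?_⟩
    rw [Pi.smul_apply, h.2]; rfl

/-- The bigraded vector space `C^{p,q}`. -/
abbrev Cochain (p q : ℕ) : Type _ := T.cochains p q

/-! ## Cartan connections -/

/-- Sequences of tangent vectors at the components of an arrow. -/
abbrev TangentSeq (g : T.Arrow) : Type _ := ∀ k, TangentSpace 𝓘(ℝ, F k) (g.comp k)

/-- The tangent space of the inverse limit at `g`: the compatible sequences of tangent vectors. -/
def tangent (g : T.Arrow) : Submodule ℝ (T.TangentSeq g) where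
  carrier := {w | ∀ k, (mfderiv 𝓘(ℝ, F (k + 1)) 𝓘(ℝ, F k) (T.proj k) (g.comp (k + 1))
    (w (k + 1)) : F k) = w k}
  zero_mem' _ := map_zero _
  add_mem' hv hw k := (map_add _ _ _).trans (congrArg₂ (fun a b : F k => a + b) (hv k) (hw k))
  smul_mem' r _ hw k := (map_smul _ _ _).trans (congrArg (fun a : F k => r • a) (hw k))

/-- The differential of the target map. -/
def dTgt (g : T.Arrow) : T.TangentSeq g →ₗ[ℝ] E :=
  (mfderiv 𝓘(ℝ, F 0) 𝓘(ℝ, E) (T.level 0).tgt (g.comp 0)).toLinearMap ∘ₗ LinearMap.proj 0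

/-- The differential of the source map. -/
def dSrc (g : T.Arrow) : T.TangentSeq g →ₗ[ℝ] E :=
  (mfderiv 𝓘(ℝ, F 0) 𝓘(ℝ, E) (T.level 0).src (g.comp 0)).toLinearMap ∘ₗ LinearMap.proj 0

/-- The vectors that are tangent to the fibre of the target map. -/
def vertical (g : T.Arrow) : Submodule ℝ (T.TangentSeq g) := T.tangent g ⊓ LinearMap.ker (T.dTgt g)

variable [IsManifold 𝓘(ℝ, E) ∞ X] [∀ k, IsManifold 𝓘(ℝ, F k) ∞ (A k)]

/-- An Ehresmann connection for `t : Σ → X`: a subbundle of the tangent bundle of `Σ` that is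
complementary to the bundle of vertical vectors. Smoothness is that of the horizontal lift
`t^*TX → TΣ`: its component at level `k` is a smooth morphism of vector bundles from `t^*TX` to the
pull-back of the tangent bundle of `A k`, over some level `k + n`. -/
structure EhresmannConnection where
  carrier : ∀ g : T.Arrow, Submodule ℝ (T.TangentSeq g)
  disjoint : ∀ g, Disjoint (carrier g) (T.vertical g)
  sup_eq : ∀ g, carrier g ⊔ T.vertical g = T.tangent g
  smooth : ∀ k, ∃ (n : ℕ) (h : ∀ y : A (k + n), TangentSpace 𝓘(ℝ, E) ((T.level (k + n)).tgt y) →L[ℝ]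
      TangentSpace 𝓘(ℝ, F k) (T.projAdd k n y)),
    (∀ y₀, ContMDiffAt 𝓘(ℝ, F (k + n)) 𝓘(ℝ, E →L[ℝ] F k) ∞
      (inTangentCoordinates 𝓘(ℝ, E) 𝓘(ℝ, F k) (T.level (k + n)).tgt (T.projAdd k n) h y₀) y₀) ∧
    ∀ g, ∀ w ∈ carrier g, (h (g.comp (k + n)) (T.dTgt g w) : F k) = w k

/-- A Cartan groupoid: an Ehresmann connection on `t : Σ → X` that is multiplicative, i.e. a
subgroupoid of the tangent groupoid `TΣ ⇉ TX` with the same objects: it is closed under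
multiplication and inversion, and contains the unit vectors (so that both
`ds` and `dt` map it onto `TX`). -/
structure CartanConnection extends EhresmannConnection T where
  mul_mem : ∀ g h, T.limit.src g = T.limit.tgt h → ∀ v ∈ carrier g, ∀ w ∈ carrier h,
    T.dSrc g v = T.dTgt h w →
    (fun k => ((T.level k).tangentMul (g.comp k) (h.comp k) (v k) (w k) : F k)) ∈
      carrier (T.limit.mul g h)
  unit_mem : ∀ (x : X) (v : TangentSpace 𝓘(ℝ, E) x),
    (fun k => mfderiv 𝓘(ℝ, E) 𝓘(ℝ, F k) (T.level k).unit x v) ∈ carrier (T.limit.unit x)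
  inv_mem : ∀ g, ∀ v ∈ carrier g,
    (fun k => mfderiv 𝓘(ℝ, F k) 𝓘(ℝ, F k) (T.level k).inv (g.comp k) (v k)) ∈
      carrier (T.limit.inv g)

variable {T}

/-- A smooth local section of a distribution over the set `O` of arrows: for every `k`, its
component at level `k` is given by a smooth map from some level `k + n` to the tangent bundle of
`A k`. -/
structure EhresmannConnection.IsSectionOn (C : EhresmannConnection T) (O : Set T.Arrow)
    (Y : ∀ g, T.TangentSeq g) : Prop where
  mem : ∀ g ∈ O, Y g ∈ C.carrier g
  smooth : ∀ k, ∃ (n : ℕ) (η : A (k + n) → TangentBundle 𝓘(ℝ, F k) (A k)), ∀ g ∈ O,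
    η (g.comp (k + n)) = ⟨g.comp k, Y g k⟩ ∧
    ContMDiffAt 𝓘(ℝ, F (k + n)) 𝓘(ℝ, F k).tangent ∞ η (g.comp (k + n))

/-- The tangent vector `z` at `g` is the value at `g` of the Lie bracket `[Y, Z]` of two vector
fields, i.e. `z(f) = Y(Z(f)) - Z(Y(f))` for the smooth functions `f` defined around the
component of `g` at some level `k`. Here `Z(f)` and `Y(f)` are, near `g`, functions `ψ` and `χ` on
some level `k + n`. -/
def IsLieBracketAt (Y Z : ∀ g, T.TangentSeq g) (g : T.Arrow) (z : T.TangentSeq g) : Prop :=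
  ∀ (k : ℕ) (f : A k → ℝ), (∃ V ∈ 𝓝 (g.comp k), ContMDiffOn 𝓘(ℝ, F k) 𝓘(ℝ, ℝ) ∞ f V) →
  ∀ (n : ℕ) (ψ χ : A (k + n) → ℝ),
    MDifferentiableAt 𝓘(ℝ, F (k + n)) 𝓘(ℝ, ℝ) ψ (g.comp (k + n)) →
    MDifferentiableAt 𝓘(ℝ, F (k + n)) 𝓘(ℝ, ℝ) χ (g.comp (k + n)) →
    (∀ᶠ y in 𝓝 (g.comp (k + n)), ∀ g' : T.Arrow, g'.comp (k + n) = y →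
      ψ y = mfderiv 𝓘(ℝ, F k) 𝓘(ℝ, ℝ) f (g'.comp k) (Z g' k) ∧
      χ y = mfderiv 𝓘(ℝ, F k) 𝓘(ℝ, ℝ) f (g'.comp k) (Y g' k)) →
    (mfderiv 𝓘(ℝ, F k) 𝓘(ℝ, ℝ) f (g.comp k) (z k) : ℝ) =
      (show ℝ from mfderiv 𝓘(ℝ, F (k + n)) 𝓘(ℝ, ℝ) ψ (g.comp (k + n)) (Y g (k + n))) -
      (show ℝ from mfderiv 𝓘(ℝ, F (k + n)) 𝓘(ℝ, ℝ) χ (g.comp (k + n)) (Z g (k + n)))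

/-- Involutivity: the Lie bracket of two smooth local sections of the distribution takes values in
the distribution. A flat Cartan groupoid is one whose connection is involutive. -/
def EhresmannConnection.IsInvolutive (C : EhresmannConnection T) : Prop :=
  ∀ (l : ℕ) (W : Set (A l)), IsOpen W → ∀ Y Z : ∀ g, T.TangentSeq g,
    C.IsSectionOn {g | g.comp l ∈ W} Y → C.IsSectionOn {g | g.comp l ∈ W} Z →
    ∀ g : T.Arrow, g.comp l ∈ W → ∃ z ∈ C.carrier g, IsLieBracketAt Y Z g z

/-! ## The Haefliger complex -/

namespace CartanConnection

variable (C : CartanConnection T)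

/-- The connection `C^{(p)}` on the manifold of strings of `p` arrows: the tangent vectors
`(v¹, …, v^p)` at `g = (g₁, …, g_p)` all of whose components belong to `C`. The induced tangent
vectors at the objects are recorded as well, and `base 0` is the image of the vector under the
differential of the target map `t : Σ^{(p)} → X`; so the vector is the horizontal lift of
`base 0`. -/
structure Horizontal {p : ℕ} (g : T.limit.Nerve p) where
  base : Fin (p + 1) → E
  vec : ∀ i : Fin p, T.TangentSeq (g.arr i)
  mem : ∀ i, vec i ∈ C.carrier (g.arr i)
  tgt_vec : ∀ i, T.dTgt (g.arr i) (vec i) = base i.castSucc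
  src_vec : ∀ i, T.dSrc (g.arr i) (vec i) = base i.succ

/-- `η = d_C c`, i.e. `η(v⁰, …, v^q) = (d_{DR} c)(hor(v⁰), …, hor(v^q))`. The right hand side, for
a form `c` represented by `θ` at level `k`, is `(d ξ^*θ)_u(e₀, …, e_q)` for any smooth map `ξ` from
an open subset of a Euclidean space whose differential at `u` maps each `e_j` to the component of
`hor(v^j)` at level `k`. -/
def IsHorizontalDifferential {p q : ℕ} (c : T.limit.Nerve p → E [⋀^Fin q]→L[ℝ] ℝ)
    (η : T.limit.Nerve p → E [⋀^Fin (q + 1)]→L[ℝ] ℝ) : Prop :=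
  ∀ (g : T.limit.Nerve p) (w : Fin (q + 1) → C.Horizontal g)
    (k : ℕ) (θ : (T.level k).Nerve p → E [⋀^Fin q]→L[ℝ] ℝ), T.IsRepresentedBy c k θ →
  ∀ (n : ℕ) (ξ : EuclideanSpace ℝ (Fin n) → (T.level k).Nerve p)
    (U : Set (EuclideanSpace ℝ (Fin n))), (T.level k).IsPlot ξ U →
  ∀ u ∈ U, ξ u = T.nerveComp k g → ∀ e : Fin (q + 1) → EuclideanSpace ℝ (Fin n),
    (∀ j i, mfderiv 𝓘(ℝ, EuclideanSpace ℝ (Fin n)) 𝓘(ℝ, E) (fun u' => (ξ u').obj i) u (e j) =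
      (w j).base i) →
    (∀ j i, (mfderiv 𝓘(ℝ, EuclideanSpace ℝ (Fin n)) 𝓘(ℝ, F k) (fun u' => (ξ u').arr i) u (e j) :
      F k) = (w j).vec i k) →
    η g (fun j => (w j).base 0) = extDeriv ((T.level k).pullback θ ξ) u e

/-- The operations of the Haefliger complex: the wedge product of forms and the constant function
`1`, the differential `d_C`, and the pull-backs along the face and degeneracy maps of the nerve,
restricted to horizontal vectors: `(d_i^*c)_g(v¹, …, v^q)` is the value of `c` at `d_i(g)` on the
images of `hor(v^j)` under the differential of `t ∘ d_i : Σ^{(p+1)} → X`, `g ↦ x_1` for `i = 0`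
and `g ↦ x_0` for `i > 0`. (For `i = 0` this is the action of `g₁` on `c(g₂, …, g_{p+1})` through
`λ_{g₁}^* = ds ∘ hor_{g₁}`. The degeneracy maps do not change the target.) -/
structure IsHaefligerComplex (Ω : CosimplicialDGA T.Cochain) : Prop where
  wedge_apply : ∀ {p q r : ℕ} (a : T.Cochain p q) (b : T.Cochain p r) (g : T.limit.Nerve p),
    (Ω.wedge a b).1 g = wedge (a.1 g) (b.1 g)
  one_apply : ∀ {p : ℕ} (g : T.limit.Nerve p) (v : Fin 0 → E), (Ω.one p).1 g v = 1
  d_apply : ∀ {p q : ℕ} (c : T.Cochain p q), C.IsHorizontalDifferential c.1 (Ω.d c).1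
  face_apply : ∀ {p q : ℕ} (i : Fin (p + 2)) (c : T.Cochain p q) (g : T.limit.Nerve (p + 1))
    (w : Fin q → C.Horizontal g), (Ω.face i c).1 g (fun j => (w j).base 0) =
      c.1 (T.limit.face i g) (fun j => (w j).base (i.succAbove 0))
  degen_apply : ∀ {p q : ℕ} (i : Fin (p + 1)) (c : T.Cochain (p + 1) q) (g : T.limit.Nerve p),
    (Ω.degen i c).1 g = c.1 (T.limit.degen i g)

end CartanConnection

end LieGroupoidTower

/-- A finite dimensional Lie groupoid as a constant tower. -/
def LieGroupoid.constTower {E X F A : Type*} [NormedAddCommGroup E] [NormedSpace ℝ E]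
    [TopologicalSpace X] [ChartedSpace E X] [NormedAddCommGroup F] [NormedSpace ℝ F]
    [TopologicalSpace A] [ChartedSpace F A] [IsManifold 𝓘(ℝ, F) ∞ A] (G : LieGroupoid E X F A) :
    LieGroupoidTower E X (fun _ => F) (fun _ => A) where
  level _ := G
  proj _ := id
  proj_surjective _ := Function.surjective_id
  proj_submersion _ := Manifold.IsSubmersion.id
  src_proj _ _ := rfl
  tgt_proj _ _ := rfl
  proj_unit _ _ := rfl
  proj_inv _ _ := rfl
  proj_mul _ _ _ _ := rfl

end Haefliger

/-! The double complex is formal. In any cosimplicial DGA `δ` squares to zero and commutes with `d`.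
The cup product obeys the Leibniz rule because the last coface of the left factor and the zeroth
coface of the right factor give the same term with opposite signs (`cup_faceN_last`). The work lies
in constructing the cosimplicial DGA and in showing that the formulas determine it.

Complementarity makes `dt` an isomorphism from the connection onto `TX`, so a horizontal vector on a
string is determined by its image `v` at the target: applying `λ_g` arrow by arrow gives its
components at the other objects (`hbase`), and lifting these gives its components at the arrows
(`hvec`). Together with this uniqueness, multiplicativity shows that products and units of
horizontal vectors are the expected lifts (`hor_mul`, `hor_unit`). Hence faces and degeneracies
preserve horizontal vectors, and the cosimplicial identities follow from the simplicial identities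
of the nerve (`hbase_face`, `hbase_degen`).

The value of `d_C c` at `g` is the exterior derivative, at one point, of the pull-back of `c` along
any map whose tangent vectors at that point are horizontal. It is well defined because this
derivative depends only on the first derivative of the map (`extDeriv_pull_apply`). To see that,
factor the map through a smooth map from a coordinate space to the nerve that is a left inverse of
the coordinates (`exists_nerveParam`). The Leibniz rule for `d_C` is then that of the exterior
derivative.

Flatness enters in `d_C² = 0` and in the compatibility of `d_C` with faces, and no integral
manifolds are constructed. Along a plot, both problems concern a form `x ↦ μ(κ x) ∘ L x` in which `L
x` is the lift in coordinates and agrees with the derivative of `κ` only at the point `u`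
considered. Its exterior derivative at `u` is still `dμ ∘ L u`, provided that the derivative of `L`
at `u` is symmetric (`extDeriv_compContinuousLinearMap`). This symmetry is the infinitesimal form of
flatness: the bracket of the lifts of two coordinate fields is horizontal by involutivity and
vertical because coordinate fields commute, so it vanishes (`IsHorChart.fderiv_symm`). An induction
along the string extends the symmetry to all components, using the symmetry of second derivatives of
the source map (`fderiv_baseChart_symm`).

In the pro-finite case all computations take place at a finite level. The component of the lift at
level `k` is a function on some level `k + n` (`IsHorLevel`), so `d_C` and the cofaces take forms
from level `k` to forms from level `k + n`. -/

namespace Haefliger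

/-! ## Signed sums over permutations -/

section AltSum

variable {V ι κ : Type*} [Fintype ι] [DecidableEq ι] [Fintype κ] [DecidableEq κ]

/-- The sign of a permutation as a real number. -/
def rsign : Equiv.Perm ι →* ℝ :=
  ((Int.castRingHom ℝ : ℤ →* ℝ).comp (Units.coeHom ℤ)).comp Equiv.Perm.sign

theorem rsign_apply (σ : Equiv.Perm ι) : rsign σ = ((Equiv.Perm.sign σ : ℤ) : ℝ) := rfl

theorem rsign_mul_self (σ : Equiv.Perm ι) : rsign σ * rsign σ = 1 := by
  rw [rsign_apply]
  rcases Int.units_eq_one_or (Equiv.Perm.sign σ) with h | h <;> simp [h]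

theorem abs_rsign (σ : Equiv.Perm ι) : |rsign σ| = 1 := by
  rw [rsign_apply]
  rcases Int.units_eq_one_or (Equiv.Perm.sign σ) with h | h <;> simp [h]

/-- The signed sum of the values of `f` at all permutations of a family. -/
def altSum (f : (ι → V) → ℝ) (v : ι → V) : ℝ := ∑ σ : Equiv.Perm ι, rsign σ * f (v ∘ σ)

theorem altSum_comp_perm (f : (ι → V) → ℝ) (τ : Equiv.Perm ι) (v : ι → V) :
    altSum (fun w => f (w ∘ τ)) v = rsign τ * altSum f v := by
  rw [altSum, altSum, Finset.mul_sum]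
  refine Fintype.sum_equiv (Equiv.mulRight τ) _ _ fun σ => ?_
  rw [Equiv.coe_mulRight, map_mul, show v ∘ ⇑(σ * τ) = (v ∘ σ) ∘ τ from rfl]
  linear_combination (-(rsign σ * f ((v ∘ ⇑σ) ∘ ⇑τ))) * rsign_mul_self τ

theorem altSum_mul_left (c : ℝ) (f : (ι → V) → ℝ) (v : ι → V) :
    altSum (fun w => c * f w) v = c * altSum f v := by
  rw [altSum, altSum, Finset.mul_sum]
  exact Finset.sum_congr rfl fun _ _ => by ring

theorem altSum_sum {α : Type*} (s : Finset α) (f : α → (ι → V) → ℝ) (v : ι → V) :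
    altSum (fun w => ∑ i ∈ s, f i w) v = ∑ i ∈ s, altSum (f i) v := by
  simp only [altSum, Finset.mul_sum]
  exact Finset.sum_comm

theorem altSum_equiv (e : ι ≃ κ) (f : (κ → V) → ℝ) (v : κ → V) :
    altSum f v = altSum (fun w => f (w ∘ e.symm)) (v ∘ e) := by
  rw [altSum, altSum, ← (e.permCongr).sum_comp]
  refine Finset.sum_congr rfl fun σ _ => ?_
  rw [rsign_apply, Equiv.Perm.sign_permCongr, rsign_apply]
  rfl

/-- Antisymmetrising first over some of the permutations is absorbed by the full antisymmetrisation: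
each `τ` contributes its sign squared times the full sum. Only preservation of signs matters; `ρ`
need not be a homomorphism. -/
theorem altSum_partial {α : Type*} [Fintype α] [DecidableEq α]
    (ρ : Equiv.Perm α → Equiv.Perm ι) (hρ : ∀ τ, rsign (ρ τ) = rsign τ) (f : (ι → V) → ℝ)
    (v : ι → V) :
    altSum (fun w => ∑ τ, rsign τ * f (w ∘ ρ τ)) v = (Fintype.card α).factorial * altSum f v := by
  rw [altSum_sum, ← Fintype.card_perm, ← nsmul_eq_mul, ← Finset.card_univ, ← Finset.sum_const]
  refine Finset.sum_congr rfl fun τ _ => ?_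
  rw [altSum_mul_left, altSum_comp_perm, hρ, ← mul_assoc, rsign_mul_self, one_mul]

variable [NormedAddCommGroup V] [NormedSpace ℝ V]

theorem map_comp_perm (a : V [⋀^ι]→L[ℝ] ℝ) (σ : Equiv.Perm ι) (v : ι → V) :
    a (v ∘ σ) = rsign σ * a v := by
  have := a.toAlternatingMap.map_perm v σ
  rw [ContinuousAlternatingMap.coe_toAlternatingMap] at this
  rw [this, rsign_apply, Units.smul_def, zsmul_eq_mul]

theorem altSum_self (a : V [⋀^ι]→L[ℝ] ℝ) (v : ι → V) :
    altSum a v = (Fintype.card ι).factorial * a v := by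
  rw [altSum, ← Fintype.card_perm, ← nsmul_eq_mul, ← Finset.card_univ, ← Finset.sum_const]
  refine Finset.sum_congr rfl fun τ _ => ?_
  rw [map_comp_perm, ← mul_assoc, rsign_mul_self, one_mul]

end AltSum

/-! ### Permutations of a block of indices -/

section Shuffle

variable {V : Type*} {q r : ℕ}

/-- A permutation of the first `q` of `q + r` indices. -/
def permLeft (r : ℕ) (τ : Equiv.Perm (Fin q)) : Equiv.Perm (Fin (q + r)) :=
  finSumFinEquiv.permCongr (τ.sumCongr 1)

/-- A permutation of the last `r` of `q + r` indices. -/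
def permRight (q : ℕ) (τ : Equiv.Perm (Fin r)) : Equiv.Perm (Fin (q + r)) :=
  finSumFinEquiv.permCongr (Equiv.sumCongr 1 τ)

theorem rsign_permLeft (τ : Equiv.Perm (Fin q)) : rsign (permLeft r τ) = rsign τ := by
  rw [rsign_apply, permLeft, Equiv.Perm.sign_permCongr, Equiv.Perm.sign_sumCongr, map_one, mul_one,
    rsign_apply]

theorem rsign_permRight (τ : Equiv.Perm (Fin r)) : rsign (permRight q τ) = rsign τ := by
  rw [rsign_apply, permRight, Equiv.Perm.sign_permCongr, Equiv.Perm.sign_sumCongr, map_one, one_mul,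
    rsign_apply]

theorem permLeft_castAdd (τ : Equiv.Perm (Fin q)) (i : Fin q) :
    permLeft r τ (Fin.castAdd r i) = Fin.castAdd r (τ i) := by
  simp [permLeft, Equiv.permCongr_apply]

theorem permLeft_natAdd (τ : Equiv.Perm (Fin q)) (i : Fin r) :
    permLeft r τ (Fin.natAdd q i) = Fin.natAdd q i := by
  simp [permLeft, Equiv.permCongr_apply]

theorem permRight_castAdd (τ : Equiv.Perm (Fin r)) (i : Fin q) :
    permRight q τ (Fin.castAdd r i) = Fin.castAdd r i := by
  simp [permRight, Equiv.permCongr_apply]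

theorem permRight_natAdd (τ : Equiv.Perm (Fin r)) (i : Fin r) :
    permRight q τ (Fin.natAdd q i) = Fin.natAdd q (τ i) := by
  simp [permRight, Equiv.permCongr_apply]

theorem altSum_permLeft (f : (Fin q → V) → (Fin r → V) → ℝ) (v : Fin (q + r) → V) :
    altSum (fun w : Fin (q + r) → V =>
      altSum (fun x => f x (w ∘ Fin.natAdd q)) (w ∘ Fin.castAdd r)) v =
    q.factorial * altSum (fun w => f (w ∘ Fin.castAdd r) (w ∘ Fin.natAdd q)) v := by
  have h := altSum_partial (permLeft r) rsign_permLeft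
    (fun w : Fin (q + r) → V => f (w ∘ Fin.castAdd r) (w ∘ Fin.natAdd q)) v
  rw [Fintype.card_fin] at h
  rw [← h]
  congr 1
  ext w
  refine Finset.sum_congr rfl fun τ _ => ?_
  refine congrArg (rsign τ * ·) (congrArg₂ f (funext fun i => ?_) (funext fun i => ?_))
  · simp [permLeft_castAdd]
  · simp [permLeft_natAdd]

theorem altSum_permRight (f : (Fin q → V) → (Fin r → V) → ℝ) (v : Fin (q + r) → V) :
    altSum (fun w : Fin (q + r) → V =>
      altSum (fun x => f (w ∘ Fin.castAdd r) x) (w ∘ Fin.natAdd q)) v =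
    r.factorial * altSum (fun w => f (w ∘ Fin.castAdd r) (w ∘ Fin.natAdd q)) v := by
  have h := altSum_partial (permRight q) rsign_permRight
    (fun w : Fin (q + r) → V => f (w ∘ Fin.castAdd r) (w ∘ Fin.natAdd q)) v
  rw [Fintype.card_fin] at h
  rw [← h]
  congr 1
  ext w
  refine Finset.sum_congr rfl fun τ _ => ?_
  refine congrArg (rsign τ * ·) (congrArg₂ f (funext fun i => ?_) (funext fun i => ?_))
  · simp [permRight_castAdd]
  · simp [permRight_natAdd]

/-- A permutation of the last `q` of `q + 1` indices. -/
def permSucc (τ : Equiv.Perm (Fin q)) : Equiv.Perm (Fin (q + 1)) :=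
  Equiv.Perm.decomposeFin.symm (0, τ)

theorem rsign_permSucc (τ : Equiv.Perm (Fin q)) : rsign (permSucc τ) = rsign τ := by
  rw [rsign_apply, permSucc, Equiv.Perm.decomposeFin.symm_sign]
  simp [rsign_apply]

theorem altSum_permSucc (f : V → (Fin q → V) → ℝ) (v : Fin (q + 1) → V) :
    altSum (fun w : Fin (q + 1) → V => altSum (fun x => f (w 0) x) (w ∘ Fin.succ)) v =
    q.factorial * altSum (fun w => f (w 0) (w ∘ Fin.succ)) v := by
  have h := altSum_partial permSucc rsign_permSucc
    (fun w : Fin (q + 1) → V => f (w 0) (w ∘ Fin.succ)) v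
  rw [Fintype.card_fin] at h
  rw [← h]
  congr 1

end Shuffle

/-! ## The wedge product -/

section Wedge

variable {V : Type*} [NormedAddCommGroup V] [NormedSpace ℝ V] {q r s : ℕ}

-- Shuffles represent the cosets of `S_q × S_r` in `S_{q+r}`, and the signed summand is constant on
-- a coset. Since factorials are invertible in `ℝ`, identities for the wedge product can be checked
-- on sums over all permutations, where no choice of shuffles interferes.
open Nat in
theorem wedge_eq_altSum (a : V [⋀^Fin q]→L[ℝ] ℝ) (b : V [⋀^Fin r]→L[ℝ] ℝ) (v : Fin (q + r) → V) :
    (q ! * r ! : ℝ) * wedge a b v =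
      altSum (fun w : Fin (q + r) → V => a (w ∘ Fin.castAdd r) * b (w ∘ Fin.natAdd q)) v := by
  have h := congrArg (fun m => LinearMap.mul' ℝ ℝ (m (v ∘ finSumFinEquiv)))
    (MultilinearMap.domCoprod_alternization_eq a.toAlternatingMap b.toAlternatingMap)
  simp only [AlternatingMap.smul_apply, map_nsmul, Fintype.card_fin] at h
  rw [nsmul_eq_mul, Nat.cast_mul] at h
  refine h.symm.trans ?_
  rw [MultilinearMap.alternatization_apply, map_sum, altSum_equiv finSumFinEquiv, altSum]
  refine Finset.sum_congr rfl fun σ _ => ?_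
  rw [rsign_apply, MultilinearMap.domDomCongr_apply, MultilinearMap.domCoprod_apply,
    Units.smul_def, map_zsmul, zsmul_eq_mul, LinearMap.mul'_apply]
  congr 2
  · change a _ = a _
    congr 1; ext i; simp
  · change b _ = b _
    congr 1; ext i; simp

open Nat in
theorem wedge_apply_eq (a : V [⋀^Fin q]→L[ℝ] ℝ) (b : V [⋀^Fin r]→L[ℝ] ℝ) (v : Fin (q + r) → V) :
    wedge a b v = (q ! * r ! : ℝ)⁻¹ *
      altSum (fun w : Fin (q + r) → V => a (w ∘ Fin.castAdd r) * b (w ∘ Fin.natAdd q)) v := by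
  rw [← wedge_eq_altSum, inv_mul_cancel_left₀]
  positivity

theorem wedge_add_left (a a' : V [⋀^Fin q]→L[ℝ] ℝ) (b : V [⋀^Fin r]→L[ℝ] ℝ) :
    wedge (a + a') b = wedge a b + wedge a' b := by
  ext v
  simp only [wedge_apply_eq, ContinuousAlternatingMap.add_apply, altSum, ← mul_add,
    ← Finset.sum_add_distrib, add_mul]

theorem wedge_add_right (a : V [⋀^Fin q]→L[ℝ] ℝ) (b b' : V [⋀^Fin r]→L[ℝ] ℝ) :
    wedge a (b + b') = wedge a b + wedge a b' := by
  ext v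
  simp only [wedge_apply_eq, ContinuousAlternatingMap.add_apply, altSum, ← mul_add,
    ← Finset.sum_add_distrib]

theorem wedge_smul_left (c : ℝ) (a : V [⋀^Fin q]→L[ℝ] ℝ) (b : V [⋀^Fin r]→L[ℝ] ℝ) :
    wedge (c • a) b = c • wedge a b := by
  ext v
  simp only [wedge_apply_eq, ContinuousAlternatingMap.smul_apply, smul_eq_mul, mul_assoc,
    altSum_mul_left]
  ring

theorem wedge_smul_right (c : ℝ) (a : V [⋀^Fin q]→L[ℝ] ℝ) (b : V [⋀^Fin r]→L[ℝ] ℝ) :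
    wedge a (c • b) = c • wedge a b := by
  ext v
  simp only [wedge_apply_eq, ContinuousAlternatingMap.smul_apply, smul_eq_mul, mul_left_comm _ c,
    altSum_mul_left]

theorem wedge_compContinuousLinearMap {W : Type*} [NormedAddCommGroup W] [NormedSpace ℝ W]
    (a : V [⋀^Fin q]→L[ℝ] ℝ) (b : V [⋀^Fin r]→L[ℝ] ℝ) (f : W →L[ℝ] V) :
    (wedge a b).compContinuousLinearMap f =
      wedge (a.compContinuousLinearMap f) (b.compContinuousLinearMap f) := by
  ext v
  rw [ContinuousAlternatingMap.compContinuousLinearMap_apply, wedge_apply_eq, wedge_apply_eq]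
  rfl

-- A crude estimate by the number of permutations. Its purpose is to make the wedge product a
-- continuous bilinear map, so that the product rule for derivatives applies to it.
open Nat in
theorem norm_wedge_le (a : V [⋀^Fin q]→L[ℝ] ℝ) (b : V [⋀^Fin r]→L[ℝ] ℝ) :
    ‖wedge a b‖ ≤ (q ! * r ! : ℝ)⁻¹ * (q + r)! * ‖a‖ * ‖b‖ := by
  refine ContinuousAlternatingMap.opNorm_le_bound _ (by positivity) fun v => ?_
  rw [wedge_apply_eq, norm_mul, Real.norm_of_nonneg (by positivity), mul_assoc, mul_assoc, mul_assoc]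
  gcongr
  refine (norm_sum_le _ _).trans ?_
  have h : ∀ σ : Equiv.Perm (Fin (q + r)), ‖rsign σ *
      (a ((v ∘ σ) ∘ Fin.castAdd r) * b ((v ∘ σ) ∘ Fin.natAdd q))‖ ≤
      ‖a‖ * (‖b‖ * ∏ i, ‖v i‖) := fun σ => by
    rw [norm_mul, Real.norm_eq_abs, abs_rsign, one_mul, norm_mul,
      ← Equiv.prod_comp σ, Fin.prod_univ_add]
    calc _ ≤ (‖a‖ * ∏ i, ‖((v ∘ σ) ∘ Fin.castAdd r) i‖) *
          (‖b‖ * ∏ i, ‖((v ∘ σ) ∘ Fin.natAdd q) i‖) := by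
          gcongr <;> exact ContinuousAlternatingMap.le_opNorm _ _
      _ = _ := by simp only [Function.comp_apply]; ring
  refine (Finset.sum_le_sum fun σ _ => h σ).trans ?_
  rw [Finset.sum_const, Finset.card_univ, Fintype.card_perm, Fintype.card_fin, nsmul_eq_mul]

variable (V) in
open Nat in
/-- The wedge product as a continuous bilinear map. -/
def wedgeCLM (q r : ℕ) :
    V [⋀^Fin q]→L[ℝ] ℝ →L[ℝ] V [⋀^Fin r]→L[ℝ] ℝ →L[ℝ] V [⋀^Fin (q + r)]→L[ℝ] ℝ :=
  LinearMap.mkContinuous₂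
    (LinearMap.mk₂ ℝ wedge wedge_add_left wedge_smul_left wedge_add_right wedge_smul_right)
    ((q ! * r ! : ℝ)⁻¹ * (q + r)!) norm_wedge_le

/-- Expanding the inner wedge yields a partial antisymmetrisation, which `altSum_permLeft` turns
into the factor `(q + r)!` that the outer wedge divides by. What remains is a sum over permutations
in which `a`, `b` and `c` play the same part, so both bracketings lead to it. -/
theorem wedge_wedge_apply (a : V [⋀^Fin q]→L[ℝ] ℝ) (b : V [⋀^Fin r]→L[ℝ] ℝ)
    (c : V [⋀^Fin s]→L[ℝ] ℝ) (v : Fin (q + r + s) → V) :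
    (q.factorial * r.factorial * s.factorial : ℝ) * wedge (wedge a b) c v =
      altSum (fun w : Fin (q + r + s) → V => a (w ∘ Fin.castAdd s ∘ Fin.castAdd r) *
        b (w ∘ Fin.castAdd s ∘ Fin.natAdd q) * c (w ∘ Fin.natAdd (q + r))) v := by
  have h := altSum_permLeft (r := s) (fun (x : Fin (q + r) → V) y =>
    a (x ∘ Fin.castAdd r) * b (x ∘ Fin.natAdd q) * c y) v
  have h1 : ∀ w : Fin (q + r + s) → V, altSum (fun x : Fin (q + r) → V => a (x ∘ Fin.castAdd r) *
      b (x ∘ Fin.natAdd q) * c (w ∘ Fin.natAdd (q + r))) (w ∘ Fin.castAdd s) =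
      (q.factorial * r.factorial) * (wedge a b (w ∘ Fin.castAdd s) * c (w ∘ Fin.natAdd (q + r))) :=
    fun w => by
      rw [← mul_assoc, wedge_eq_altSum, mul_comm _ (c _), ← altSum_mul_left]
      congr 1; ext; ring
  simp only [h1, altSum_mul_left, ← wedge_eq_altSum] at h
  have h0 : ((q + r).factorial : ℝ) ≠ 0 := by positivity
  refine mul_left_cancel₀ h0 (Eq.trans ?_ h)
  ring

theorem wedge_wedge_apply' (a : V [⋀^Fin q]→L[ℝ] ℝ) (b : V [⋀^Fin r]→L[ℝ] ℝ)
    (c : V [⋀^Fin s]→L[ℝ] ℝ) (v : Fin (q + (r + s)) → V) :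
    (q.factorial * r.factorial * s.factorial : ℝ) * wedge a (wedge b c) v =
      altSum (fun w : Fin (q + (r + s)) → V => a (w ∘ Fin.castAdd (r + s)) *
        b (w ∘ Fin.natAdd q ∘ Fin.castAdd s) * c (w ∘ Fin.natAdd q ∘ Fin.natAdd r)) v := by
  have h := altSum_permRight (q := q) (fun x (y : Fin (r + s) → V) =>
    a x * b (y ∘ Fin.castAdd s) * c (y ∘ Fin.natAdd r)) v
  have h1 : ∀ w : Fin (q + (r + s)) → V, altSum (fun y : Fin (r + s) → V =>
      a (w ∘ Fin.castAdd (r + s)) * b (y ∘ Fin.castAdd s) * c (y ∘ Fin.natAdd r))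
        (w ∘ Fin.natAdd q) =
      (r.factorial * s.factorial) * (a (w ∘ Fin.castAdd (r + s)) * wedge b c (w ∘ Fin.natAdd q)) :=
    fun w => by
      rw [mul_left_comm, wedge_eq_altSum, ← altSum_mul_left]
      congr 1; ext; ring
  simp only [h1, altSum_mul_left, ← wedge_eq_altSum] at h
  have h0 : ((r + s).factorial : ℝ) ≠ 0 := by positivity
  refine mul_left_cancel₀ h0 (Eq.trans ?_ h)
  ring

theorem wedge_assoc_apply (a : V [⋀^Fin q]→L[ℝ] ℝ) (b : V [⋀^Fin r]→L[ℝ] ℝ)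
    (c : V [⋀^Fin s]→L[ℝ] ℝ) (v : Fin (q + (r + s)) → V) :
    wedge (wedge a b) c (v ∘ Fin.cast (Nat.add_assoc q r s)) = wedge a (wedge b c) v := by
  have h0 : (q.factorial * r.factorial * s.factorial : ℝ) ≠ 0 := by positivity
  refine mul_left_cancel₀ h0 ?_
  rw [wedge_wedge_apply, wedge_wedge_apply', altSum_equiv (finCongr (Nat.add_assoc q r s)).symm]
  refine congrArg₂ altSum (funext fun w => ?_) (funext fun i => ?_)
  · refine congrArg₂ (· * ·) (congrArg₂ (· * ·) ?_ ?_) ?_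
    all_goals
      refine congrArg _ (funext fun i => congrArg w (Fin.ext ?_))
      simp [Nat.add_assoc]
  · exact congrArg v (Fin.ext (by simp))

theorem wedge_constOfIsEmpty_right (a : V [⋀^Fin q]→L[ℝ] ℝ) (c : ℝ) :
    wedge a (.constOfIsEmpty ℝ V (Fin 0) c) = c • a := by
  ext v
  rw [wedge_apply_eq]
  have : altSum (fun w : Fin (q + 0) → V => a (w ∘ Fin.castAdd 0) *
      (ContinuousAlternatingMap.constOfIsEmpty ℝ V (Fin 0) c) (w ∘ Fin.natAdd q)) v =
      c * altSum a v := by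
    rw [← altSum_mul_left]
    congr 1; ext w
    exact mul_comm _ _
  rw [this, altSum_self, ContinuousAlternatingMap.smul_apply, Fintype.card_fin]
  simp only [Nat.factorial_zero, smul_eq_mul]
  field_simp
  simp

theorem constOfIsEmpty_wedge_apply (a : V [⋀^Fin q]→L[ℝ] ℝ) (c : ℝ) (v : Fin q → V) :
    wedge (.constOfIsEmpty ℝ V (Fin 0) c) a (v ∘ Fin.cast (Nat.zero_add q)) = c * a v := by
  have h := altSum_equiv (finCongr (Nat.zero_add q)) (fun w : Fin q → V => c * a w) v
  rw [altSum_mul_left, altSum_self, Fintype.card_fin] at h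
  have h' : altSum (fun w : Fin (0 + q) → V =>
      (ContinuousAlternatingMap.constOfIsEmpty ℝ V (Fin 0) c) (w ∘ Fin.castAdd q) *
        a (w ∘ Fin.natAdd 0)) (v ∘ Fin.cast (Nat.zero_add q)) = c * (q.factorial * a v) := by
    rw [h]
    refine congrArg₂ altSum (funext fun w => ?_) rfl
    refine congrArg (c * a ·) (funext fun i => congrArg w (Fin.ext ?_))
    simp
  rw [wedge_apply_eq, h', Nat.factorial_zero]
  have : (q.factorial : ℝ) ≠ 0 := by positivity
  field_simp
  simp

end Wedge
/-! ## The exterior derivative -/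

section ExtDeriv

variable {V W : Type*} [NormedAddCommGroup V] [NormedSpace ℝ V] [NormedAddCommGroup W]
  [NormedSpace ℝ W] {q r : ℕ}

open ContinuousAlternatingMap (alternatizeUncurryFin)

/-- Antisymmetrise the left-hand form once more. It is alternating, so this multiplies it by `(q +
1)!`. On the other hand its `q + 1` terms are signed permutations of a single function, by the
cycles that bring `i` to the front, so each contributes the same signed sum. Dividing by `q + 1`
gives the claim. -/
theorem alternatizeUncurryFin_eq_altSum (A : V →L[ℝ] V [⋀^Fin q]→L[ℝ] ℝ) (v : Fin (q + 1) → V) :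
    (q.factorial : ℝ) * alternatizeUncurryFin A v =
      altSum (fun w : Fin (q + 1) → V => A (w 0) (w ∘ Fin.succ)) v := by
  obtain ⟨f, hf⟩ : ∃ f : (Fin (q + 1) → V) → ℝ, f = fun w => A (w 0) (w ∘ Fin.succ) := ⟨_, rfl⟩
  have h1 : ∀ w : Fin (q + 1) → V, alternatizeUncurryFin A w = ∑ i : Fin (q + 1),
      rsign i.cycleRange.symm * f (w ∘ i.cycleRange.symm) := fun w => by
    rw [ContinuousAlternatingMap.alternatizeUncurryFin_apply]
    refine Finset.sum_congr rfl fun i _ => ?_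
    have h2 : rsign i.cycleRange.symm = (-1 : ℝ) ^ (i : ℕ) := by
      rw [rsign_apply, Equiv.Perm.sign_symm, Fin.sign_cycleRange]; simp
    have h3 : (w ∘ i.cycleRange.symm) ∘ Fin.succ = i.removeNth w := by
      ext j; simp [Fin.removeNth, Fin.cycleRange_symm_succ]
    simp only [h2, hf, h3, Function.comp_apply, Fin.cycleRange_symm_zero, zsmul_eq_mul]
    simp
  have h := altSum_self (alternatizeUncurryFin A) v
  have h4 : altSum (alternatizeUncurryFin A) v = ((q + 1 : ℕ) : ℝ) * altSum f v := by
    rw [show (⇑(alternatizeUncurryFin A) : (Fin (q + 1) → V) → ℝ) = _ from funext h1, altSum_sum]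
    simp only [altSum_mul_left, altSum_comp_perm f, ← mul_assoc, rsign_mul_self, one_mul,
      Finset.sum_const, Finset.card_univ, Fintype.card_fin, nsmul_eq_mul]
  rw [h4, Fintype.card_fin, Nat.factorial_succ, Nat.cast_mul, mul_assoc, hf] at h
  exact (mul_left_cancel₀ (by positivity) h).symm

theorem alternatizeUncurryFin_wedge_left (A : V →L[ℝ] V [⋀^Fin q]→L[ℝ] ℝ)
    (b : V [⋀^Fin r]→L[ℝ] ℝ) (v : Fin (q + r + 1) → V) :
    alternatizeUncurryFin ((wedgeCLM V q r).flip b ∘L A) v =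
      wedge (alternatizeUncurryFin A) b (v ∘ Fin.cast (Nat.add_right_comm q 1 r)) := by
  have h0 : ((q + 1).factorial * (q + r).factorial * (q.factorial * r.factorial) : ℝ) ≠ 0 := by
    positivity
  refine mul_left_cancel₀ h0 ?_
  have hl : ((q + r).factorial * (q.factorial * r.factorial) : ℝ) *
      alternatizeUncurryFin ((wedgeCLM V q r).flip b ∘L A) v = (q + r).factorial *
      altSum (fun w : Fin (q + r + 1) → V => A (w 0) ((w ∘ Fin.succ) ∘ Fin.castAdd r) *
        b ((w ∘ Fin.succ) ∘ Fin.natAdd q)) v := by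
    rw [← altSum_permSucc (fun x (y : Fin (q + r) → V) =>
      A x (y ∘ Fin.castAdd r) * b (y ∘ Fin.natAdd q)) v]
    rw [mul_comm ((q + r).factorial : ℝ), mul_assoc, alternatizeUncurryFin_eq_altSum,
      ← altSum_mul_left]
    simp only [← wedge_eq_altSum]
    rfl
  have hr : (q.factorial * ((q + 1).factorial * r.factorial) : ℝ) *
      wedge (alternatizeUncurryFin A) b (v ∘ Fin.cast (Nat.add_right_comm q 1 r)) =
      (q + 1).factorial *
      altSum (fun w : Fin (q + 1 + r) → V => A ((w ∘ Fin.castAdd r) 0)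
        ((w ∘ Fin.castAdd r) ∘ Fin.succ) * b (w ∘ Fin.natAdd (q + 1)))
        (v ∘ Fin.cast (Nat.add_right_comm q 1 r)) := by
    rw [← altSum_permLeft (fun (x : Fin (q + 1) → V) y => A (x 0) (x ∘ Fin.succ) * b y)]
    rw [mul_assoc, wedge_eq_altSum, ← altSum_mul_left]
    refine congrArg₂ altSum (funext fun w => ?_) rfl
    rw [← mul_assoc, alternatizeUncurryFin_eq_altSum, mul_comm _ (b _), ← altSum_mul_left]
    refine congrArg₂ altSum (funext fun x => mul_comm _ _) rfl
  have hS : altSum (fun w : Fin (q + r + 1) → V => A (w 0) ((w ∘ Fin.succ) ∘ Fin.castAdd r) *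
        b ((w ∘ Fin.succ) ∘ Fin.natAdd q)) v =
      altSum (fun w : Fin (q + 1 + r) → V => A ((w ∘ Fin.castAdd r) 0)
        ((w ∘ Fin.castAdd r) ∘ Fin.succ) * b (w ∘ Fin.natAdd (q + 1)))
        (v ∘ Fin.cast (Nat.add_right_comm q 1 r)) := by
    rw [altSum_equiv (finCongr (Nat.add_right_comm q 1 r)).symm]
    refine congrArg₂ altSum (funext fun w => ?_) (funext fun i => congrArg v (Fin.ext (by simp)))
    refine congrArg₂ (· * ·) (congrArg₂ (fun x y => A x y) ?_ ?_) ?_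
    · exact congrArg w (Fin.ext (by simp))
    · exact funext fun i => congrArg w (Fin.ext (by simp))
    · exact congrArg _ (funext fun i => congrArg w (Fin.ext (by simp; omega)))
  linear_combination ((q + 1).factorial : ℝ) * hl - ((q + r).factorial : ℝ) * hr
    + ((q + 1).factorial : ℝ) * ((q + r).factorial : ℝ) * hS

theorem alternatizeUncurryFin_wedge_right (a : V [⋀^Fin q]→L[ℝ] ℝ)
    (B : V →L[ℝ] V [⋀^Fin r]→L[ℝ] ℝ) (v : Fin (q + r + 1) → V) :
    alternatizeUncurryFin (wedgeCLM V q r a ∘L B) v =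
      (-1 : ℝ) ^ q * wedge a (alternatizeUncurryFin B) v := by
  have h0 : ((r + 1).factorial * (q + r).factorial * (q.factorial * r.factorial) : ℝ) ≠ 0 := by
    positivity
  refine mul_left_cancel₀ h0 ?_
  have hl : ((q + r).factorial * (q.factorial * r.factorial) : ℝ) *
      alternatizeUncurryFin (wedgeCLM V q r a ∘L B) v = (q + r).factorial *
      altSum (fun w : Fin (q + r + 1) → V => a ((w ∘ Fin.succ) ∘ Fin.castAdd r) *
        B (w 0) ((w ∘ Fin.succ) ∘ Fin.natAdd q)) v := by
    rw [← altSum_permSucc (fun x (y : Fin (q + r) → V) =>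
      a (y ∘ Fin.castAdd r) * B x (y ∘ Fin.natAdd q)) v]
    rw [mul_comm ((q + r).factorial : ℝ), mul_assoc, alternatizeUncurryFin_eq_altSum,
      ← altSum_mul_left]
    simp only [← wedge_eq_altSum]
    rfl
  have hr : (r.factorial * (q.factorial * (r + 1).factorial) : ℝ) *
      wedge a (alternatizeUncurryFin B) v = (r + 1).factorial *
      altSum (fun w : Fin (q + (r + 1)) → V => a (w ∘ Fin.castAdd (r + 1)) *
        B ((w ∘ Fin.natAdd q) 0) ((w ∘ Fin.natAdd q) ∘ Fin.succ)) v := by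
    rw [← altSum_permRight (fun x (y : Fin (r + 1) → V) => a x * B (y 0) (y ∘ Fin.succ))]
    rw [mul_assoc, wedge_eq_altSum, ← altSum_mul_left]
    refine congrArg₂ altSum (funext fun w => ?_) rfl
    rw [mul_left_comm, alternatizeUncurryFin_eq_altSum, ← altSum_mul_left]
  -- The argument of the derivative has to move past the `q` arguments of `a`. The cycle that does
  -- this has sign `(-1)^q`, which is the sign in the Leibniz rule.
  let i : Fin (q + r + 1) := ⟨q, by omega⟩
  have hs : rsign i.cycleRange.symm = (-1 : ℝ) ^ q := by
    rw [rsign_apply, Equiv.Perm.sign_symm, Fin.sign_cycleRange]; simp [i]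
  have hc := altSum_comp_perm (fun w : Fin (q + r + 1) → V =>
    a ((w ∘ Fin.succ) ∘ Fin.castAdd r) * B (w 0) ((w ∘ Fin.succ) ∘ Fin.natAdd q))
    i.cycleRange.symm v
  rw [hs] at hc
  have hg : (fun w : Fin (q + r + 1) → V => a (((w ∘ i.cycleRange.symm) ∘ Fin.succ) ∘
      Fin.castAdd r) * B ((w ∘ i.cycleRange.symm) 0)
        (((w ∘ i.cycleRange.symm) ∘ Fin.succ) ∘ Fin.natAdd q)) =
      (fun w : Fin (q + (r + 1)) → V => a (w ∘ Fin.castAdd (r + 1)) *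
        B ((w ∘ Fin.natAdd q) 0) ((w ∘ Fin.natAdd q) ∘ Fin.succ)) := by
    ext w
    refine congrArg₂ (· * ·) (congrArg _ (funext fun j => ?_))
      (congrArg₂ (fun x y => B x y) ?_ (funext fun j => ?_))
    · simp only [Function.comp_apply, Fin.cycleRange_symm_succ]
      refine congrArg w ?_
      rw [Fin.succAbove_of_castSucc_lt _ _ (by simp [i, Fin.lt_def])]
      rfl
    · simp only [Function.comp_apply, Fin.cycleRange_symm_zero]
      rfl
    · simp only [Function.comp_apply, Fin.cycleRange_symm_succ]
      refine congrArg w ?_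
      rw [Fin.succAbove_of_le_castSucc _ _ (by simp [i, Fin.le_def])]
      rfl
  rw [hg] at hc
  have h2 : (-1 : ℝ) ^ q * (-1 : ℝ) ^ q = 1 := by rw [← mul_pow]; simp
  linear_combination ((r + 1).factorial : ℝ) * hl - (-1 : ℝ) ^ q * ((q + r).factorial : ℝ) * hr
    - (-1 : ℝ) ^ q * ((q + r).factorial : ℝ) * (r + 1).factorial * hc
    - ((r + 1).factorial : ℝ) * ((q + r).factorial : ℝ) * (altSum (fun w : Fin (q + r + 1) → V =>
    a ((w ∘ Fin.succ) ∘ Fin.castAdd r) * B (w 0) ((w ∘ Fin.succ) ∘ Fin.natAdd q)) v) * h2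

theorem extDeriv_wedge {a : V → V [⋀^Fin q]→L[ℝ] ℝ} {b : V → V [⋀^Fin r]→L[ℝ] ℝ} {x : V}
    (ha : DifferentiableAt ℝ a x) (hb : DifferentiableAt ℝ b x) (v : Fin (q + r + 1) → V) :
    extDeriv (fun y => wedge (a y) (b y)) x v =
      wedge (extDeriv a x) (b x) (v ∘ Fin.cast (Nat.add_right_comm q 1 r)) +
        (-1 : ℝ) ^ q * wedge (a x) (extDeriv b x) v := by
  have h := (wedgeCLM V q r).hasFDerivAt_of_bilinear ha.hasFDerivAt hb.hasFDerivAt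
  have h' : fderiv ℝ (fun y => wedge (a y) (b y)) x =
      wedgeCLM V q r (a x) ∘L fderiv ℝ b x + (wedgeCLM V q r).flip (b x) ∘L fderiv ℝ a x :=
    h.fderiv
  rw [extDeriv, h', ContinuousAlternatingMap.alternatizeUncurryFin_add,
    ContinuousAlternatingMap.add_apply, alternatizeUncurryFin_wedge_left,
    alternatizeUncurryFin_wedge_right, add_comm]
  rfl

/-- The exterior derivative of a form pulled back by means of a field of linear maps that agrees,
up to first order, with the derivative of a map. -/
theorem extDeriv_compContinuousLinearMap {μ : W → W [⋀^Fin q]→L[ℝ] ℝ} {κ : V → W}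
    {L : V → V →L[ℝ] W} {L' : V →L[ℝ] V →L[ℝ] W} {x : V} (hμ : DifferentiableAt ℝ μ (κ x))
    (hκ : HasFDerivAt κ (L x) x) (hL : HasFDerivAt L L' x) (hs : ∀ v w, L' v w = L' w v) :
    extDeriv (fun y => (μ (κ y)).compContinuousLinearMap (L y)) x =
      (extDeriv μ (κ x)).compContinuousLinearMap (L x) := by
  have h := (hμ.hasFDerivAt.comp x hκ).continuousAlternatingMapCompContinuousLinearMap hL
  rw [extDeriv]
  erw [h.fderiv]
  -- The product rule gives one term with the derivative of `μ` and one with `L'` inserted into an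
  -- argument. The second is antisymmetrised to zero because `L'` is symmetric. Nothing relates `L`
  -- to the derivative of `κ` at points other than `x`.
  rw [ContinuousAlternatingMap.alternatizeUncurryFin_add,
    ContinuousAlternatingMap.alternatizeUncurryFin_fderivCompContinuousLinearMap_eq_zero, add_zero]
  · ext v
    simp +unfoldPartialApp [ContinuousAlternatingMap.alternatizeUncurryFin_apply, Fin.removeNth,
      Function.comp_def, extDeriv]
  · exact hs

end ExtDeriv
/-! ## The double complex of a cosimplicial DGA -/

section DegCast

variable {C : ℕ → ℕ → Type*} [∀ p q, AddCommGroup (C p q)] [∀ p q, Module ℝ (C p q)]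
  {p p' p'' q q' q'' : ℕ}

@[simp]
theorem degCast_degCast (hp : p = p') (hq : q = q') (hp' : p' = p'') (hq' : q' = q'') (a : C p q) :
    degCast hp' hq' (degCast hp hq a) = degCast (hp.trans hp') (hq.trans hq') a := by
  subst hp hq hp' hq'; rfl

theorem degCast_eq_iff (hp : p = p') (hq : q = q') (a : C p q) (b : C p' q') :
    degCast hp hq a = b ↔ a = degCast hp.symm hq.symm b := by
  subst hp hq; rfl

end DegCast

namespace CosimplicialDGA

variable {C : ℕ → ℕ → Type*} [∀ p q, AddCommGroup (C p q)] [∀ p q, Module ℝ (C p q)]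
  (Ω : CosimplicialDGA C) {p p' p'' q q' q'' r r' : ℕ}

/-- The coface with a natural number as its index; it is zero if the index is out of range. -/
def faceN (i : ℕ) : C p q →ₗ[ℝ] C (p + 1) q := if h : i < p + 2 then Ω.face ⟨i, h⟩ else 0

theorem faceN_eq {i : ℕ} (h : i < p + 2) (a : C p q) : Ω.faceN i a = Ω.face ⟨i, h⟩ a := by
  rw [faceN, dif_pos h]

theorem face_eq_faceN (i : Fin (p + 2)) (a : C p q) : Ω.face i a = Ω.faceN i a :=
  (Ω.faceN_eq i.2 a).symm

theorem faceN_faceN {i j : ℕ} (hij : i ≤ j) (hj : j < p + 2) (a : C p q) :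
    Ω.faceN (j + 1) (Ω.faceN i a) = Ω.faceN i (Ω.faceN j a) := by
  rw [Ω.faceN_eq (by omega) (Ω.faceN i a), Ω.faceN_eq (by omega) a, Ω.faceN_eq hj a,
    Ω.faceN_eq (by omega)]
  exact Ω.face_face ⟨i, by omega⟩ ⟨j, hj⟩ hij a

theorem δ_eq_sum (a : C p q) :
    Ω.δ a = ∑ i ∈ Finset.range (p + 2), (-1 : ℝ) ^ i • Ω.faceN i a := by
  rw [Finset.sum_range, δ, LinearMap.sum_apply]
  exact Finset.sum_congr rfl fun i _ => by rw [LinearMap.smul_apply, face_eq_faceN]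

theorem faceN_wedge {i : ℕ} (h : i < p + 2) (a : C p q) (b : C p r) :
    Ω.faceN i (Ω.wedge a b) = Ω.wedge (Ω.faceN i a) (Ω.faceN i b) := by
  simp only [Ω.faceN_eq h, Ω.face_wedge]

theorem faceN_d (i : ℕ) (a : C p q) : Ω.faceN i (Ω.d a) = Ω.d (Ω.faceN i a) := by
  by_cases h : i < p + 2
  · simp only [Ω.faceN_eq h, Ω.face_d]
  · simp [faceN, dif_neg h]

/-! ### Compatibility with transport -/

theorem faceN_degCast (hp : p = p') (hq : q = q') (i : ℕ) (a : C p q) :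
    Ω.faceN i (degCast hp hq a) = degCast (congrArg (· + 1) hp) hq (Ω.faceN i a) := by
  subst hp hq; rfl

theorem d_degCast (hp : p = p') (hq : q = q') (a : C p q) :
    Ω.d (degCast hp hq a) = degCast hp (congrArg (· + 1) hq) (Ω.d a) := by
  subst hp hq; rfl

theorem wedge_degCast (hp : p = p') (hq : q = q') (hr : r = r') (a : C p q) (b : C p r) :
    Ω.wedge (degCast hp hq a) (degCast hp hr b) =
      degCast hp (congrArg₂ (· + ·) hq hr) (Ω.wedge a b) := by
  subst hp hq hr; rfl

theorem first_degCast (hp : p = p') (hq : q = q') (n : ℕ) (a : C p q) :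
    Ω.first n (degCast hp hq a) = degCast (congrArg (· + n) hp) hq (Ω.first n a) := by
  subst hp hq; rfl

theorem dropFirst_degCast (hp : p = p') (hq : q = q') (n : ℕ) (a : C p q) :
    Ω.dropFirst n (degCast hp hq a) = degCast (congrArg (· + n) hp) hq (Ω.dropFirst n a) := by
  subst hp hq; rfl

theorem dropFirst_index {n m : ℕ} (h : n = m) (a : C p q) :
    Ω.dropFirst n a = degCast (congrArg (p + ·) h.symm) rfl (Ω.dropFirst m a) := by
  subst h; rfl

theorem first_index {n m : ℕ} (h : n = m) (a : C p q) :
    Ω.first n a = degCast (congrArg (p + ·) h.symm) rfl (Ω.first m a) := by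
  subst h; rfl

theorem faceN_congr {i j : ℕ} (h : i = j) (a : C p q) : Ω.faceN i a = Ω.faceN j a := by rw [h]

theorem degCast_wedge (hp : p = p') (h : q + r = q + r) (a : C p q) (b : C p r) :
    degCast hp h (Ω.wedge a b) = Ω.wedge (degCast hp rfl a) (degCast hp rfl b) := by
  subst hp; rfl

theorem one_degCast (hp : p = p') : degCast hp rfl (Ω.one p) = Ω.one p' := by subst hp; rfl

/-! ### First and last arrows -/

theorem first_succ (n : ℕ) (a : C p q) : Ω.first (n + 1) a = Ω.faceN (p + n + 1) (Ω.first n a) := by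
  rw [Ω.faceN_eq (by omega)]; rfl

theorem dropFirst_succ (n : ℕ) (a : C p q) :
    Ω.dropFirst (n + 1) a = Ω.faceN 0 (Ω.dropFirst n a) := by
  rw [Ω.faceN_eq (by omega)]; rfl

theorem first_wedge (n : ℕ) (a : C p q) (b : C p r) :
    Ω.first n (Ω.wedge a b) = Ω.wedge (Ω.first n a) (Ω.first n b) := by
  induction n with
  | zero => rfl
  | succ n ih => rw [first_succ, ih, faceN_wedge _ (by omega)]; simp only [first_succ]

theorem dropFirst_wedge (n : ℕ) (a : C p q) (b : C p r) :
    Ω.dropFirst n (Ω.wedge a b) = Ω.wedge (Ω.dropFirst n a) (Ω.dropFirst n b) := by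
  induction n with
  | zero => rfl
  | succ n ih => rw [dropFirst_succ, ih, faceN_wedge _ (by omega)]; simp only [dropFirst_succ]

theorem first_d (n : ℕ) (a : C p q) : Ω.first n (Ω.d a) = Ω.d (Ω.first n a) := by
  induction n with
  | zero => rfl
  | succ n ih => rw [first_succ, ih, faceN_d, first_succ]

theorem dropFirst_d (n : ℕ) (a : C p q) : Ω.dropFirst n (Ω.d a) = Ω.d (Ω.dropFirst n a) := by
  induction n with
  | zero => rfl
  | succ n ih => rw [dropFirst_succ, ih, faceN_d, dropFirst_succ]

theorem first_one (n : ℕ) : Ω.first n (Ω.one p) = Ω.one (p + n) := by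
  induction n with
  | zero => rfl
  | succ n ih => rw [first_succ, ih, faceN_eq _ (by omega), face_one]; rfl

theorem dropFirst_one (n : ℕ) : Ω.dropFirst n (Ω.one p) = Ω.one (p + n) := by
  induction n with
  | zero => rfl
  | succ n ih => rw [dropFirst_succ, ih, faceN_eq _ (by omega), face_one]; rfl

theorem faceN_first_of_le {i : ℕ} (hi : i ≤ p) (n : ℕ) (a : C p q) :
    Ω.faceN i (Ω.first n a) = degCast (Nat.add_right_comm p 1 n) rfl (Ω.first n (Ω.faceN i a)) := by
  induction n with
  | zero => rfl
  | succ n ih =>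
    rw [first_succ, ← Ω.faceN_faceN (p := p + n) (by omega) (by omega), ih, faceN_degCast,
      first_succ, Ω.faceN_congr (show p + n + 1 + 1 = p + 1 + n + 1 by omega)]

/-- A face `d_i` with `i > p` leaves the first `p` arrows untouched, so after it the same `p` arrows
are kept. -/
theorem faceN_first_of_gt {i n : ℕ} (hi : p < i) (hi' : i < p + n + 2) (a : C p q) :
    Ω.faceN i (Ω.first n a) = Ω.first (n + 1) a := by
  induction n with
  | zero => rw [first_succ, show i = p + 0 + 1 by omega]
  | succ n ih =>
    rcases (show i ≤ p + n + 2 by omega).eq_or_lt with h | h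
    · rw [h, first_succ _ (n + 1)]; rfl
    · rw [first_succ, ← Ω.faceN_faceN (p := p + n) (by omega) (by omega), ih h, first_succ _ (n + 1)]; rfl

theorem faceN_dropFirst_of_le {i n : ℕ} (hi : i ≤ n) (a : C p q) :
    Ω.faceN i (Ω.dropFirst n a) = Ω.dropFirst (n + 1) a := by
  induction n generalizing i with
  | zero => rw [dropFirst_succ, show i = 0 by omega]
  | succ n ih =>
    rcases i with _ | i
    · rw [dropFirst_succ _ (n + 1)]
    · rw [dropFirst_succ, Ω.faceN_faceN (p := p + n) (by omega) (by omega), ih (by omega),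
        dropFirst_succ _ (n + 1)]

/-- A face whose index exceeds the number `n` of dropped arrows acts on the remaining ones, with its
index lowered by `n`. -/
theorem faceN_dropFirst_add {i : ℕ} (hi : i < p + 2) (n : ℕ) (a : C p q) :
    Ω.faceN (i + n) (Ω.dropFirst n a) =
      degCast (Nat.add_right_comm p 1 n) rfl (Ω.dropFirst n (Ω.faceN i a)) := by
  induction n with
  | zero => rfl
  | succ n ih =>
    rw [dropFirst_succ, Ω.faceN_congr (show i + (n + 1) = i + n + 1 from rfl),
      Ω.faceN_faceN (p := p + n) (by omega) (by omega), ih, faceN_degCast, dropFirst_succ]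

theorem first_first (m n : ℕ) (a : C p q) :
    Ω.first n (Ω.first m a) = degCast (Nat.add_assoc p m n).symm rfl (Ω.first (m + n) a) := by
  induction n with
  | zero => rfl
  | succ n ih =>
    rw [first_succ, ih, faceN_degCast, Ω.faceN_congr (show p + m + n + 1 = p + (m + n) + 1 by omega),
      ← first_succ]
    rfl

theorem dropFirst_dropFirst (m n : ℕ) (a : C p q) :
    Ω.dropFirst n (Ω.dropFirst m a) =
      degCast (Nat.add_assoc p m n).symm rfl (Ω.dropFirst (m + n) a) := by
  induction n with
  | zero => rfl
  | succ n ih =>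
    rw [dropFirst_succ, ih, faceN_degCast, ← dropFirst_succ]
    rfl

theorem first_dropFirst (m n : ℕ) (a : C p q) :
    Ω.first n (Ω.dropFirst m a) =
      degCast (Nat.add_right_comm p n m) rfl (Ω.dropFirst m (Ω.first n a)) := by
  induction n with
  | zero => rfl
  | succ n ih =>
    rw [first_succ, ih, faceN_degCast,
      Ω.faceN_congr (show p + m + n + 1 = (p + n + 1) + m by omega), faceN_dropFirst_add _ (by omega), first_succ, degCast_degCast]

/-! ### The cup product -/

theorem cup_apply (a : C p q) (b : C p' q') :
    Ω.cup a b = Ω.wedge (Ω.first p' a) (degCast (Nat.add_comm p' p) rfl (Ω.dropFirst p b)) := rfl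

theorem cup_assoc (a : C p q) (b : C p' q') (c : C p'' q'') :
    degCast (Nat.add_assoc p p' p'') (Nat.add_assoc q q' q'') (Ω.cup (Ω.cup a b) c) =
      Ω.cup a (Ω.cup b c) := by
  simp only [cup_apply, first_wedge, dropFirst_wedge, first_degCast, dropFirst_degCast,
    first_first, first_dropFirst, dropFirst_dropFirst, degCast_degCast, degCast_wedge]
  rw [← Ω.wedge_assoc, degCast_eq_iff]
  simp only [degCast_wedge, degCast_degCast]
  rw [Ω.dropFirst_index (Nat.add_comm p p'), degCast_degCast]

theorem one_cup (a : C p q) :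
    degCast (Nat.zero_add p) (Nat.zero_add q) (Ω.cup (Ω.one 0) a) = a := by
  have h := Ω.one_wedge a
  rw [cup_apply, first_one, ← Ω.one_degCast (Nat.zero_add p).symm, dropFirst_index _ rfl]
  change degCast _ _ (Ω.wedge (degCast _ rfl _) (degCast _ rfl a)) = _
  rw [wedge_degCast, degCast_degCast, h]

theorem cup_one (a : C p q) : Ω.cup a (Ω.one 0) = a := by
  rw [cup_apply, dropFirst_one, one_degCast]
  exact Ω.wedge_one a

theorem d_cup (a : C p q) (b : C p' q') :
    Ω.d (Ω.cup a b) = degCast rfl (Nat.add_right_comm q 1 q') (Ω.cup (Ω.d a) b)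
      + (-1 : ℝ) ^ q • degCast rfl (Nat.add_assoc q q' 1).symm (Ω.cup a (Ω.d b)) := by
  simp only [cup_apply, d_wedge, d_degCast, first_d, dropFirst_d]

theorem faceN_cup_of_le {i : ℕ} (hi : i ≤ p) (a : C p q) (b : C p' q') :
    Ω.faceN i (Ω.cup a b) = degCast (Nat.add_right_comm p 1 p') rfl (Ω.cup (Ω.faceN i a) b) := by
  rw [cup_apply, faceN_wedge _ (by omega), faceN_first_of_le _ hi, faceN_degCast,
    faceN_dropFirst_of_le _ hi, cup_apply, degCast_wedge, degCast_degCast]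

theorem faceN_cup_add {i : ℕ} (hi : i < p' + 1) (a : C p q) (b : C p' q') :
    Ω.faceN (p + 1 + i) (Ω.cup a b) =
      degCast (Nat.add_assoc p p' 1).symm rfl (Ω.cup a (Ω.faceN (i + 1) b)) := by
  rw [cup_apply, faceN_wedge _ (by omega), faceN_first_of_gt _ (by omega) (by omega), faceN_degCast,
    show p + 1 + i = i + 1 + p by omega, faceN_dropFirst_add _ (by omega), cup_apply,
    degCast_degCast]
  rfl

/-- On a string of `p + 1 + p'` arrows, both sides evaluate `a` on the first `p` arrows and `b` on
the last `p'`, and ignore the arrow in between. -/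
theorem cup_faceN_last (a : C p q) (b : C p' q') :
    degCast (Nat.add_right_comm p 1 p') rfl (Ω.cup (Ω.faceN (p + 1) a) b) =
      degCast (Nat.add_assoc p p' 1).symm rfl (Ω.cup a (Ω.faceN 0 b)) := by
  have h1 : Ω.faceN (p + 1) a = Ω.first 1 a := (Ω.first_succ 0 a).symm
  have h2 : Ω.faceN 0 b = Ω.dropFirst 1 b := (Ω.dropFirst_succ 0 b).symm
  rw [cup_apply, cup_apply, h1, h2, first_first, dropFirst_dropFirst]
  simp only [degCast_wedge, degCast_degCast]
  rw [Ω.dropFirst_index (Nat.add_comm 1 p), Ω.first_index (Nat.add_comm 1 p'), degCast_degCast,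
    degCast_degCast]

theorem δ_cup (a : C p q) (b : C p' q') :
    Ω.δ (Ω.cup a b) = degCast (Nat.add_right_comm p 1 p') rfl (Ω.cup (Ω.δ a) b)
      + (-1 : ℝ) ^ p • degCast (Nat.add_assoc p p' 1).symm rfl (Ω.cup a (Ω.δ b)) := by
  have h1 : Ω.δ (Ω.cup a b) = ∑ i ∈ Finset.range (p + 1), (-1 : ℝ) ^ i •
      degCast (Nat.add_right_comm p 1 p') rfl (Ω.cup (Ω.faceN i a) b) +
      ∑ i ∈ Finset.range (p' + 1), (-1 : ℝ) ^ (p + 1 + i) •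
        degCast (Nat.add_assoc p p' 1).symm rfl (Ω.cup a (Ω.faceN (i + 1) b)) := by
    rw [δ_eq_sum, show p + p' + 2 = p + 1 + (p' + 1) by omega, Finset.sum_range_add]
    refine congrArg₂ (· + ·) (Finset.sum_congr rfl fun i hi => ?_)
      (Finset.sum_congr rfl fun i hi => ?_)
    · rw [faceN_cup_of_le _ (by have := Finset.mem_range.1 hi; omega)]
    · rw [faceN_cup_add _ (Finset.mem_range.1 hi)]
  -- The cofaces of `a ∪ b` account for all cofaces of `a` but the last and all cofaces of `b` but
  -- the zeroth. The two left over are equal by `cup_faceN_last`, and their signs `(-1)^(p+1)` and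
  -- `(-1)^p` cancel.
  rw [h1, δ_eq_sum, δ_eq_sum, Finset.sum_range_succ _ (p + 1), Finset.sum_range_succ' _ (p' + 1)]
  simp only [map_add, map_sum, map_smul, LinearMap.add_apply, LinearMap.sum_apply,
    LinearMap.smul_apply, cup_faceN_last, smul_add, Finset.smul_sum, smul_smul, pow_zero, one_smul]
  rw [pow_succ, mul_neg_one, neg_smul]
  have h2 : ∀ i, (-1 : ℝ) ^ (p + 1 + i) = (-1) ^ p * (-1) ^ (i + 1) := fun i => by ring
  simp only [h2]
  abel

/-- The terms cancel in the pairs `(i, j)`, `(j + 1, i)` with `i ≤ j`. Raising `n` by one adds one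
row and one column to the rectangle of indices, and these cancel against each other. -/
theorem sum_range_sum_range_eq_zero {M : Type*} [AddCommGroup M] (g : ℕ → ℕ → M) (n : ℕ)
    (h : ∀ i j, i ≤ j → j < n → g (j + 1) i = -g i j) :
    ∑ i ∈ Finset.range (n + 1), ∑ j ∈ Finset.range n, g i j = 0 := by
  induction n with
  | zero => simp
  | succ n ih =>
    rw [Finset.sum_range_succ, Finset.sum_congr rfl fun i _ => Finset.sum_range_succ (g i) n,
      Finset.sum_add_distrib, ih fun i j hij hj => h i j hij (by omega), zero_add,
      ← Finset.sum_add_distrib]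
    refine Finset.sum_eq_zero fun i hi => ?_
    rw [h i n (by have := Finset.mem_range.1 hi; omega) (by omega), add_neg_cancel]

theorem δ_δ (a : C p q) : Ω.δ (Ω.δ a) = 0 := by
  rw [δ_eq_sum, δ_eq_sum]
  simp only [map_sum, map_smul, Finset.smul_sum, smul_smul]
  refine sum_range_sum_range_eq_zero _ _ fun i j hij hj => ?_
  rw [faceN_faceN _ hij hj, ← neg_smul]
  congr 1
  ring

theorem d_δ (a : C p q) : Ω.d (Ω.δ a) = Ω.δ (Ω.d a) := by
  simp only [δ_eq_sum, map_sum, map_smul, faceN_d]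

/-! ### The total complex -/

theorem toTot_degCast (hp : p = p') (hq : q = q') (a : C p q) :
    toTot p' q' (degCast hp hq a) = toTot p q a := by
  subst hp hq; rfl

theorem tot_induction {P : Tot C → Prop} (h0 : P 0) (hadd : ∀ a b, P a → P b → P (a + b))
    (h : ∀ p q (a : C p q), P (toTot p q a)) (a : Tot C) : P a := by
  induction a using DirectSum.induction_on with
  | zero => exact h0
  | of i x => exact h i.1 i.2 x
  | add a b ha hb => exact hadd a b ha hb

@[simp]
theorem totD_toTot (a : C p q) :
    Ω.totD (toTot p q a) = toTot (p + 1) q (Ω.δ a) + (-1 : ℝ) ^ p • toTot p (q + 1) (Ω.d a) := by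
  rw [totD, toTot, DirectSum.toModule_lof]; rfl

@[simp]
theorem totCup_toTot (a : C p q) (b : C p' q') :
    Ω.totCup (toTot p q a) (toTot p' q' b) =
      (-1 : ℝ) ^ (q * p') • toTot (p + p') (q + q') (Ω.cup a b) := by
  rw [totCup, toTot, DirectSum.toModule_lof, LinearMap.flip_apply, toTot, DirectSum.toModule_lof]
  rfl

theorem totD_totD (a : Tot C) : Ω.totD (Ω.totD a) = 0 := by
  induction a using tot_induction with
  | h0 => simp
  | hadd a b ha hb => rw [map_add, map_add, ha, hb, add_zero]
  | h p q a =>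
    simp only [totD_toTot, map_add, map_smul, δ_δ, Ω.d_d, map_zero, d_δ, smul_zero, add_zero, zero_add]
    rw [pow_succ, mul_neg_one, neg_smul, neg_add_cancel]

theorem totCup_assoc (a b c : Tot C) :
    Ω.totCup (Ω.totCup a b) c = Ω.totCup a (Ω.totCup b c) := by
  induction a using tot_induction with
  | h0 => simp
  | hadd a a' ha ha' => simp only [map_add, LinearMap.add_apply, ha, ha']
  | h p q a =>
  induction b using tot_induction with
  | h0 => simp
  | hadd a a' ha ha' => simp only [map_add, LinearMap.add_apply, ha, ha']
  | h p' q' b =>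
  induction c using tot_induction with
  | h0 => simp
  | hadd a a' ha ha' => simp only [map_add, ha, ha']
  | h p'' q'' c =>
    simp only [totCup_toTot, map_smul, LinearMap.smul_apply, smul_smul]
    rw [← cup_assoc, toTot_degCast]
    congr 1
    ring

theorem totD_totCup_toTot (a : C p q) (b : Tot C) :
    Ω.totD (Ω.totCup (toTot p q a) b) = Ω.totCup (Ω.totD (toTot p q a)) b +
      (-1 : ℝ) ^ (p + q) • Ω.totCup (toTot p q a) (Ω.totD b) := by
  induction b using tot_induction with
  | h0 => simp
  | hadd b b' hb hb' =>
    simp only [map_add, hb, hb', smul_add]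
    abel
  | h p' q' b =>
    simp only [totCup_toTot, totD_toTot, map_smul, map_add, LinearMap.add_apply,
      LinearMap.smul_apply, δ_cup, d_cup, toTot_degCast, smul_add, smul_smul]
    have h2 : (-1 : ℝ) ^ q * (-1) ^ q = 1 := by rw [← mul_pow]; simp
    -- The exponent `q p'` grows by `q` when `δ` raises `p'` and by `p'` when `d` raises `q`. These
    -- changes convert the signs `(-1)^p` and `(-1)^q` of the two Leibniz rules into the single sign
    -- `(-1)^(p+q)`.
    have e1 : (-1 : ℝ) ^ (p + q) * (-1) ^ (q * (p' + 1)) = (-1) ^ (q * p') * (-1) ^ p := by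
      rw [mul_add, mul_one, pow_add, pow_add]; linear_combination (-1) ^ (q * p') * (-1) ^ p * h2
    have e2 : (-1 : ℝ) ^ p * (-1) ^ ((q + 1) * p') = (-1) ^ (q * p') * (-1) ^ (p + p') := by
      rw [add_mul, one_mul, pow_add, pow_add]; ring
    have e3 : (-1 : ℝ) ^ (p + q) * ((-1) ^ p' * (-1) ^ (q * p')) =
        (-1) ^ (q * p') * ((-1) ^ (p + p') * (-1) ^ q) := by
      rw [pow_add, pow_add]; ring
    simp only [e1, e2, e3]
    abel

theorem totD_totCup (k : ℕ) (a b : Tot C) (h : IsTotDegree k a) :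
    Ω.totD (Ω.totCup a b) = Ω.totCup (Ω.totD a) b + (-1 : ℝ) ^ k • Ω.totCup a (Ω.totD b) := by
  classical
  have ha : a = ∑ i ∈ a.support, toTot i.1 i.2 (a i) := (DirectSum.sum_support_of a).symm
  rw [ha]
  simp only [map_sum, LinearMap.sum_apply, Finset.smul_sum, ← Finset.sum_add_distrib]
  refine Finset.sum_congr rfl fun i hi => ?_
  rw [← h i (by simpa using hi), totD_totCup_toTot]

theorem isDoubleDGA : Ω.IsDoubleDGA where
  δ_δ := Ω.δ_δ
  d_d := Ω.d_d
  d_δ := Ω.d_δ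
  cup_assoc := Ω.cup_assoc
  one_cup := Ω.one_cup
  cup_one := Ω.cup_one
  δ_cup := Ω.δ_cup
  d_cup := Ω.d_cup
  totD_totD := Ω.totD_totD
  totCup_assoc := Ω.totCup_assoc
  totD_totCup := Ω.totD_totCup

end CosimplicialDGA
/-! ## Smoothness of alternating forms depending on a parameter -/

section AlternatingSmooth

variable {V W U : Type*} [NormedAddCommGroup V] [NormedSpace ℝ V] [FiniteDimensional ℝ V]
  [NormedAddCommGroup W] [NormedSpace ℝ W] [NormedAddCommGroup U] [NormedSpace ℝ U] {q : ℕ}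

variable (V q) in
/-- The values of an alternating form at families of vectors of a basis. -/
def evalBasis : V [⋀^Fin q]→L[ℝ] ℝ →ₗ[ℝ] (Fin q → Fin (Module.finrank ℝ V)) → ℝ where
  toFun a s := a fun i => Module.finBasis ℝ V (s i)
  map_add' _ _ := rfl
  map_smul' _ _ := rfl

theorem evalBasis_injective : Function.Injective (evalBasis V q) := by
  intro a b h
  have : a.toAlternatingMap.toMultilinearMap = b.toAlternatingMap.toMultilinearMap :=
    Module.Basis.ext_multilinear (fun _ => Module.finBasis ℝ V) fun s => congrFun h s
  ext v
  exact DFunLike.congr_fun this v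

/-- In finite dimension a form is recovered linearly from its values on basis vectors, so pointwise
smoothness of the values suffices. -/
theorem contDiffAt_alternating {f : U → V [⋀^Fin q]→L[ℝ] ℝ} {u : U} {n : WithTop ℕ∞}
    (h : ∀ v, ContDiffAt ℝ n (fun x => f x v) u) : ContDiffAt ℝ n f u := by
  obtain ⟨g, hg⟩ := (evalBasis V q).exists_leftInverse_of_injective
    (LinearMap.ker_eq_bot.2 evalBasis_injective)
  have hf : f = fun x => LinearMap.toContinuousLinearMap g (evalBasis V q (f x)) := by
    ext1 x; exact (LinearMap.congr_fun hg (f x)).symm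
  rw [hf]
  exact (ContinuousLinearMap.contDiff _).contDiffAt.comp u (contDiffAt_pi.2 fun s => h _)

/-- Composition is linear in the form and multilinear in the `q` copies of the linear map; by the
preceding lemma only values at fixed vectors have to be considered. -/
theorem ContDiffAt.alternating_compContinuousLinearMap {f : U → W [⋀^Fin q]→L[ℝ] ℝ}
    {g : U → V →L[ℝ] W} {u : U} {n : WithTop ℕ∞} (hf : ContDiffAt ℝ n f u)
    (hg : ContDiffAt ℝ n g u) :
    ContDiffAt ℝ n (fun x => (f x).compContinuousLinearMap (g x)) u := by
  refine contDiffAt_alternating fun v => ?_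
  have h1 : ContDiffAt ℝ n (fun x =>
      ContinuousMultilinearMap.compContinuousLinearMapContinuousMultilinear ℝ
        (fun _ : Fin q => V) (fun _ : Fin q => W) ℝ (fun _ => g x)) u :=
    (ContinuousMultilinearMap.contDiff _).contDiffAt.comp u (contDiffAt_pi.2 fun _ => hg)
  have h2 : ContDiffAt ℝ n (fun x =>
      (f x).toContinuousMultilinearMap) u :=
    (ContinuousLinearMap.contDiff (E := W [⋀^Fin q]→L[ℝ] ℝ)
      (F := ContinuousMultilinearMap ℝ (fun _ : Fin q => W) ℝ)
      (ContinuousAlternatingMap.toContinuousMultilinearMapCLM ℝ)).contDiffAt.comp u hf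
  exact (ContinuousMultilinearMap.apply ℝ (fun _ : Fin q => V) ℝ v).contDiff.contDiffAt.comp u
    (h1.clm_apply h2)

omit [FiniteDimensional ℝ V] in
theorem ContDiffAt.wedge {r : ℕ} {f : U → V [⋀^Fin q]→L[ℝ] ℝ} {g : U → V [⋀^Fin r]→L[ℝ] ℝ} {u : U}
    {n : WithTop ℕ∞} (hf : ContDiffAt ℝ n f u) (hg : ContDiffAt ℝ n g u) :
    ContDiffAt ℝ n (fun x => Haefliger.wedge (f x) (g x)) u := by
  have hL : ContDiff ℝ n (fun a => wedgeCLM V q r a) := by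
    apply ContinuousLinearMap.contDiff
  have h : ContDiffAt ℝ n (fun x => wedgeCLM V q r (f x)) u := hL.contDiffAt.comp u hf
  exact h.clm_apply hg

omit [FiniteDimensional ℝ V] in
theorem ContDiffAt.extDeriv {f : V → V [⋀^Fin q]→L[ℝ] ℝ} {u : V} (hf : ContDiffAt ℝ ∞ f u) :
    ContDiffAt ℝ ∞ (_root_.extDeriv f) u := by
  have hL : ContDiff ℝ ∞ fun a =>
    ContinuousAlternatingMap.alternatizeUncurryFinCLM ℝ V ℝ (n := q) a := by
    apply ContinuousLinearMap.contDiff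
  exact hL.contDiffAt.comp u (hf.fderiv_right (m := ∞) (by simp))

end AlternatingSmooth

/-! ## Derivatives of maps between manifolds -/

section Manifold

variable {E X E' X' E'' X'' : Type*} [NormedAddCommGroup E] [NormedSpace ℝ E]
  [TopologicalSpace X] [ChartedSpace E X]
  [NormedAddCommGroup E'] [NormedSpace ℝ E'] [TopologicalSpace X'] [ChartedSpace E' X']
  [NormedAddCommGroup E''] [NormedSpace ℝ E''] [TopologicalSpace X''] [ChartedSpace E'' X'']

variable (E E') in
/-- The derivative of a map between manifolds, as a map between the model spaces. -/
def md (f : X → X') (x : X) : E →L[ℝ] E' := mfderiv 𝓘(ℝ, E) 𝓘(ℝ, E') f x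

variable (E E') in
/-- The map `f` is smooth at all points near `x`. -/
def SmoothNear (f : X → X') (x : X) : Prop :=
  ∀ᶠ x' in 𝓝 x, ContMDiffAt 𝓘(ℝ, E) 𝓘(ℝ, E') ∞ f x'

theorem SmoothNear.contMDiffAt {f : X → X'} {x : X} (h : SmoothNear E E' f x) :
    ContMDiffAt 𝓘(ℝ, E) 𝓘(ℝ, E') ∞ f x := Filter.Eventually.self_of_nhds h

theorem SmoothNear.mdifferentiableAt {f : X → X'} {x : X} (h : SmoothNear E E' f x) :
    MDifferentiableAt 𝓘(ℝ, E) 𝓘(ℝ, E') f x := h.contMDiffAt.mdifferentiableAt (by simp)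

theorem SmoothNear.continuousAt {f : X → X'} {x : X} (h : SmoothNear E E' f x) :
    ContinuousAt f x := h.contMDiffAt.continuousAt

theorem SmoothNear.eventually {f : X → X'} {x : X} (h : SmoothNear E E' f x) :
    ∀ᶠ x' in 𝓝 x, SmoothNear E E' f x' := eventually_eventually_nhds.2 h

theorem _root_.ContMDiff.smoothNear {f : X → X'} (h : ContMDiff 𝓘(ℝ, E) 𝓘(ℝ, E') ∞ f) (x : X) :
    SmoothNear E E' f x := Filter.Eventually.of_forall h

theorem SmoothNear.comp {g : X' → X''} {f : X → X'} {x : X} (hg : SmoothNear E' E'' g (f x))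
    (hf : SmoothNear E E' f x) : SmoothNear E E'' (fun y => g (f y)) x := by
  filter_upwards [hf, hf.continuousAt.eventually hg] with y h1 h2
  exact h2.comp y h1

theorem SmoothNear.congr {f g : X → X'} {x : X} (h : SmoothNear E E' f x) (hfg : f =ᶠ[𝓝 x] g) :
    SmoothNear E E' g x := by
  filter_upwards [h, eventually_eventually_nhds.2 hfg] with y h1 h2
  exact h1.congr_of_eventuallyEq (Filter.EventuallyEq.symm h2)

theorem smoothNear_extChartAt [IsManifold 𝓘(ℝ, E) ∞ X] {x y : X}
    (hy : y ∈ (extChartAt 𝓘(ℝ, E) x).source) : SmoothNear E E (extChartAt 𝓘(ℝ, E) x) y := by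
  filter_upwards [(isOpen_extChartAt_source x).mem_nhds hy] with z hz
  exact contMDiffAt_extChartAt' (by simpa using hz)

theorem smoothNear_extChartAt_symm [IsManifold 𝓘(ℝ, E) ∞ X] {x : X} {y : E}
    (hy : y ∈ (extChartAt 𝓘(ℝ, E) x).target) :
    SmoothNear E E (extChartAt 𝓘(ℝ, E) x).symm y := by
  filter_upwards [(isOpen_extChartAt_target x).mem_nhds hy] with z hz
  exact (contMDiffOn_extChartAt_symm x).contMDiffAt ((isOpen_extChartAt_target x).mem_nhds hz)

theorem md_comp {g : X' → X''} {f : X → X'} {x : X}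
    (hg : MDifferentiableAt 𝓘(ℝ, E') 𝓘(ℝ, E'') g (f x))
    (hf : MDifferentiableAt 𝓘(ℝ, E) 𝓘(ℝ, E') f x) :
    md E E'' (fun y => g (f y)) x = (md E' E'' g (f x)).comp (md E E' f x) := mfderiv_comp x hg hf

theorem md_congr {f g : X → X'} {x : X} (h : f =ᶠ[𝓝 x] g) : md E E' f x = md E E' g x :=
  h.mfderiv_eq

theorem md_id (x : X) : md E E (fun y : X => y) x = .id ℝ E := mfderiv_id

theorem md_eq_fderiv {f : E → E'} {x : E} : md E E' f x = fderiv ℝ f x := mfderiv_eq_fderiv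

theorem md_extChartAt_self [IsManifold 𝓘(ℝ, E) 1 X] (x : X) :
    md E E (extChartAt 𝓘(ℝ, E) x) x = .id ℝ E := mfderiv_extChartAt_self

theorem smoothNear_iff_contDiffAt {f : E → E'} {x : E} :
    SmoothNear E E' f x ↔ ∀ᶠ y in 𝓝 x, ContDiffAt ℝ ∞ f y := by
  simp only [SmoothNear, contMDiffAt_iff_contDiffAt]

theorem SmoothNear.contDiffAt {f : E → E'} {x : E} (h : SmoothNear E E' f x) :
    ContDiffAt ℝ ∞ f x := h.contMDiffAt.contDiffAt

theorem _root_.ContDiff.smoothNear {f : E → E'} (h : ContDiff ℝ ∞ f) (x : E) :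
    SmoothNear E E' f x := h.contMDiff.smoothNear x

theorem SmoothNear.prodMk {f : X → E'} {g : X → E''} {x : X} (hf : SmoothNear E E' f x)
    (hg : SmoothNear E E'' g x) : SmoothNear E (E' × E'') (fun y => (f y, g y)) x := by
  filter_upwards [hf, hg] with y h1 h2 using h1.prodMk_space h2

theorem SmoothNear.pi {ι : Type*} [Fintype ι] {f : X → ι → E'} {x : X}
    (hf : ∀ i, SmoothNear E E' (fun y => f y i) x) : SmoothNear E (ι → E') f x := by
  filter_upwards [Filter.eventually_all.2 hf] with y h using contMDiffAt_pi_space.2 h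

theorem SmoothNear.fderiv {f : E → E'} {x : E} (hf : SmoothNear E E' f x) :
    SmoothNear E (E →L[ℝ] E') (fderiv ℝ f) x := by
  rw [smoothNear_iff_contDiffAt] at *
  filter_upwards [hf] with y h using h.fderiv_right (m := ∞) (by simp)

/-- A submersion `f` has, near each point `a`, a smooth family of local sections: in coordinates,
`ρ (y, b)` is a point over `y` and `ρ (f a', a') = a'`. -/
theorem exists_section_of_isSubmersion [IsManifold 𝓘(ℝ, E) ∞ X] [IsManifold 𝓘(ℝ, E') ∞ X']
    {f : X → X'} (hf : Manifold.IsSubmersion 𝓘(ℝ, E) 𝓘(ℝ, E') ∞ f) (a : X) :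
    ∃ ρ : E' × E → X,
      SmoothNear (E' × E) E ρ (extChartAt 𝓘(ℝ, E') (f a) (f a), extChartAt 𝓘(ℝ, E) a a) ∧
      (∀ᶠ z in 𝓝 (extChartAt 𝓘(ℝ, E') (f a) (f a), extChartAt 𝓘(ℝ, E) a a),
        f (ρ z) = (extChartAt 𝓘(ℝ, E') (f a)).symm z.1) ∧
      ∀ᶠ a' in 𝓝 a, ρ (extChartAt 𝓘(ℝ, E') (f a) (f a'), extChartAt 𝓘(ℝ, E) a a') = a' := by
  have h := hf.isSubmersionAt a
  set φ := extChartAt 𝓘(ℝ, E') (f a) with hφ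
  set ψ := extChartAt 𝓘(ℝ, E) a with hψ
  -- In the charts adapted to the submersion, `f` is the projection to the first factor.
  have hd : ∀ z ∈ h.domChart.target, h.codChart (f (h.domChart.symm z)) = (h.equiv z).1 := by
    intro z hz
    have := h.writtenInCharts (show z ∈ (h.domChart.extend 𝓘(ℝ, E)).target by simpa using hz)
    simpa using this
  have hfc : Continuous f := hf.contMDiff.continuous
  -- The adapted coordinates of the new point: the first is that of the prescribed image, the
  -- complementary one is taken over from the second argument. If the image prescribed is that of
  -- the point itself, nothing changes.
  let σ : E' × E → E := fun z =>
    h.equiv.symm (h.codChart (φ.symm z.1), (h.equiv (h.domChart (ψ.symm z.2))).2)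
  let z₀ : E' × E := (φ (f a), ψ a)
  have e1 : φ.symm z₀.1 = f a := φ.left_inv (mem_extChartAt_source _)
  have e2 : ψ.symm z₀.2 = a := ψ.left_inv (mem_extChartAt_source _)
  have e0 : ∀ a' ∈ h.domChart.source, h.equiv.symm (h.codChart (f a'),
      (h.equiv (h.domChart a')).2) = h.domChart a' := fun a' ha' => by
    have := hd _ (h.domChart.map_source ha')
    rw [h.domChart.left_inv ha'] at this
    rw [this, h.equiv.symm_apply_apply]
  have hσ₀ : σ z₀ = h.domChart a := by
    simp only [σ, e1, e2]
    exact e0 a h.mem_domChart_source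
  have s1 : SmoothNear (E' × E) E' (fun z : E' × E => φ.symm z.1) z₀ :=
    SmoothNear.comp (g := φ.symm) (f := Prod.fst)
      (smoothNear_extChartAt_symm (mem_extChartAt_target _)) (contDiff_fst.smoothNear _)
  have s2 : SmoothNear (E' × E) E (fun z : E' × E => ψ.symm z.2) z₀ :=
    SmoothNear.comp (g := ψ.symm) (f := Prod.snd)
      (smoothNear_extChartAt_symm (mem_extChartAt_target _)) (contDiff_snd.smoothNear _)
  have s3 : SmoothNear E' E' h.codChart (φ.symm z₀.1) := by
    rw [e1]
    filter_upwards [h.codChart.open_source.mem_nhds h.mem_codChart_source] with y hy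
    exact contMDiffAt_of_mem_maximalAtlas h.codChart_mem_maximalAtlas hy
  have s4 : SmoothNear E E h.domChart (ψ.symm z₀.2) := by
    rw [e2]
    filter_upwards [h.domChart.open_source.mem_nhds h.mem_domChart_source] with y hy
    exact contMDiffAt_of_mem_maximalAtlas h.domChart_mem_maximalAtlas hy
  have s5 : SmoothNear E E h.domChart.symm (σ z₀) := by
    rw [hσ₀]
    filter_upwards [h.domChart.open_target.mem_nhds
      (h.domChart.map_source h.mem_domChart_source)] with y hy
    exact contMDiffAt_symm_of_mem_maximalAtlas h.domChart_mem_maximalAtlas hy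
  have sσ : SmoothNear (E' × E) E σ z₀ := by
    have s6 := SmoothNear.comp (g := h.codChart) (f := fun z : E' × E => φ.symm z.1) s3 s1
    have s7 : SmoothNear (E' × E) h.complement
        (fun z => (h.equiv (h.domChart (ψ.symm z.2))).2) z₀ :=
      SmoothNear.comp (g := fun w => (h.equiv w).2)
        ((contDiff_snd.comp h.equiv.contDiff).smoothNear _) 
        (SmoothNear.comp (g := h.domChart) (f := fun z : E' × E => ψ.symm z.2) s4 s2)
    exact SmoothNear.comp (g := h.equiv.symm) (h.equiv.symm.contDiff.smoothNear _) (s6.prodMk s7)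
  refine ⟨fun z => h.domChart.symm (σ z), s5.comp sσ, ?_, ?_⟩
  · have t1 : ∀ᶠ z in 𝓝 z₀, φ.symm z.1 ∈ h.codChart.source := s1.continuousAt.eventually
      (h.codChart.open_source.mem_nhds (by
        show φ.symm z₀.1 ∈ _; rw [e1]; exact h.mem_codChart_source))
    have t2 : ∀ᶠ z in 𝓝 z₀, σ z ∈ h.domChart.target := sσ.continuousAt.eventually
      (h.domChart.open_target.mem_nhds
        (by rw [hσ₀]; exact h.domChart.map_source h.mem_domChart_source))
    filter_upwards [t1, t2] with z h1 h2
    have h3 := hd _ h2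
    have h4 : f (h.domChart.symm (σ z)) ∈ h.codChart.source :=
      h.source_subset_preimage_source (h.domChart.map_target h2)
    refine h.codChart.injOn h4 h1 ?_
    rw [h3]
    simp [σ]
  · filter_upwards [h.domChart.open_source.mem_nhds h.mem_domChart_source,
      extChartAt_source_mem_nhds (I := 𝓘(ℝ, E)) a,
      hfc.continuousAt.eventually (extChartAt_source_mem_nhds (I := 𝓘(ℝ, E')) (f a))]
      with a' h1 h2 h3
    simp only [σ, φ.left_inv h3, ψ.left_inv h2, e0 a' h1, h.domChart.left_inv h1]

end Manifold

/-! ### Charts at their own centre, and the topology of the nerve -/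

section Charts

variable {E X : Type*} [NormedAddCommGroup E] [NormedSpace ℝ E] [TopologicalSpace X]
  [ChartedSpace E X] [IsManifold 𝓘(ℝ, E) ∞ X]

omit [IsManifold 𝓘(ℝ, E) ∞ X] in
theorem md_prodMk {E' E'' : Type*} [NormedAddCommGroup E'] [NormedSpace ℝ E']
    [NormedAddCommGroup E''] [NormedSpace ℝ E''] {f : X → E'} {g : X → E''} {x : X}
    (hf : MDifferentiableAt 𝓘(ℝ, E) 𝓘(ℝ, E') f x) (hg : MDifferentiableAt 𝓘(ℝ, E) 𝓘(ℝ, E'') g x) :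
    md E (E' × E'') (fun y => (f y, g y)) x = (md E E' f x).prod (md E E'' g x) := by
  have h := mfderiv_prodMk hf hg
  rw [md]
  rw [modelWithCornersSelf_prod, ← chartedSpaceSelf_prod]
  exact h

theorem mdifferentiableAt_extChartAt_self (x : X) :
    MDifferentiableAt 𝓘(ℝ, E) 𝓘(ℝ, E) (extChartAt 𝓘(ℝ, E) x) x :=
  (smoothNear_extChartAt (mem_extChartAt_source x)).mdifferentiableAt

/-- The tangent space at `x` is identified with `E` through the preferred chart at `x`, so this
chart and its inverse have derivative the identity there. At all other points of the chart the
derivative is a genuine change of coordinates, which is why `mdSymm` is needed later. -/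
theorem md_extChartAt_symm_self (x : X) :
    md E E (extChartAt 𝓘(ℝ, E) x).symm (extChartAt 𝓘(ℝ, E) x x) = .id ℝ E := by
  have : IsManifold 𝓘(ℝ, E) 1 X := .of_le (n := ∞) (by simp)
  have h := md_comp (f := extChartAt 𝓘(ℝ, E) x) (g := (extChartAt 𝓘(ℝ, E) x).symm) (x := x)
    (smoothNear_extChartAt_symm (mem_extChartAt_target x)).mdifferentiableAt
    (mdifferentiableAt_extChartAt_self x)
  rw [md_extChartAt_self, ContinuousLinearMap.comp_id] at h
  rw [← h, ← md_id (E := E) x]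
  refine md_congr ?_
  filter_upwards [extChartAt_source_mem_nhds (I := 𝓘(ℝ, E)) x] with y hy
  exact (extChartAt 𝓘(ℝ, E) x).left_inv hy

end Charts

/-- Only the topology of the nerve is used, for statements valid near a string. No manifold
structure is put on it; smoothness is always tested through plots. -/
instance {X A : Type*} [TopologicalSpace X] [TopologicalSpace A] (G : SetGroupoid X A) (p : ℕ) :
    TopologicalSpace (G.Nerve p) :=
  .induced (fun g => (g.obj, g.arr)) inferInstance

namespace SetGroupoid

variable {X A : Type*} [TopologicalSpace X] [TopologicalSpace A] {G : SetGroupoid X A} {p : ℕ}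

theorem continuous_nerve_obj (i : Fin (p + 1)) : Continuous fun g : G.Nerve p => g.obj i :=
  (continuous_apply i).comp (continuous_fst.comp (continuous_induced_dom
    (f := fun g : G.Nerve p => (g.obj, g.arr))))

theorem continuous_nerve_arr (i : Fin p) : Continuous fun g : G.Nerve p => g.arr i :=
  (continuous_apply i).comp (continuous_snd.comp (continuous_induced_dom
    (f := fun g : G.Nerve p => (g.obj, g.arr))))

theorem continuousAt_nerve_iff {V : Type*} [TopologicalSpace V] {ξ : V → G.Nerve p} {u : V} :
    ContinuousAt ξ u ↔ (∀ i, ContinuousAt (fun u' => (ξ u').obj i) u) ∧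
      ∀ i, ContinuousAt (fun u' => (ξ u').arr i) u := by
  rw [ContinuousAt, nhds_induced, Filter.tendsto_comap_iff, nhds_prod_eq,
    Filter.tendsto_prod_iff']
  simp only [Function.comp_def, tendsto_pi_nhds]
  rfl

end SetGroupoid

namespace LieGroupoid

variable {E X F A : Type*} [NormedAddCommGroup E] [NormedSpace ℝ E]
  [TopologicalSpace X] [ChartedSpace E X] [NormedAddCommGroup F] [NormedSpace ℝ F]
  [TopologicalSpace A] [ChartedSpace F A] (G : LieGroupoid E X F A) {p q : ℕ}
  {V W : Type*} [NormedAddCommGroup V] [NormedSpace ℝ V]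
  [NormedAddCommGroup W] [NormedSpace ℝ W]

/-! ## Plots of the nerve -/

/-- The map `ξ` to the manifold of strings is smooth near `u`. -/
structure PlotAt (ξ : V → G.Nerve p) (u : V) : Prop where
  obj : ∀ i, SmoothNear V E (fun u' => (ξ u').obj i) u
  arr : ∀ i, SmoothNear V F (fun u' => (ξ u').arr i) u

/-- The pull-back of a horizontal form along a map from a normed space. -/
def pull (θ : G.Nerve p → E [⋀^Fin q]→L[ℝ] ℝ) (ξ : V → G.Nerve p) (u : V) : V [⋀^Fin q]→L[ℝ] ℝ :=
  (θ (ξ u)).compContinuousLinearMap (md V E (fun u' => (ξ u').obj 0) u)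

variable {G}

theorem PlotAt.eventually {ξ : V → G.Nerve p} {u : V} (h : G.PlotAt ξ u) :
    ∀ᶠ u' in 𝓝 u, G.PlotAt ξ u' := by
  filter_upwards [Filter.eventually_all.2 fun i => (h.obj i).eventually,
    Filter.eventually_all.2 fun i => (h.arr i).eventually] with u' h1 h2 using ⟨h1, h2⟩

theorem PlotAt.continuousAt {ξ : V → G.Nerve p} {u : V} (h : G.PlotAt ξ u) : ContinuousAt ξ u :=
  SetGroupoid.continuousAt_nerve_iff.2
    ⟨fun i => (h.obj i).continuousAt, fun i => (h.arr i).continuousAt⟩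

theorem PlotAt.comp {ξ : V → G.Nerve p} {f : W → V} {u : W} (h : G.PlotAt ξ (f u))
    (hf : SmoothNear W V f u) : G.PlotAt (fun x => ξ (f x)) u :=
  ⟨fun i => SmoothNear.comp (g := fun u' => (ξ u').obj i) (h.obj i) hf,
    fun i => SmoothNear.comp (g := fun u' => (ξ u').arr i) (h.arr i) hf⟩

theorem IsPlot.plotAt {n : ℕ} {ξ : EuclideanSpace ℝ (Fin n) → G.Nerve p} {U}
    (h : G.IsPlot ξ U) {u} (hu : u ∈ U) : G.PlotAt ξ u := by
  refine ⟨fun i => ?_, fun i => ?_⟩ <;> filter_upwards [h.isOpen.mem_nhds hu] with y hy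
  exacts [(h.smooth_obj i).contMDiffAt (h.isOpen.mem_nhds hy),
    (h.smooth_arr i).contMDiffAt (h.isOpen.mem_nhds hy)]

theorem PlotAt.exists_isPlot {n : ℕ} {ξ : EuclideanSpace ℝ (Fin n) → G.Nerve p} {u}
    (h : G.PlotAt ξ u) : ∃ U, u ∈ U ∧ G.IsPlot ξ U := by
  obtain ⟨U, hU, ho, hu⟩ := eventually_nhds_iff.1 h.eventually
  exact ⟨U, hu, ho, fun i y hy => ((hU y hy).obj i).contMDiffAt.contMDiffWithinAt,
    fun i y hy => ((hU y hy).arr i).contMDiffAt.contMDiffWithinAt⟩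

theorem pull_comp (θ : G.Nerve p → E [⋀^Fin q]→L[ℝ] ℝ) {ξ : V → G.Nerve p} {f : W → V} {u : W}
    (h : G.PlotAt ξ (f u)) (hf : DifferentiableAt ℝ f u) :
    G.pull θ (fun x => ξ (f x)) u =
      (G.pull θ ξ (f u)).compContinuousLinearMap (fderiv ℝ f u) := by
  have := md_comp (g := fun u' => (ξ u').obj 0) (f := f) (x := u) (h.obj 0).mdifferentiableAt
    hf.mdifferentiableAt
  rw [pull, this, md_eq_fderiv]
  rfl

/-- Smoothness is defined by test maps from Euclidean spaces; a linear isomorphism with such a space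
extends it to any finite-dimensional source. The horizontal plots below are indexed by `E`. -/
theorem IsSmoothForm.contDiffAt_pull [FiniteDimensional ℝ V]
    {θ : G.Nerve p → E [⋀^Fin q]→L[ℝ] ℝ} (hθ : G.IsSmoothForm θ) {ξ : V → G.Nerve p} {u : V}
    (h : G.PlotAt ξ u) : ContDiffAt ℝ ∞ (G.pull θ ξ) u := by
  let e := toEuclidean (E := V)
  have h' : G.PlotAt (fun y => ξ (e.symm y)) (e u) :=
    PlotAt.comp (by simpa using h) (e.symm.contDiff.smoothNear _)
  obtain ⟨U, hu, hU⟩ := h'.exists_isPlot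
  have h1 : ContDiffAt ℝ ∞ (G.pullback θ (fun y => ξ (e.symm y))) (e u) :=
    (hθ _ _ U hU).contDiffAt (hU.isOpen.mem_nhds hu)
  have h2 : ContDiffAt ℝ ∞ (fun x => (G.pullback θ (fun y => ξ (e.symm y))
      (e x)).compContinuousLinearMap (fderiv ℝ e x)) u :=
    ContDiffAt.alternating_compContinuousLinearMap (h1.comp u e.contDiff.contDiffAt) (by
      rw [show fderiv ℝ e = fun _ => (e : V →L[ℝ] _) from funext fun _ => e.fderiv]
      exact contDiffAt_const)
  refine h2.congr_of_eventuallyEq ?_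
  filter_upwards [e.continuous.continuousAt.eventually h'.eventually] with x hx
  have := pull_comp θ (f := e) (u := x) hx e.differentiableAt
  simp only [e.symm_apply_apply] at this
  exact this

theorem isSmoothForm_of_contDiffAt_pull {θ : G.Nerve p → E [⋀^Fin q]→L[ℝ] ℝ}
    (h : ∀ (n : ℕ) (ξ : EuclideanSpace ℝ (Fin n) → G.Nerve p) u, G.PlotAt ξ u →
      ContDiffAt ℝ ∞ (G.pull θ ξ) u) : G.IsSmoothForm θ :=
  fun n ξ _ hξ u hu => (h n ξ u (hξ.plotAt hu)).contDiffWithinAt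

theorem IsSmoothForm.extDeriv_pull_comp [FiniteDimensional ℝ V]
    {θ : G.Nerve p → E [⋀^Fin q]→L[ℝ] ℝ} (hθ : G.IsSmoothForm θ)
    {ξ : V → G.Nerve p} {f : W → V} {u : W} (h : G.PlotAt ξ (f u)) (hf : SmoothNear W V f u) :
    extDeriv (G.pull θ (fun x => ξ (f x))) u =
      (extDeriv (G.pull θ ξ) (f u)).compContinuousLinearMap (fderiv ℝ f u) := by
  rw [← extDeriv_pullback (r := ∞) ((hθ.contDiffAt_pull h).differentiableAt (by simp))
    hf.contDiffAt (by
    rw [minSmoothness_of_isRCLikeNormedField]; exact WithTop.coe_le_coe.2 le_top)]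
  refine Filter.EventuallyEq.extDeriv_eq ?_
  filter_upwards [hf.continuousAt.eventually h.eventually, hf.eventually] with x hx hx'
  exact pull_comp θ hx (hx'.contDiffAt.differentiableAt (by simp))

/-! ## Local parametrizations of the nerve -/

variable (G) in
/-- The coordinates of a string: those of its target and of its arrows. -/
def nerveChart (g₀ g : G.Nerve p) : E × (Fin p → F) :=
  (extChartAt 𝓘(ℝ, E) (g₀.obj 0) (g.obj 0), fun i => extChartAt 𝓘(ℝ, F) (g₀.arr i) (g.arr i))

theorem continuousAt_nerveChart (g₀ : G.Nerve p) : ContinuousAt (G.nerveChart g₀) g₀ := by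
  refine ContinuousAt.prodMk ?_ (continuousAt_pi.2 fun i => ?_)
  · exact ContinuousAt.comp (f := fun g : G.Nerve p => g.obj 0) (continuousAt_extChartAt _)
      (SetGroupoid.continuous_nerve_obj 0).continuousAt
  · exact ContinuousAt.comp (f := fun g : G.Nerve p => g.arr i) (continuousAt_extChartAt _)
      (SetGroupoid.continuous_nerve_arr i).continuousAt

variable [IsManifold 𝓘(ℝ, E) ∞ X] [IsManifold 𝓘(ℝ, F) ∞ A]

/-- The coordinates of `nerveChart` are redundant, since composability is a constraint on them. So
`R` is only a left inverse: it makes the nerve, near `g₀`, a smooth retract of an open set of a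
vector space, which is enough for derivatives. A string is rebuilt from the left: the object `x_i`
is known, a local section of the target map corrects the next coordinate to an arrow with target
`x_i`, and its source is `x_{i+1}`. No correction occurs if the coordinates come from a string, nor,
to first order, along vectors tangent to the nerve. -/
theorem exists_nerveParam (g₀ : G.Nerve p) : ∃ R : E × (Fin p → F) → G.Nerve p,
    G.PlotAt R (G.nerveChart g₀ g₀) ∧ (∀ᶠ g in 𝓝 g₀, R (G.nerveChart g₀ g) = g) ∧
    (∀ᶠ m in 𝓝 (G.nerveChart g₀ g₀), (R m).obj 0 = (extChartAt 𝓘(ℝ, E) (g₀.obj 0)).symm m.1) ∧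
    ∀ (base : Fin (p + 1) → E) (vec : Fin p → F),
      (∀ i, md F E G.tgt (g₀.arr i) (vec i) = base i.castSucc) →
      (∀ i, md F E G.src (g₀.arr i) (vec i) = base i.succ) →
      (∀ i, md (E × (Fin p → F)) E (fun m => (R m).obj i) (G.nerveChart g₀ g₀) (base 0, vec) =
        base i) ∧
      ∀ i, md (E × (Fin p → F)) F (fun m => (R m).arr i) (G.nerveChart g₀ g₀) (base 0, vec) =
        vec i := by
  classical
  set m₀ := G.nerveChart g₀ g₀ with hm₀
  let φ := fun i => extChartAt 𝓘(ℝ, E) (g₀.obj i)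
  let ψ := fun i => extChartAt 𝓘(ℝ, F) (g₀.arr i)
  have hρ : ∀ i : Fin p, ∃ ρ : E × F → A,
      SmoothNear (E × F) F ρ (φ i.castSucc (g₀.obj i.castSucc), ψ i (g₀.arr i)) ∧
      (∀ᶠ z in 𝓝 (φ i.castSucc (g₀.obj i.castSucc), ψ i (g₀.arr i)),
        G.tgt (ρ z) = (φ i.castSucc).symm z.1) ∧
      ∀ᶠ a in 𝓝 (g₀.arr i), ρ (φ i.castSucc (G.tgt a), ψ i a) = a := fun i => by
    have := exists_section_of_isSubmersion G.submersion_tgt (g₀.arr i)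
    rwa [g₀.tgt_arr] at this
  choose ρ ρs ρt ρu using hρ
  -- `o i` is the reconstructed `i`-th object and `a i` the arrow corrected so as to have it as its
  -- target.
  let o : (i : Fin (p + 1)) → E × (Fin p → F) → X := Fin.induction
    (fun m => (φ 0).symm m.1) (fun i oi m => G.src (ρ i (φ i.castSucc (oi m), m.2 i)))
  let a : (i : Fin p) → E × (Fin p → F) → A := fun i m => ρ i (φ i.castSucc (o i.castSucc m), m.2 i)
  have o0 : o 0 = fun m => (φ 0).symm m.1 := rfl
  have os : ∀ i : Fin p, o i.succ = fun m => G.src (a i m) := fun i => Fin.induction_succ _ _ i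
  have ρ₀ : ∀ i, ρ i (φ i.castSucc (g₀.obj i.castSucc), ψ i (g₀.arr i)) = g₀.arr i := fun i => by
    have := (ρu i).self_of_nhds
    rwa [g₀.tgt_arr] at this
  have stgt : ∀ x, SmoothNear F E G.tgt x := G.submersion_tgt.contMDiff.smoothNear
  have ssrc : ∀ x, SmoothNear F E G.src x := G.submersion_src.contMDiff.smoothNear
  -- values and smoothness at the centre
  have sarr : ∀ i : Fin p, (SmoothNear (E × (Fin p → F)) E (o i.castSucc) m₀ ∧ o i.castSucc m₀ = g₀.obj i.castSucc) →
      SmoothNear (E × (Fin p → F)) (E × F)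
        (fun m => (φ i.castSucc (o i.castSucc m), m.2 i)) m₀ ∧
      SmoothNear (E × (Fin p → F)) F (a i) m₀ ∧ a i m₀ = g₀.arr i := by
    intro i hi
    have e : (φ i.castSucc (o i.castSucc m₀), m₀.2 i) =
        (φ i.castSucc (g₀.obj i.castSucc), ψ i (g₀.arr i)) := by rw [hi.2]; rfl
    have h1 : SmoothNear (E × (Fin p → F)) (E × F)
        (fun m => (φ i.castSucc (o i.castSucc m), m.2 i)) m₀ :=
      SmoothNear.prodMk (SmoothNear.comp (g := φ i.castSucc)
        (smoothNear_extChartAt (by rw [hi.2]; exact mem_extChartAt_source _)) hi.1)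
        (((contDiff_apply ℝ F i).comp contDiff_snd).smoothNear _)
    refine ⟨h1, SmoothNear.comp (g := ρ i) (by rw [e]; exact ρs i) h1, ?_⟩
    change ρ i _ = _
    rw [e, ρ₀]
  have so : ∀ i, SmoothNear (E × (Fin p → F)) E (o i) m₀ ∧ o i m₀ = g₀.obj i := by
    intro i
    induction i using Fin.induction with
    | zero =>
      refine ⟨SmoothNear.comp (g := (φ 0).symm) (f := Prod.fst)
        (smoothNear_extChartAt_symm (mem_extChartAt_target _)) (contDiff_fst.smoothNear _), ?_⟩
      exact (φ 0).left_inv (mem_extChartAt_source _)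
    | succ i ih =>
      obtain ⟨-, h2, h3⟩ := sarr i ih
      rw [os]
      exact ⟨SmoothNear.comp (ssrc _) h2, (congrArg G.src h3).trans (g₀.src_arr i)⟩
  have sa : ∀ i, SmoothNear (E × (Fin p → F)) F (a i) m₀ ∧ a i m₀ = g₀.arr i := fun i => (sarr i (so _)).2
  have sc := fun i => (sarr i (so _)).1
  have ec : ∀ i, (φ i.castSucc (o i.castSucc m₀), m₀.2 i) =
      (φ i.castSucc (g₀.obj i.castSucc), ψ i (g₀.arr i)) := fun i => by rw [(so _).2]; rfl
  have ht : ∀ᶠ m in 𝓝 m₀, ∀ i, G.tgt (a i m) = o i.castSucc m := Filter.eventually_all.2 fun i => by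
    have h1 := ρt i
    have h2 : ∀ᶠ x in 𝓝 (g₀.obj i.castSucc), x ∈ (φ i.castSucc).source :=
      extChartAt_source_mem_nhds (I := 𝓘(ℝ, E)) (g₀.obj i.castSucc)
    rw [← ec] at h1
    rw [← (so i.castSucc).2] at h2
    filter_upwards [(sc i).continuousAt.eventually h1,
      (so i.castSucc).1.continuousAt.eventually h2] with m h1 h2
    rw [h1]
    exact (φ i.castSucc).left_inv h2
  -- The matching of targets holds only near `m₀`, where the local sections are valid; the value
  -- `g₀` elsewhere plays no role.
  let R : E × (Fin p → F) → G.Nerve p := fun m =>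
    if h : ∀ i, G.tgt (a i m) = o i.castSucc m then
      ⟨fun i => o i m, fun i => a i m, h, fun i => by rw [os]⟩ else g₀
  have hR : ∀ᶠ m in 𝓝 m₀, (∀ i, (R m).obj i = o i m) ∧ ∀ i, (R m).arr i = a i m := by
    filter_upwards [ht] with m h
    simp only [R, dif_pos h, implies_true, and_self]
  have hRo : ∀ i, (fun m => (R m).obj i) =ᶠ[𝓝 m₀] o i := fun i => hR.mono fun m h => h.1 i
  have hRa : ∀ i, (fun m => (R m).arr i) =ᶠ[𝓝 m₀] a i := fun i => hR.mono fun m h => h.2 i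
  refine ⟨R, ⟨fun i => (so i).1.congr (hRo i).symm, fun i => (sa i).1.congr (hRa i).symm⟩,
    ?_, hRo 0, ?_⟩
  · have h1 : ∀ᶠ g in 𝓝 g₀, ∀ i, g.obj i ∈ (φ i).source := Filter.eventually_all.2 fun i =>
      (SetGroupoid.continuous_nerve_obj i).continuousAt.eventually
        (extChartAt_source_mem_nhds (I := 𝓘(ℝ, E)) (g₀.obj i))
    have h2 : ∀ᶠ g in 𝓝 g₀, ∀ i, ρ i (φ i.castSucc (G.tgt (g.arr i)), ψ i (g.arr i)) = g.arr i :=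
      Filter.eventually_all.2 fun i =>
        (SetGroupoid.continuous_nerve_arr i).continuousAt.eventually (ρu i)
    filter_upwards [h1, h2, (continuousAt_nerveChart g₀).eventually hR] with g h1 h2 h3
    have ha : ∀ i : Fin p, o i.castSucc (G.nerveChart g₀ g) = g.obj i.castSucc →
        a i (G.nerveChart g₀ g) = g.arr i := fun i hi => by
      have := h2 i
      rw [g.tgt_arr] at this
      change ρ i _ = _
      rw [hi]
      exact this
    have ho : ∀ i, o i (G.nerveChart g₀ g) = g.obj i := fun i => by
      induction i using Fin.induction with
      | zero => exact (φ 0).left_inv (h1 0)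
      | succ i ih => simp only [os, ha i ih, g.src_arr]
    ext i
    · rw [h3.1, ho]
    · rw [h3.2, ha i (ho _)]
  · intro base vec hb hv
    have da : ∀ i : Fin p, md (E × (Fin p → F)) E (o i.castSucc) m₀ (base 0, vec) = base i.castSucc →
        md (E × (Fin p → F)) F (a i) m₀ (base 0, vec) = vec i := by
      intro i hi
      -- The correction `ρ i` is undone by `b ↦ (φ (t b), ψ b)`, whose derivative sends `vec i` to
      -- `(base i.castSucc, vec i)`. The arguments of `ρ i` in `a i` vary in the same direction, so
      -- the derivative of `a i` is `vec i`.
      have d1 : md F F (fun b => ρ i (φ i.castSucc (G.tgt b), ψ i b)) (g₀.arr i) = .id ℝ F := by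
        rw [md_congr (ρu i), md_id]
      have d2 : md F (E × F) (fun b => (φ i.castSucc (G.tgt b), ψ i b)) (g₀.arr i) (vec i) =
          (base i.castSucc, vec i) := by
        have e1 : MDifferentiableAt 𝓘(ℝ, E) 𝓘(ℝ, E) (φ i.castSucc) (G.tgt (g₀.arr i)) := by
          rw [g₀.tgt_arr]; exact mdifferentiableAt_extChartAt_self _
        have e2 : MDifferentiableAt 𝓘(ℝ, F) 𝓘(ℝ, E) (fun b => φ i.castSucc (G.tgt b)) (g₀.arr i) :=
          e1.comp (g₀.arr i) (stgt _).mdifferentiableAt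
        rw [md_prodMk (g := ψ i) e2 (mdifferentiableAt_extChartAt_self _), ContinuousLinearMap.prod_apply,
          md_extChartAt_self, md_comp e1 (stgt _).mdifferentiableAt,
          ContinuousLinearMap.comp_apply, hb, g₀.tgt_arr, md_extChartAt_self]
        rfl
      have d3 : md (E × (Fin p → F)) (E × F) (fun m => (φ i.castSucc (o i.castSucc m), m.2 i)) m₀
          (base 0, vec) = (base i.castSucc, vec i) := by
        have e1 : MDifferentiableAt 𝓘(ℝ, E) 𝓘(ℝ, E) (φ i.castSucc) (o i.castSucc m₀) := by
          rw [(so _).2]; exact mdifferentiableAt_extChartAt_self _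
        have e2 : HasFDerivAt (fun m : E × (Fin p → F) => m.2 i)
            ((ContinuousLinearMap.proj i).comp (.snd ℝ E (Fin p → F))) m₀ :=
          ((ContinuousLinearMap.proj i).comp (.snd ℝ E (Fin p → F))).hasFDerivAt
        have e3 : MDifferentiableAt 𝓘(ℝ, E × (Fin p → F)) 𝓘(ℝ, E)
            (fun m => φ i.castSucc (o i.castSucc m)) m₀ := e1.comp m₀ (so _).1.mdifferentiableAt
        rw [md_prodMk (g := fun m : E × (Fin p → F) => m.2 i) e3 e2.differentiableAt.mdifferentiableAt, ContinuousLinearMap.prod_apply,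
          md_comp e1 (so _).1.mdifferentiableAt, ContinuousLinearMap.comp_apply, hi, (so _).2,
          md_extChartAt_self, md_eq_fderiv, e2.fderiv]
        rfl
      have e1' : MDifferentiableAt 𝓘(ℝ, E) 𝓘(ℝ, E) (φ i.castSucc) (G.tgt (g₀.arr i)) := by
        rw [g₀.tgt_arr]; exact mdifferentiableAt_extChartAt_self _
      have d4 := md_comp (E'' := F) (g := ρ i) (x := m₀) (by rw [ec]; exact (ρs i).mdifferentiableAt)
        (sc i).mdifferentiableAt
      have d5 := md_comp (E'' := F) (g := ρ i) (f := fun b => (φ i.castSucc (G.tgt b), ψ i b))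
        (x := g₀.arr i) (by rw [g₀.tgt_arr]; exact (ρs i).mdifferentiableAt)
        (MDifferentiableAt.prodMk_space (e1'.comp (g₀.arr i) (stgt _).mdifferentiableAt)
          (mdifferentiableAt_extChartAt_self _))
      rw [d1, g₀.tgt_arr] at d5
      change md (E × (Fin p → F)) F (fun m => ρ i _) m₀ _ = _
      rw [d4, ContinuousLinearMap.comp_apply, d3, ec, ← d2, ← ContinuousLinearMap.comp_apply, ← d5]
      rfl
    have dob : ∀ i, md (E × (Fin p → F)) E (o i) m₀ (base 0, vec) = base i := by
      intro i
      induction i using Fin.induction with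
      | zero =>
        rw [o0, md_comp (g := (φ 0).symm) (f := Prod.fst)
          (smoothNear_extChartAt_symm (mem_extChartAt_target _)).mdifferentiableAt
          differentiableAt_fst.mdifferentiableAt, md_eq_fderiv, fderiv_fst]
        change md E E (φ 0).symm (φ 0 (g₀.obj 0)) (base 0) = base 0
        rw [md_extChartAt_symm_self]
        rfl
      | succ i ih =>
        rw [os, md_comp (ssrc _).mdifferentiableAt (sa i).1.mdifferentiableAt,
          ContinuousLinearMap.comp_apply, da i ih, (sa i).2, hv]
    exact ⟨fun i => by rw [md_congr (hRo i), dob], fun i => by rw [md_congr (hRa i), da i (dob _)]⟩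

end LieGroupoid
-- Exterior derivatives through the local parametrization
namespace LieGroupoid

variable {E X F A : Type*} [NormedAddCommGroup E] [NormedSpace ℝ E]
  [TopologicalSpace X] [ChartedSpace E X] [NormedAddCommGroup F] [NormedSpace ℝ F]
  [TopologicalSpace A] [ChartedSpace F A] {G : LieGroupoid E X F A} {p q : ℕ}
  {V : Type*} [NormedAddCommGroup V] [NormedSpace ℝ V]
  [IsManifold 𝓘(ℝ, E) ∞ X] [IsManifold 𝓘(ℝ, F) ∞ A]

variable (G) in
/-- A local parametrization of the manifold of strings near `g₀`, inverse to `nerveChart`. -/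
def nerveParam (g₀ : G.Nerve p) : E × (Fin p → F) → G.Nerve p :=
  (exists_nerveParam g₀).choose

variable (G) in
/-- The string `g` is so near to `g₀` that `nerveParam g₀` is well behaved there. -/
structure IsNear (g₀ g : G.Nerve p) : Prop where
  plotAt : G.PlotAt (G.nerveParam g₀) (G.nerveChart g₀ g)
  param_chart : ∀ᶠ g' in 𝓝 g, G.nerveParam g₀ (G.nerveChart g₀ g') = g'
  obj_zero : ∀ᶠ m in 𝓝 (G.nerveChart g₀ g),
    (G.nerveParam g₀ m).obj 0 = (extChartAt 𝓘(ℝ, E) (g₀.obj 0)).symm m.1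
  obj_mem : g.obj 0 ∈ (extChartAt 𝓘(ℝ, E) (g₀.obj 0)).source
  arr_mem : ∀ i, g.arr i ∈ (extChartAt 𝓘(ℝ, F) (g₀.arr i)).source

theorem eventually_isNear (g₀ : G.Nerve p) : ∀ᶠ g in 𝓝 g₀, G.IsNear g₀ g := by
  obtain ⟨h1, h2, h3, -⟩ := (exists_nerveParam g₀).choose_spec
  filter_upwards [(continuousAt_nerveChart g₀).eventually h1.eventually,
    eventually_eventually_nhds.2 h2,
    (continuousAt_nerveChart g₀).eventually (eventually_eventually_nhds.2 h3),
    (SetGroupoid.continuous_nerve_obj 0).continuousAt.eventually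
      (extChartAt_source_mem_nhds (I := 𝓘(ℝ, E)) (g₀.obj 0)),
    Filter.eventually_all.2 fun i => (SetGroupoid.continuous_nerve_arr i).continuousAt.eventually
      (extChartAt_source_mem_nhds (I := 𝓘(ℝ, F)) (g₀.arr i))] with g h1 h2 h3 h4 h5
  exact ⟨h1, h2, h3, h4, h5⟩

theorem isNear_self (g₀ : G.Nerve p) : G.IsNear g₀ g₀ := (eventually_isNear g₀).self_of_nhds

theorem IsNear.param_chart_self {g₀ g : G.Nerve p} (h : G.IsNear g₀ g) :
    G.nerveParam g₀ (G.nerveChart g₀ g) = g := h.param_chart.self_of_nhds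

theorem md_nerveParam_obj (g₀ : G.Nerve p) {base : Fin (p + 1) → E} {vec : Fin p → F}
    (hb : ∀ i, md F E G.tgt (g₀.arr i) (vec i) = base i.castSucc)
    (hv : ∀ i, md F E G.src (g₀.arr i) (vec i) = base i.succ) (i : Fin (p + 1)) :
    md (E × (Fin p → F)) E (fun m => (G.nerveParam g₀ m).obj i) (G.nerveChart g₀ g₀)
      (base 0, vec) = base i :=
  ((exists_nerveParam g₀).choose_spec.2.2.2 base vec hb hv).1 i

theorem md_nerveParam_arr (g₀ : G.Nerve p) {base : Fin (p + 1) → E} {vec : Fin p → F}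
    (hb : ∀ i, md F E G.tgt (g₀.arr i) (vec i) = base i.castSucc)
    (hv : ∀ i, md F E G.src (g₀.arr i) (vec i) = base i.succ) (i : Fin p) :
    md (E × (Fin p → F)) F (fun m => (G.nerveParam g₀ m).arr i) (G.nerveChart g₀ g₀)
      (base 0, vec) = vec i :=
  ((exists_nerveParam g₀).choose_spec.2.2.2 base vec hb hv).2 i

theorem IsNear.smoothNear_nerveChart {g₀ : G.Nerve p} {ξ : V → G.Nerve p} {u : V}
    (h : G.IsNear g₀ (ξ u)) (hξ : G.PlotAt ξ u) :
    SmoothNear V (E × (Fin p → F)) (fun u' => G.nerveChart g₀ (ξ u')) u :=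
  .prodMk (SmoothNear.comp (smoothNear_extChartAt h.obj_mem) (hξ.obj 0))
    (.pi fun i => SmoothNear.comp (smoothNear_extChartAt (h.arr_mem i)) (hξ.arr i))

theorem IsNear.fderiv_nerveChart {g₀ : G.Nerve p} {ξ : V → G.Nerve p} {u : V}
    (h : G.IsNear g₀ (ξ u)) (hξ : G.PlotAt ξ u) (e : V) :
    fderiv ℝ (fun u' => G.nerveChart g₀ (ξ u')) u e =
      (md E E (extChartAt 𝓘(ℝ, E) (g₀.obj 0)) ((ξ u).obj 0) (md V E (fun u' => (ξ u').obj 0) u e),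
        fun i => md F F (extChartAt 𝓘(ℝ, F) (g₀.arr i)) ((ξ u).arr i)
          (md V F (fun u' => (ξ u').arr i) u e)) := by
  have h1 : SmoothNear V E (fun u' => extChartAt 𝓘(ℝ, E) (g₀.obj 0) ((ξ u').obj 0)) u :=
    SmoothNear.comp (smoothNear_extChartAt h.obj_mem) (hξ.obj 0)
  have h2 : ∀ i, SmoothNear V F (fun u' => extChartAt 𝓘(ℝ, F) (g₀.arr i) ((ξ u').arr i)) u :=
    fun i => SmoothNear.comp (smoothNear_extChartAt (h.arr_mem i)) (hξ.arr i)
  have h3 := fun i => (h2 i).contDiffAt.differentiableAt (by simp)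
  have e1 : fderiv ℝ (fun u' => G.nerveChart g₀ (ξ u')) u =
      (fderiv ℝ (fun u' => extChartAt 𝓘(ℝ, E) (g₀.obj 0) ((ξ u').obj 0)) u).prod
        (.pi fun i => fderiv ℝ (fun u' => extChartAt 𝓘(ℝ, F) (g₀.arr i) ((ξ u').arr i)) u) :=
    ((h1.contDiffAt.differentiableAt (by simp)).hasFDerivAt.prodMk
      (hasFDerivAt_pi.2 fun i => (h3 i).hasFDerivAt)).fderiv
  rw [e1]
  simp only [← md_eq_fderiv]
  rw [md_comp (f := fun u' => (ξ u').obj 0)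
    (smoothNear_extChartAt h.obj_mem).mdifferentiableAt (hξ.obj 0).mdifferentiableAt]
  refine Prod.ext rfl (funext fun i => ?_)
  change md V F (fun u' => extChartAt 𝓘(ℝ, F) (g₀.arr i) ((ξ u').arr i)) u e = _
  rw [md_comp (f := fun u' => (ξ u').arr i)
    (smoothNear_extChartAt (h.arr_mem i)).mdifferentiableAt (hξ.arr i).mdifferentiableAt]
  rfl

theorem fderiv_nerveChart_self {ξ : V → G.Nerve p} {u : V} (hξ : G.PlotAt ξ u) (e : V) :
    fderiv ℝ (fun u' => G.nerveChart (ξ u) (ξ u')) u e =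
      (md V E (fun u' => (ξ u').obj 0) u e, fun i => md V F (fun u' => (ξ u').arr i) u e) := by
  have : IsManifold 𝓘(ℝ, E) 1 X := .of_le (n := ∞) (by simp)
  have : IsManifold 𝓘(ℝ, F) 1 A := .of_le (n := ∞) (by simp)
  rw [(isNear_self (ξ u)).fderiv_nerveChart hξ]
  simp only [md_extChartAt_self]
  rfl

variable [FiniteDimensional ℝ E] [FiniteDimensional ℝ F]

/-- Near `u` the plot is the parametrization composed with the coordinates of the plot, so
naturality of the exterior derivative applies to an ordinary map of vector spaces. Hence only the
first derivative of the plot at `u` enters. -/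
theorem IsNear.extDeriv_pull {θ : G.Nerve p → E [⋀^Fin q]→L[ℝ] ℝ} (hθ : G.IsSmoothForm θ)
    {g₀ : G.Nerve p} {ξ : V → G.Nerve p} {u : V} (h : G.IsNear g₀ (ξ u)) (hξ : G.PlotAt ξ u) :
    extDeriv (G.pull θ ξ) u = (extDeriv (G.pull θ (G.nerveParam g₀))
      (G.nerveChart g₀ (ξ u))).compContinuousLinearMap
        (fderiv ℝ (fun u' => G.nerveChart g₀ (ξ u')) u) := by
  rw [← hθ.extDeriv_pull_comp (f := fun u' => G.nerveChart g₀ (ξ u')) h.plotAt (h.smoothNear_nerveChart hξ)]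
  refine Filter.EventuallyEq.extDeriv_eq ?_
  have h1 : ξ =ᶠ[𝓝 u] fun u' => G.nerveParam g₀ (G.nerveChart g₀ (ξ u')) :=
    (hξ.continuousAt.eventually h.param_chart).mono fun u' h => h.symm
  filter_upwards [h1, h1.eventually_nhds] with u' h2 h3
  rw [pull, pull, ← h2, md_congr (f := fun u' => (ξ u').obj 0)
    (h3.mono fun x hx => congrArg (fun g => g.obj 0) hx)]

/-- The exterior derivative of the pull-back of a form depends only on the tangent vectors of the
plot. -/
theorem IsSmoothForm.extDeriv_pull_apply {θ : G.Nerve p → E [⋀^Fin q]→L[ℝ] ℝ}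
    (hθ : G.IsSmoothForm θ) {g : G.Nerve p} {ξ : V → G.Nerve p} {u : V} (hξ : G.PlotAt ξ u)
    (hg : ξ u = g) (e : Fin (q + 1) → V) {base : Fin (q + 1) → E} {vec : Fin (q + 1) → Fin p → F}
    (hb : ∀ j, md V E (fun u' => (ξ u').obj 0) u (e j) = base j)
    (hv : ∀ j i, md V F (fun u' => (ξ u').arr i) u (e j) = vec j i) :
    extDeriv (G.pull θ ξ) u e = extDeriv (G.pull θ (G.nerveParam g)) (G.nerveChart g g)
      fun j => (base j, vec j) := by
  subst hg
  rw [(isNear_self (ξ u)).extDeriv_pull hθ hξ, ContinuousAlternatingMap.compContinuousLinearMap_apply]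
  congr 1
  ext1 j
  simp only [Function.comp_apply, fderiv_nerveChart_self hξ, hb, hv]

end LieGroupoid

/-- Differentiate `f (ρ (y, b)) = φ⁻¹ y` for the local sections `ρ`: the preimage of `b` is the
derivative of `ρ` along `(b, 0)`. -/
theorem md_surjective_of_isSubmersion {E X E' X' : Type*} [NormedAddCommGroup E] [NormedSpace ℝ E]
    [TopologicalSpace X] [ChartedSpace E X] [IsManifold 𝓘(ℝ, E) ∞ X] [NormedAddCommGroup E']
    [NormedSpace ℝ E'] [TopologicalSpace X'] [ChartedSpace E' X'] [IsManifold 𝓘(ℝ, E') ∞ X']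
    {f : X → X'} (hf : Manifold.IsSubmersion 𝓘(ℝ, E) 𝓘(ℝ, E') ∞ f) (a : X) :
    Function.Surjective (md E E' f a) := by
  intro b
  obtain ⟨ρ, h1, h2, h3⟩ := exists_section_of_isSubmersion hf a
  have e : ρ (extChartAt 𝓘(ℝ, E') (f a) (f a), extChartAt 𝓘(ℝ, E) a a) = a := h3.self_of_nhds
  have hfs : SmoothNear E E' f a := hf.contMDiff.smoothNear a
  have h4 := md_comp (g := f) (f := ρ) (x := (extChartAt 𝓘(ℝ, E') (f a) (f a), extChartAt 𝓘(ℝ, E) a a))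
    (by rw [e]; exact hfs.mdifferentiableAt) h1.mdifferentiableAt
  have h5 := md_comp (g := (extChartAt 𝓘(ℝ, E') (f a)).symm) (f := Prod.fst)
    (x := (extChartAt 𝓘(ℝ, E') (f a) (f a), extChartAt 𝓘(ℝ, E) a a))
    (smoothNear_extChartAt_symm (mem_extChartAt_target _)).mdifferentiableAt
    differentiableAt_fst.mdifferentiableAt
  rw [md_congr h2, h5, e, md_extChartAt_symm_self, md_eq_fderiv, fderiv_fst] at h4
  exact ⟨_, (DFunLike.congr_fun h4 (b, 0)).symm⟩

/-- Lift step by step above `k`, project below. The induction shifts the tower so that the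
prescribed entry comes first. It serves both for arrows and for tangent vectors. -/
theorem exists_compatible_seq {B : ℕ → Type*} (π : ∀ k, B (k + 1) → B k)
    (hπ : ∀ k, Function.Surjective (π k)) (k : ℕ) (y : B k) :
    ∃ c : ∀ j, B j, (∀ j, π j (c (j + 1)) = c j) ∧ c k = y := by
  induction k generalizing B with
  | zero =>
    exact ⟨Nat.rec y fun j b => (hπ j b).choose, fun j => (hπ j _).choose_spec, rfl⟩
  | succ k ih =>
    obtain ⟨c, h1, h2⟩ := ih (B := fun j => B (j + 1)) (fun j => π (j + 1)) (fun j => hπ _) y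
    exact ⟨fun | 0 => π 0 (c 0) | j + 1 => c j, fun | 0 => rfl | j + 1 => h1 j, h2⟩

/-! ### Levels of the tower -/

namespace LieGroupoidTower

variable {E X : Type*} {F A : ℕ → Type*} [NormedAddCommGroup E]
    [NormedSpace ℝ E] [TopologicalSpace X] [ChartedSpace E X] [∀ k, NormedAddCommGroup (F k)]
    [∀ k, NormedSpace ℝ (F k)] [∀ k, TopologicalSpace (A k)] [∀ k, ChartedSpace (F k) (A k)]
    {T : LieGroupoidTower E X F A}

theorem smoothNear_proj (k : ℕ) (y : A (k + 1)) : SmoothNear (F (k + 1)) (F k) (T.proj k) y :=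
  (T.proj_submersion k).contMDiff.smoothNear y

theorem smoothNear_src (k : ℕ) (y : A k) : SmoothNear (F k) E (T.level k).src y :=
  (T.level k).submersion_src.contMDiff.smoothNear y

theorem smoothNear_tgt (k : ℕ) (y : A k) : SmoothNear (F k) E (T.level k).tgt y :=
  (T.level k).submersion_tgt.contMDiff.smoothNear y

theorem smoothNear_projAdd (k n : ℕ) (y : A (k + n)) :
    SmoothNear (F (k + n)) (F k) (T.projAdd k n) y := by
  induction n with
  | zero => exact contMDiff_id.smoothNear y
  | succ n ih => exact SmoothNear.comp (f := T.proj (k + n)) (ih _) (smoothNear_proj _ y)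

theorem projAdd_comp (k n : ℕ) (g : T.Arrow) : T.projAdd k n (g.comp (k + n)) = g.comp k := by
  induction n with
  | zero => rfl
  | succ n ih => rw [← ih, ← g.proj_comp (k + n)]; rfl

theorem exists_arrow (k : ℕ) (y : A k) : ∃ g : T.Arrow, g.comp k = y := by
  obtain ⟨c, h1, h2⟩ := exists_compatible_seq T.proj T.proj_surjective k y
  exact ⟨⟨c, h1⟩, h2⟩

/-- Strings lift arrow by arrow: composability is a condition on sources and targets, which the
projections preserve. -/
theorem nerveComp_surjective (k p : ℕ) : Function.Surjective (T.nerveComp k (p := p)) := by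
  intro y
  choose a ha using fun i => exists_arrow (T := T) k (y.arr i)
  refine ⟨⟨y.obj, a, fun i => ?_, fun i => ?_⟩, ?_⟩
  · exact ((a i).tgt_comp k).symm.trans (by rw [ha, y.tgt_arr])
  · exact ((a i).src_comp k).symm.trans (by rw [ha, y.src_arr])
  · ext i
    · rfl
    · exact ha i

/-- The section is a mere choice of lifts and has no continuity. None is needed, since being a plot
at level `k` only concerns the component at level `k`; but it must return the given `g`, on whose
higher components the lift depends. -/
theorem exists_lift (k : ℕ) {p : ℕ} (g : T.limit.Nerve p) :
    ∃ s : (T.level k).Nerve p → T.limit.Nerve p,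
      (∀ y, T.nerveComp k (s y) = y) ∧ s (T.nerveComp k g) = g := by
  classical
  refine ⟨fun y => if T.nerveComp k g = y then g else (nerveComp_surjective k p y).choose,
    fun y => ?_, if_pos rfl⟩
  dsimp only
  split_ifs with h
  · exact h
  · exact (nerveComp_surjective k p y).choose_spec

/-! ## Tangent vectors of the inverse limit -/

theorem md_proj_of_mem_tangent {g : T.Arrow} {v : T.TangentSeq g} (hv : v ∈ T.tangent g) (k : ℕ) :
    md (F (k + 1)) (F k) (T.proj k) (g.comp (k + 1)) (v (k + 1)) = v k := hv k

theorem md_projAdd_of_mem_tangent {g : T.Arrow} {v : T.TangentSeq g} (hv : v ∈ T.tangent g)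
    (k n : ℕ) : md (F (k + n)) (F k) (T.projAdd k n) (g.comp (k + n)) (v (k + n)) = v k := by
  induction n with
  | zero => exact DFunLike.congr_fun (md_id (E := F k) (g.comp k)) _
  | succ n ih =>
    have h := md_comp (g := T.projAdd k n) (f := T.proj (k + n)) (x := g.comp (k + n + 1))
      (smoothNear_projAdd k n _).mdifferentiableAt (smoothNear_proj _ _).mdifferentiableAt
    refine (DFunLike.congr_fun h _).trans ?_
    change md (F (k + n)) (F k) (T.projAdd k n) _
      (md (F (k + n + 1)) (F (k + n)) (T.proj (k + n)) _ (v (k + n + 1))) = _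
    rw [md_proj_of_mem_tangent hv, g.proj_comp, ih]

theorem md_tgt_of_mem_tangent {g : T.Arrow} {v : T.TangentSeq g} (hv : v ∈ T.tangent g) (k : ℕ) :
    md (F k) E (T.level k).tgt (g.comp k) (v k) = T.dTgt g v := by
  induction k with
  | zero => rfl
  | succ k ih =>
    have h := md_comp (g := (T.level k).tgt) (f := T.proj k) (x := g.comp (k + 1))
      (smoothNear_tgt k _).mdifferentiableAt (smoothNear_proj _ _).mdifferentiableAt
    rw [show (fun y => (T.level k).tgt (T.proj k y)) = (T.level (k + 1)).tgt from
      funext (T.tgt_proj k)] at h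
    rw [h]
    change md (F k) E (T.level k).tgt _ (md (F (k + 1)) (F k) (T.proj k) _ (v (k + 1))) = _
    rw [md_proj_of_mem_tangent hv, g.proj_comp, ih]

theorem md_src_of_mem_tangent {g : T.Arrow} {v : T.TangentSeq g} (hv : v ∈ T.tangent g) (k : ℕ) :
    md (F k) E (T.level k).src (g.comp k) (v k) = T.dSrc g v := by
  induction k with
  | zero => rfl
  | succ k ih =>
    have h := md_comp (g := (T.level k).src) (f := T.proj k) (x := g.comp (k + 1))
      (smoothNear_src k _).mdifferentiableAt (smoothNear_proj _ _).mdifferentiableAt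
    rw [show (fun y => (T.level k).src (T.proj k y)) = (T.level (k + 1)).src from
      funext (T.src_proj k)] at h
    rw [h]
    change md (F k) E (T.level k).src _ (md (F (k + 1)) (F k) (T.proj k) _ (v (k + 1))) = _
    rw [md_proj_of_mem_tangent hv, g.proj_comp, ih]

variable [IsManifold 𝓘(ℝ, E) ∞ X] [∀ k, IsManifold 𝓘(ℝ, F k) ∞ (A k)]

theorem exists_mem_tangent (g : T.Arrow) (v : E) : ∃ w ∈ T.tangent g, T.dTgt g w = v := by
  obtain ⟨w, hw⟩ := md_surjective_of_isSubmersion (T.level 0).submersion_tgt (g.comp 0) v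
  have h : ∀ k, Function.Surjective (md (F (k + 1)) (F k) (T.proj k) (g.comp (k + 1))) :=
    fun k => md_surjective_of_isSubmersion (T.proj_submersion k) _
  obtain ⟨c, h1, h2⟩ := exists_compatible_seq (B := F)
    (fun k => md (F (k + 1)) (F k) (T.proj k) (g.comp (k + 1))) h 0 w
  refine ⟨c, h1, ?_⟩
  change md (F 0) E (T.level 0).tgt (g.comp 0) (c 0) = v
  rw [h2, hw]

/-! ### The horizontal lift -/

namespace EhresmannConnection

variable (C : EhresmannConnection T)

theorem mem_tangent {g : T.Arrow} {w : T.TangentSeq g} (hw : w ∈ C.carrier g) : w ∈ T.tangent g :=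
  C.sup_eq g ▸ Submodule.mem_sup_left hw

/-- The kernel of `dt` in the tangent space is the vertical space. It meets the connection
trivially, and it can be split off from any tangent vector without changing its image; every vector
of `TX` is the image of a tangent vector because target and projections are submersions. -/
theorem bijective_dTgt (g : T.Arrow) :
    Function.Bijective ((T.dTgt g).domRestrict (C.carrier g)) := by
  constructor
  · rw [← LinearMap.ker_eq_bot, LinearMap.ker_eq_bot']
    rintro ⟨w, hw⟩ h
    exact Subtype.ext ((Submodule.disjoint_def.1 (C.disjoint g)) w hw ⟨C.mem_tangent hw, h⟩)
  · intro v
    obtain ⟨w, hw, rfl⟩ := exists_mem_tangent g v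
    rw [← C.sup_eq g] at hw
    obtain ⟨a, ha, b, hb, rfl⟩ := Submodule.mem_sup.1 hw
    refine ⟨⟨a, ha⟩, ?_⟩
    rw [map_add, show T.dTgt g b = 0 from hb.2, add_zero]
    rfl

/-- The horizontal lift. -/
def hor (g : T.Arrow) : E →ₗ[ℝ] T.TangentSeq g :=
  (C.carrier g).subtype ∘ₗ (LinearEquiv.ofBijective _ (C.bijective_dTgt g)).symm.toLinearMap

theorem hor_mem (g : T.Arrow) (v : E) : C.hor g v ∈ C.carrier g :=
  ((LinearEquiv.ofBijective _ (C.bijective_dTgt g)).symm v).2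

theorem dTgt_hor (g : T.Arrow) (v : E) : T.dTgt g (C.hor g v) = v :=
  (LinearEquiv.ofBijective _ (C.bijective_dTgt g)).apply_symm_apply v

theorem eq_hor {g : T.Arrow} {w : T.TangentSeq g} (hw : w ∈ C.carrier g) :
    w = C.hor g (T.dTgt g w) :=
  congrArg Subtype.val
    ((LinearEquiv.ofBijective _ (C.bijective_dTgt g)).symm_apply_apply ⟨w, hw⟩).symm

theorem hor_mem_tangent (g : T.Arrow) (v : E) : C.hor g v ∈ T.tangent g :=
  C.mem_tangent (C.hor_mem g v)

variable [FiniteDimensional ℝ E]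

/-- The component at level `k` of the horizontal lift. -/
def horAt (k : ℕ) (g : T.Arrow) : E →L[ℝ] F k :=
  LinearMap.toContinuousLinearMap (LinearMap.proj (φ := F) k ∘ₗ C.hor g)

theorem horAt_apply (k : ℕ) (g : T.Arrow) (v : E) : C.horAt k g v = C.hor g v k := rfl

theorem md_tgt_horAt (k : ℕ) (g : T.Arrow) (v : E) :
    md (F k) E (T.level k).tgt (g.comp k) (C.horAt k g v) = v :=
  (md_tgt_of_mem_tangent (C.hor_mem_tangent g v) k).trans (C.dTgt_hor g v)

theorem md_projAdd_horAt (k n : ℕ) (g : T.Arrow) (v : E) :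
    md (F (k + n)) (F k) (T.projAdd k n) (g.comp (k + n)) (C.horAt (k + n) g v) = C.horAt k g v :=
  md_projAdd_of_mem_tangent (C.hor_mem_tangent g v) k n

/-- The linear map `λ_g^* = ds ∘ hor_g`. -/
def lam (g : T.Arrow) : E →L[ℝ] E :=
  LinearMap.toContinuousLinearMap (T.dSrc g ∘ₗ C.hor g)

theorem md_src_horAt (k : ℕ) (g : T.Arrow) (v : E) :
    md (F k) E (T.level k).src (g.comp k) (C.horAt k g v) = C.lam g v :=
  md_src_of_mem_tangent (C.hor_mem_tangent g v) k

/-- The images of the horizontal lift of a vector under the differentials of `g ↦ x_i`. -/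
def hbase {p : ℕ} (g : T.limit.Nerve p) (i : Fin (p + 1)) : E →L[ℝ] E :=
  Fin.induction (motive := fun _ => E →L[ℝ] E) (.id ℝ E) (fun i L => (C.lam (g.arr i)).comp L) i

theorem hbase_zero {p : ℕ} (g : T.limit.Nerve p) : C.hbase g 0 = .id ℝ E := rfl

theorem hbase_succ {p : ℕ} (g : T.limit.Nerve p) (i : Fin p) :
    C.hbase g i.succ = (C.lam (g.arr i)).comp (C.hbase g i.castSucc) := Fin.induction_succ _ _ i

/-- The component at level `k` of the `i`-th arrow of the horizontal lift. -/
def hvec (k : ℕ) {p : ℕ} (g : T.limit.Nerve p) (i : Fin p) : E →L[ℝ] F k :=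
  (C.horAt k (g.arr i)).comp (C.hbase g i.castSucc)

theorem md_tgt_hvec (k : ℕ) {p : ℕ} (g : T.limit.Nerve p) (v : E) (i : Fin p) :
    md (F k) E (T.level k).tgt ((T.nerveComp k g).arr i) (C.hvec k g i v) =
      C.hbase g i.castSucc v := C.md_tgt_horAt k _ _

theorem md_src_hvec (k : ℕ) {p : ℕ} (g : T.limit.Nerve p) (v : E) (i : Fin p) :
    md (F k) E (T.level k).src ((T.nerveComp k g).arr i) (C.hvec k g i v) = C.hbase g i.succ v := by
  rw [hbase_succ]; exact C.md_src_horAt k _ _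

end EhresmannConnection

namespace CartanConnection

variable [FiniteDimensional ℝ E] {C : CartanConnection T} {p : ℕ} {g : T.limit.Nerve p}

/-- The vector at an arrow is the lift of its target component, and its source component is the
target component at the next arrow. So the vector at `x_0` determines all others. -/
theorem Horizontal.base_eq (w : C.Horizontal g) (i : Fin (p + 1)) :
    w.base i = C.hbase g i (w.base 0) := by
  induction i using Fin.induction with
  | zero => rfl
  | succ i ih =>
    rw [C.hbase_succ, ContinuousLinearMap.comp_apply, ← ih, ← w.src_vec i, ← w.tgt_vec i]
    conv_lhs => rw [C.eq_hor (w.mem i)]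
    rfl

theorem Horizontal.vec_eq (w : C.Horizontal g) (i : Fin p) (k : ℕ) :
    (w.vec i k : F k) = C.hvec k g i (w.base 0) := by
  conv_lhs => rw [C.eq_hor (w.mem i), w.tgt_vec, w.base_eq]
  rfl

variable (C g) in
/-- The horizontal lift of a vector to a string. -/
def horizontal (v : E) : C.Horizontal g where
  base i := C.hbase g i v
  vec i := C.hor (g.arr i) (C.hbase g i.castSucc v)
  mem i := C.hor_mem _ _
  tgt_vec i := C.dTgt_hor _ _
  src_vec i := by rw [C.hbase_succ]; rfl

end CartanConnection

end LieGroupoidTower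
theorem md_comp_hasFDerivAt {V W E X : Type*} [NormedAddCommGroup V] [NormedSpace ℝ V]
    [NormedAddCommGroup W] [NormedSpace ℝ W] [NormedAddCommGroup E] [NormedSpace ℝ E]
    [TopologicalSpace X] [ChartedSpace E X] {r : W → X} {f : V → W} {x : V} {L : V →L[ℝ] W}
    (hr : SmoothNear W E r (f x)) (hf : HasFDerivAt f L x) (v : V) :
    md V E (fun y => r (f y)) x v = md W E r (f x) (L v) := by
  rw [md_comp hr.mdifferentiableAt hf.differentiableAt.mdifferentiableAt, md_eq_fderiv, hf.fderiv]
  rfl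

/-! ### Smoothness of face and degeneracy maps -/

namespace LieGroupoid

variable {E X F A : Type*} [NormedAddCommGroup E] [NormedSpace ℝ E]
  [TopologicalSpace X] [ChartedSpace E X] [NormedAddCommGroup F] [NormedSpace ℝ F]
  [TopologicalSpace A] [ChartedSpace F A] {G : LieGroupoid E X F A} {p : ℕ}
  {V : Type*} [NormedAddCommGroup V] [NormedSpace ℝ V]

theorem smoothNear_mul {a b : V → A} {u : V} (ha : SmoothNear V F a u) (hb : SmoothNear V F b u)
    (hab : ∀ᶠ u' in 𝓝 u, G.src (a u') = G.tgt (b u')) :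
    SmoothNear V F (fun u' => G.mul (a u') (b u')) u := by
  filter_upwards [ha, hb, eventually_eventually_nhds.2 hab] with x h1 h2 h3
  exact ((G.smooth_mul (a x, b x) h3.self_of_nhds).comp x (h1.prodMk h2).contMDiffWithinAt
    (s := {u' | G.src (a u') = G.tgt (b u')}) fun _ h => h).contMDiffAt h3

/-- The derivative within the set of composable pairs may be ambiguous off the tangent directions of
that set. Its value on the velocity of a map into the set is determined by the chain rule. -/
theorem tangentMul_md {a b : V → A} {u : V} (ha : SmoothNear V F a u) (hb : SmoothNear V F b u)
    (hab : ∀ᶠ u' in 𝓝 u, G.src (a u') = G.tgt (b u')) (e : V) :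
    G.tangentMul (a u) (b u) (md V F a u e) (md V F b u e) =
      md V F (fun u' => G.mul (a u') (b u')) u e := by
  have h1 := ((G.smooth_mul (a u, b u) hab.self_of_nhds).mdifferentiableWithinAt
    (by simp)).hasMFDerivWithinAt
  have h2 := (ha.mdifferentiableAt.hasMFDerivAt.prodMk
    hb.mdifferentiableAt.hasMFDerivAt).hasMFDerivWithinAt
    (s := {u' | G.src (a u') = G.tgt (b u')})
  have h3 := (HasMFDerivWithinAt.comp (g := fun a : A × A => G.mul a.1 a.2)
    (u := {a : A × A | G.src a.1 = G.tgt a.2}) u h1 h2 fun _ h => h).hasMFDerivAt hab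
  exact (DFunLike.congr_fun h3.mfderiv e).symm

theorem PlotAt.face {ξ : V → G.Nerve (p + 1)} {u : V} (h : G.PlotAt ξ u) (i : Fin (p + 2)) :
    G.PlotAt (fun u' => G.face i (ξ u')) u := by
  refine ⟨fun j => h.obj _, fun j => ?_⟩
  simp only [SetGroupoid.face]
  split_ifs
  · exact h.arr _
  · exact smoothNear_mul (h.arr _) (h.arr _) (.of_forall fun u' => by
      rw [(ξ u').src_arr, (ξ u').tgt_arr, Fin.succ_castSucc])
  · exact h.arr _

theorem PlotAt.degen {ξ : V → G.Nerve p} {u : V} (h : G.PlotAt ξ u) (i : Fin (p + 1)) :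
    G.PlotAt (fun u' => G.degen i (ξ u')) u := by
  refine ⟨fun j => h.obj _, fun j => ?_⟩
  simp only [SetGroupoid.degen]
  split_ifs
  · exact h.arr _
  · exact h.arr _
  · exact SmoothNear.comp (f := fun u' => (ξ u').obj i) (G.smooth_unit.smoothNear _) (h.obj i)

end LieGroupoid

namespace LieGroupoidTower

variable {E X : Type*} {F A : ℕ → Type*} [NormedAddCommGroup E]
    [NormedSpace ℝ E] [TopologicalSpace X] [ChartedSpace E X] [∀ k, NormedAddCommGroup (F k)]
    [∀ k, NormedSpace ℝ (F k)] [∀ k, TopologicalSpace (A k)] [∀ k, ChartedSpace (F k) (A k)]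
    {T : LieGroupoidTower E X F A} {p : ℕ}
    {V : Type*} [NormedAddCommGroup V] [NormedSpace ℝ V]

theorem comp_limit_mul {g h : T.Arrow} (H : T.limit.src g = T.limit.tgt h) (k : ℕ) :
    (T.limit.mul g h).comp k = (T.level k).mul (g.comp k) (h.comp k) :=
  congrArg (fun a : T.Arrow => a.comp k) (dif_pos H)

theorem nerveComp_face (k : ℕ) (g : T.limit.Nerve (p + 1)) (i : Fin (p + 2)) :
    T.nerveComp k (T.limit.face i g) = (T.level k).face i (T.nerveComp k g) := by
  ext j
  · rfl
  · simp only [nerveComp, SetGroupoid.face]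
    split_ifs
    · rfl
    · exact comp_limit_mul (by rw [g.src_arr, g.tgt_arr, Fin.succ_castSucc]) k
    · rfl

theorem nerveComp_degen (k : ℕ) (g : T.limit.Nerve p) (i : Fin (p + 1)) :
    T.nerveComp k (T.limit.degen i g) = (T.level k).degen i (T.nerveComp k g) := by
  ext j
  · rfl
  · simp only [nerveComp, SetGroupoid.degen]
    split_ifs <;> rfl

variable (T) in
/-- The map `ξ` to the strings of the inverse limit is smooth near `u` at level `k`. -/
def PlotAt (k : ℕ) (ξ : V → T.limit.Nerve p) (u : V) : Prop :=
  (T.level k).PlotAt (fun u' => T.nerveComp k (ξ u')) u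

theorem PlotAt.obj {k : ℕ} {ξ : V → T.limit.Nerve p} {u : V} (h : T.PlotAt k ξ u)
    (i : Fin (p + 1)) : SmoothNear V E (fun u' => (ξ u').obj i) u := LieGroupoid.PlotAt.obj h i

theorem PlotAt.arr {k : ℕ} {ξ : V → T.limit.Nerve p} {u : V} (h : T.PlotAt k ξ u)
    (i : Fin p) : SmoothNear V (F k) (fun u' => ((ξ u').arr i).comp k) u :=
  LieGroupoid.PlotAt.arr h i

theorem PlotAt.of_add {k n : ℕ} {ξ : V → T.limit.Nerve p} {u : V} (h : T.PlotAt (k + n) ξ u) :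
    T.PlotAt k ξ u := by
  refine ⟨h.obj, fun i => ?_⟩
  have := SmoothNear.comp (g := T.projAdd k n) (smoothNear_projAdd k n _) (h.arr i)
  rwa [show (fun u' => T.projAdd k n (((ξ u').arr i).comp (k + n))) =
    fun u' => ((ξ u').arr i).comp k from funext fun u' => projAdd_comp _ _ _] at this

theorem PlotAt.face {k : ℕ} {ξ : V → T.limit.Nerve (p + 1)} {u : V} (h : T.PlotAt k ξ u)
    (i : Fin (p + 2)) : T.PlotAt k (fun u' => T.limit.face i (ξ u')) u := by
  simpa only [PlotAt, nerveComp_face] using LieGroupoid.PlotAt.face h i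

theorem PlotAt.degen {k : ℕ} {ξ : V → T.limit.Nerve p} {u : V} (h : T.PlotAt k ξ u)
    (i : Fin (p + 1)) : T.PlotAt k (fun u' => T.limit.degen i (ξ u')) u := by
  simpa only [PlotAt, nerveComp_degen] using LieGroupoid.PlotAt.degen h i

variable [IsManifold 𝓘(ℝ, E) ∞ X] [∀ k, IsManifold 𝓘(ℝ, F k) ∞ (A k)] [FiniteDimensional ℝ E]

/-! ### Plots that are horizontal at one point -/

namespace EhresmannConnection

variable (C : EhresmannConnection T)

/-- The tangent vectors of the plot `ξ` at `u` along `e` are, at level `k`, those of the horizontal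
lift of `v` to the string `g`. -/
structure IsHorizontalAt (k : ℕ) (ξ : V → T.limit.Nerve p) (u e : V) (g : T.limit.Nerve p) (v : E) :
    Prop where
  obj : ∀ i, md V E (fun u' => (ξ u').obj i) u e = C.hbase g i v
  arr : ∀ i, md V (F k) (fun u' => ((ξ u').arr i).comp k) u e = C.hvec k g i v

/-- A smooth map, at level `k`, from `E` to the strings that is horizontal at the coordinates of
the target of `g`. -/
structure IsHorizontalPlot (k : ℕ) (g : T.limit.Nerve p) (ξ : E → T.limit.Nerve p) : Prop where
  plotAt : T.PlotAt k ξ (extChartAt 𝓘(ℝ, E) (g.obj 0) (g.obj 0))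
  self : ξ (extChartAt 𝓘(ℝ, E) (g.obj 0) (g.obj 0)) = g
  obj_zero : ∀ᶠ x in 𝓝 (extChartAt 𝓘(ℝ, E) (g.obj 0) (g.obj 0)),
    (ξ x).obj 0 = (extChartAt 𝓘(ℝ, E) (g.obj 0)).symm x
  isHorizontalAt : ∀ v, C.IsHorizontalAt k ξ (extChartAt 𝓘(ℝ, E) (g.obj 0) (g.obj 0)) v g v

/-- Take an affine map in coordinates whose linear part is the lift at `g`, pass to strings of level
`k` by `nerveParam`, then to the limit by a set-theoretic section. The result is horizontal at its
centre only; an integral manifold is neither available nor needed at this stage. -/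
theorem exists_isHorizontalPlot (k : ℕ) (g : T.limit.Nerve p) :
    ∃ ξ, C.IsHorizontalPlot k g ξ := by
  obtain ⟨s, hs, hg⟩ := exists_lift k g
  set x₀ := extChartAt 𝓘(ℝ, E) (g.obj 0) (g.obj 0) with hx₀
  set m₀ := (T.level k).nerveChart (T.nerveComp k g) (T.nerveComp k g) with hm₀
  let H : E →L[ℝ] E × (Fin p → F k) := (ContinuousLinearMap.id ℝ E).prod
    (.pi fun i => C.hvec k g i)
  let f : E → E × (Fin p → F k) := fun x => m₀ + H (x - x₀)
  have hf : ContDiff ℝ ∞ f := contDiff_const.add (H.contDiff.comp (contDiff_id.sub contDiff_const))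
  have hf₀ : f x₀ = m₀ := by simp [f]
  -- The first coordinate of `m₀` is `x₀` and that of `H` is the identity, so the target of the plot
  -- is the inverse chart, everywhere near the centre.
  have hf1 : ∀ x, (f x).1 = x := fun x => by
    change x₀ + (x - x₀) = x
    abel
  have hdf : HasFDerivAt f H x₀ :=
    (H.hasFDerivAt.comp x₀ ((hasFDerivAt_id x₀).sub_const x₀)).const_add m₀
  have hn := (T.level k).isNear_self (T.nerveComp k g)
  have hplot : (T.level k).PlotAt (fun x => (T.level k).nerveParam (T.nerveComp k g) (f x)) x₀ :=
    .comp (by rw [hf₀]; exact hn.plotAt) (hf.smoothNear _)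
  refine ⟨fun x => s ((T.level k).nerveParam (T.nerveComp k g) (f x)), ?_, ?_, ?_, ?_⟩
  · simpa only [PlotAt, hs] using hplot
  · rw [hf₀, hn.param_chart_self, hg]
  · have h1 := hn.obj_zero
    rw [← hm₀, ← hf₀] at h1
    filter_upwards [hf.continuous.continuousAt.eventually h1] with x hx
    rw [hf1] at hx
    exact (congrArg (fun y : (T.level k).Nerve p => y.obj 0) (hs _)).trans hx
  · intro v
    refine ⟨fun i => ?_, fun i => ?_⟩
    · have e1 : (fun x => (s ((T.level k).nerveParam (T.nerveComp k g) (f x))).obj i) =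
        fun x => ((T.level k).nerveParam (T.nerveComp k g) (f x)).obj i := funext fun x =>
          congrArg (fun y : (T.level k).Nerve p => y.obj i) (hs _)
      rw [e1, md_comp_hasFDerivAt (r := fun m => ((T.level k).nerveParam (T.nerveComp k g) m).obj i)
        (by rw [hf₀]; exact hn.plotAt.obj i) hdf, hf₀]
      exact LieGroupoid.md_nerveParam_obj (T.nerveComp k g) (base := fun i => C.hbase g i v)
        (vec := fun i => C.hvec k g i v) (C.md_tgt_hvec k g v) (C.md_src_hvec k g v) i
    · have e1 : (fun x => ((s ((T.level k).nerveParam (T.nerveComp k g) (f x))).arr i).comp k) =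
        fun x => ((T.level k).nerveParam (T.nerveComp k g) (f x)).arr i := funext fun x =>
          congrArg (fun y : (T.level k).Nerve p => y.arr i) (hs _)
      rw [e1, md_comp_hasFDerivAt (r := fun m => ((T.level k).nerveParam (T.nerveComp k g) m).arr i)
        (by rw [hf₀]; exact hn.plotAt.arr i) hdf, hf₀]
      exact LieGroupoid.md_nerveParam_arr (T.nerveComp k g) (base := fun i => C.hbase g i v)
        (vec := fun i => C.hvec k g i v) (C.md_tgt_hvec k g v) (C.md_src_hvec k g v) i

end EhresmannConnection
end LieGroupoidTower

/-- The string of two composable arrows. -/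
def SetGroupoid.pair {X A : Type*} (G : SetGroupoid X A) (a b : A) (h : G.src a = G.tgt b) :
    G.Nerve 2 where
  obj := ![G.tgt a, G.src a, G.src b]
  arr := ![a, b]
  tgt_arr := Fin.forall_fin_two.2 ⟨rfl, h.symm⟩
  src_arr := Fin.forall_fin_two.2 ⟨rfl, rfl⟩

namespace LieGroupoidTower

variable {E X : Type*} {F A : ℕ → Type*} [NormedAddCommGroup E]
    [NormedSpace ℝ E] [TopologicalSpace X] [ChartedSpace E X] [∀ k, NormedAddCommGroup (F k)]
    [∀ k, NormedSpace ℝ (F k)] [∀ k, TopologicalSpace (A k)] [∀ k, ChartedSpace (F k) (A k)]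
    {T : LieGroupoidTower E X F A} {p : ℕ}
    {V : Type*} [NormedAddCommGroup V] [NormedSpace ℝ V]
    [IsManifold 𝓘(ℝ, E) ∞ X] [∀ k, IsManifold 𝓘(ℝ, F k) ∞ (A k)] [FiniteDimensional ℝ E]

/-! ### Multiplicativity: faces and degeneracies preserve horizontal vectors -/

namespace CartanConnection

variable (C : CartanConnection T)

/-- The product of the lift of `v` at `a` with the lift of `λ_a v` at `b` lies in the connection by
multiplicativity, and its target component is `v`. By uniqueness it is the lift of `v` at the
product; its source component then gives the rule for `λ`. -/
theorem hor_mul {a b : T.Arrow} (H : T.limit.src a = T.limit.tgt b) (v : E) :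
    (∀ k, C.horAt k (T.limit.mul a b) v = (T.level k).tangentMul (a.comp k) (b.comp k)
      (C.horAt k a v) (C.horAt k b (C.lam a v))) ∧
    C.lam (T.limit.mul a b) v = C.lam b (C.lam a v) := by
  let w : T.TangentSeq (T.limit.mul a b) := fun k => ((T.level k).tangentMul (a.comp k) (b.comp k)
    (C.hor a v k) (C.hor b (C.lam a v) k) : F k)
  have hw : w ∈ C.carrier (T.limit.mul a b) :=
    C.mul_mem a b H _ (C.hor_mem a v) _ (C.hor_mem b _) (C.dTgt_hor b _).symm
  -- Realising the two vectors by a plot of composable pairs turns `tangentMul` into the derivative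
  -- of a product, to which `t(ab) = t(a)` and `s(ab) = s(b)` apply. Level `0` suffices because
  -- `dTgt` and `dSrc` see only that level.
  obtain ⟨ξ, hξ⟩ := C.exists_isHorizontalPlot 0 (T.limit.pair a b H)
  have ha : ((ξ (extChartAt 𝓘(ℝ, E) ((T.limit.pair a b H).obj 0)
      ((T.limit.pair a b H).obj 0))).arr 0).comp 0 = a.comp 0 := by rw [hξ.self]; rfl
  have hb : ((ξ (extChartAt 𝓘(ℝ, E) ((T.limit.pair a b H).obj 0)
      ((T.limit.pair a b H).obj 0))).arr 1).comp 0 = b.comp 0 := by rw [hξ.self]; rfl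
  have hs : ∀ x, (T.level 0).src (((ξ x).arr 0).comp 0) = (T.level 0).tgt (((ξ x).arr 1).comp 0) :=
    fun x => ((ξ x).src_arr 0).trans ((ξ x).tgt_arr 1).symm
  have h1 := LieGroupoid.tangentMul_md (hξ.plotAt.arr 0) (hξ.plotAt.arr 1) (.of_forall hs) v
  have h2 := LieGroupoid.smoothNear_mul (hξ.plotAt.arr 0) (hξ.plotAt.arr 1) (.of_forall hs)
  have e0 : C.hvec 0 (T.limit.pair a b H) 0 v = C.horAt 0 a v := rfl
  have e1 : C.hvec 0 (T.limit.pair a b H) 1 v = C.horAt 0 b (C.lam a v) := by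
    change C.horAt 0 b (C.hbase _ (Fin.succ 0) v) = _
    rw [C.hbase_succ]; rfl
  rw [(hξ.isHorizontalAt v).arr, (hξ.isHorizontalAt v).arr, e0, e1, ha, hb] at h1
  have hc : (T.limit.mul a b).comp 0 = (T.level 0).mul (a.comp 0) (b.comp 0) := comp_limit_mul H 0
  have hT : T.dTgt (T.limit.mul a b) w = v := by
    change md (F 0) E (T.level 0).tgt ((T.limit.mul a b).comp 0) ((T.level 0).tangentMul _ _
      (C.horAt 0 a v) (C.horAt 0 b (C.lam a v)) : F 0) = v
    rw [h1, hc]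
    have h3 := md_comp (g := (T.level 0).tgt) (smoothNear_tgt 0 _).mdifferentiableAt
      h2.mdifferentiableAt
    simp only [fun x => (T.level 0).tgt_mul _ _ (hs x)] at h3
    rw [md_comp (f := fun x => ((ξ x).arr 0).comp 0) (g := (T.level 0).tgt)
      (smoothNear_tgt 0 _).mdifferentiableAt (hξ.plotAt.arr 0).mdifferentiableAt] at h3
    have h4 := DFunLike.congr_fun h3 v
    simp only [ContinuousLinearMap.comp_apply, ha, hb] at h4
    rw [← h4, (hξ.isHorizontalAt v).arr, e0, C.md_tgt_horAt]
  have hS : T.dSrc (T.limit.mul a b) w = C.lam b (C.lam a v) := by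
    change md (F 0) E (T.level 0).src ((T.limit.mul a b).comp 0) ((T.level 0).tangentMul _ _
      (C.horAt 0 a v) (C.horAt 0 b (C.lam a v)) : F 0) = _
    rw [h1, hc]
    have h3 := md_comp (g := (T.level 0).src) (smoothNear_src 0 _).mdifferentiableAt
      h2.mdifferentiableAt
    simp only [fun x => (T.level 0).src_mul _ _ (hs x)] at h3
    rw [md_comp (f := fun x => ((ξ x).arr 1).comp 0) (g := (T.level 0).src)
      (smoothNear_src 0 _).mdifferentiableAt (hξ.plotAt.arr 1).mdifferentiableAt] at h3
    have h4 := DFunLike.congr_fun h3 v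
    simp only [ContinuousLinearMap.comp_apply, ha, hb] at h4
    rw [← h4, (hξ.isHorizontalAt v).arr, e1, C.md_src_horAt]
  have hwe : w = C.hor (T.limit.mul a b) v := by rw [C.eq_hor hw, hT]
  refine ⟨fun k => ?_, ?_⟩
  · rw [C.horAt_apply, ← hwe]; rfl
  · rw [← hS, hwe]; rfl

theorem hor_unit (x : X) (v : E) :
    (∀ k, C.horAt k (T.limit.unit x) v = md E (F k) (T.level k).unit x v) ∧
    C.lam (T.limit.unit x) v = v := by
  let w : T.TangentSeq (T.limit.unit x) := fun k => (md E (F k) (T.level k).unit x v : F k)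
  have hw : w ∈ C.carrier (T.limit.unit x) := C.unit_mem x v
  have hu := ((T.level 0).smooth_unit.smoothNear x).mdifferentiableAt
  have hT : T.dTgt (T.limit.unit x) w = v := by
    have h3 := md_comp (g := (T.level 0).tgt) (smoothNear_tgt 0 _).mdifferentiableAt hu
    simp only [(T.level 0).tgt_unit, md_id] at h3
    exact (DFunLike.congr_fun h3 v).symm
  have hS : T.dSrc (T.limit.unit x) w = v := by
    have h3 := md_comp (g := (T.level 0).src) (smoothNear_src 0 _).mdifferentiableAt hu
    simp only [(T.level 0).src_unit, md_id] at h3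
    exact (DFunLike.congr_fun h3 v).symm
  have hwe : w = C.hor (T.limit.unit x) v := by rw [C.eq_hor hw, hT]
  refine ⟨fun k => ?_, ?_⟩
  · rw [C.horAt_apply, ← hwe]
  · exact (congrArg (T.dSrc _) hwe.symm).trans hS

theorem lam_mul {a b : T.Arrow} (H : T.limit.src a = T.limit.tgt b) :
    C.lam (T.limit.mul a b) = (C.lam b).comp (C.lam a) :=
  ContinuousLinearMap.ext fun v => (C.hor_mul H v).2

theorem lam_unit (x : X) : C.lam (T.limit.unit x) = .id ℝ E :=
  ContinuousLinearMap.ext fun v => (C.hor_unit x v).2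

/-- The index `i.succAbove 0` is that of the first object that survives the face. From there on the
lifts are compared arrow by arrow, and only the composed arrow uses `λ_{ab} = λ_b λ_a`. -/
theorem hbase_face (g : T.limit.Nerve (p + 1)) (i : Fin (p + 2)) (j : Fin (p + 1)) :
    (C.hbase (T.limit.face i g) j).comp (C.hbase g (i.succAbove 0)) =
      C.hbase g (i.succAbove j) := by
  induction j using Fin.induction with
  | zero => exact ContinuousLinearMap.id_comp _
  | succ j ih =>
    rw [C.hbase_succ, ContinuousLinearMap.comp_assoc, ih]
    simp only [SetGroupoid.face]
    split_ifs with h h'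
    · rw [Fin.succAbove_of_castSucc_lt i j.castSucc (by rw [Fin.lt_def]; simp; omega),
        Fin.succAbove_of_castSucc_lt i j.succ (by rw [Fin.lt_def]; simpa using h),
        ← Fin.succ_castSucc, C.hbase_succ]
    · rw [Fin.succAbove_of_castSucc_lt i j.castSucc (by rw [Fin.lt_def]; simp; omega),
        Fin.succAbove_of_le_castSucc i j.succ (by rw [Fin.le_def]; simp; omega),
        C.lam_mul (by rw [g.src_arr, g.tgt_arr, Fin.succ_castSucc]), C.hbase_succ,
        ← Fin.succ_castSucc, C.hbase_succ, ContinuousLinearMap.comp_assoc]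
    · rw [Fin.succAbove_of_le_castSucc i j.castSucc (by rw [Fin.le_def]; simp; omega),
        Fin.succAbove_of_le_castSucc i j.succ (by rw [Fin.le_def]; simp; omega),
        C.hbase_succ g j.succ, Fin.succ_castSucc]

theorem hbase_degen (g : T.limit.Nerve p) (i : Fin (p + 1)) (j : Fin (p + 2)) :
    C.hbase (T.limit.degen i g) j = C.hbase g (i.predAbove j) := by
  induction j using Fin.induction with
  | zero => rw [Fin.predAbove_right_zero]; rfl
  | succ j ih =>
    rw [C.hbase_succ, ih]
    simp only [SetGroupoid.degen]
    split_ifs with h h'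
    · rw [Fin.predAbove_of_le_castSucc i j.castSucc (by rw [Fin.le_def]; simp; omega),
        Fin.predAbove_of_le_castSucc i j.succ (by rw [Fin.le_def]; simp; omega)]
      exact (C.hbase_succ g ⟨j, by omega⟩).symm
    · rw [Fin.predAbove_of_castSucc_lt i j.castSucc (by rw [Fin.lt_def]; simpa using h'),
        Fin.predAbove_of_castSucc_lt i j.succ (by rw [Fin.lt_def]; simp; omega)]
      have e1 : ∀ h, j.castSucc.pred h = (⟨(j : ℕ) - 1, by omega⟩ : Fin p).castSucc :=
        fun h => Fin.ext (by simp)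
      have e2 : ∀ h, j.succ.pred h = (⟨(j : ℕ) - 1, by omega⟩ : Fin p).succ :=
        fun h => Fin.ext (by simp; omega)
      rw [e1, e2, C.hbase_succ]
    · rw [Fin.predAbove_of_le_castSucc i j.castSucc (by rw [Fin.le_def]; simp; omega),
        Fin.predAbove_of_castSucc_lt i j.succ (by rw [Fin.lt_def]; simp; omega), lam_unit,
        ContinuousLinearMap.id_comp]
      congr 1

variable {C}

/-- A face moves the base vector of a lift to the first surviving object. Where two arrows are
composed, the chain rule for the product and `hor_mul` identify the new component. -/
theorem IsHorizontalAt.face {k : ℕ} {ξ : V → T.limit.Nerve (p + 1)} {u e : V}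
    {g : T.limit.Nerve (p + 1)} {v : E} (h : C.IsHorizontalAt k ξ u e g v)
    (hξ : T.PlotAt k ξ u) (hg : ξ u = g) (i : Fin (p + 2)) :
    C.IsHorizontalAt k (fun u' => T.limit.face i (ξ u')) u e (T.limit.face i g)
      (C.hbase g (i.succAbove 0) v) := by
  refine ⟨fun j => ?_, fun j => ?_⟩
  · rw [← ContinuousLinearMap.comp_apply, C.hbase_face]
    exact h.obj _
  · rw [EhresmannConnection.hvec, ContinuousLinearMap.comp_apply, ← ContinuousLinearMap.comp_apply (C.hbase _ _),
      C.hbase_face]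
    simp only [SetGroupoid.face]
    split_ifs with h1 h2
    · rw [Fin.succAbove_of_castSucc_lt i j.castSucc (by rw [Fin.lt_def]; simp; omega)]
      exact h.arr _
    · have H : ∀ y : T.limit.Nerve (p + 1),
          T.limit.src (y.arr j.castSucc) = T.limit.tgt (y.arr j.succ) := fun y => by
        rw [y.src_arr, y.tgt_arr, Fin.succ_castSucc]
      have H' : ∀ u', (T.level k).src (((ξ u').arr j.castSucc).comp k) =
          (T.level k).tgt (((ξ u').arr j.succ).comp k) := fun u' => by
        rw [Arrow.src_comp, Arrow.tgt_comp]; exact H (ξ u')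
      simp only [comp_limit_mul (H _)]
      rw [Fin.succAbove_of_castSucc_lt i j.castSucc (by rw [Fin.lt_def]; simp; omega),
        (C.hor_mul (H g) _).1 k, ← LieGroupoid.tangentMul_md (hξ.arr _) (hξ.arr _)
          (.of_forall H') e, h.arr, h.arr, hg]
      simp only [EhresmannConnection.hvec]
      rw [← Fin.succ_castSucc, C.hbase_succ]
      rfl
    · rw [Fin.succAbove_of_le_castSucc i j.castSucc (by rw [Fin.le_def]; simp; omega),
        Fin.succ_castSucc]
      exact h.arr _

theorem IsHorizontalAt.degen {k : ℕ} {ξ : V → T.limit.Nerve p} {u e : V}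
    {g : T.limit.Nerve p} {v : E} (h : C.IsHorizontalAt k ξ u e g v)
    (hξ : T.PlotAt k ξ u) (hg : ξ u = g) (i : Fin (p + 1)) :
    C.IsHorizontalAt k (fun u' => T.limit.degen i (ξ u')) u e (T.limit.degen i g) v := by
  refine ⟨fun j => ?_, fun j => ?_⟩
  · rw [C.hbase_degen]
    exact h.obj _
  · rw [EhresmannConnection.hvec, ContinuousLinearMap.comp_apply, C.hbase_degen]
    simp only [SetGroupoid.degen]
    split_ifs with h1 h2
    · rw [Fin.predAbove_of_le_castSucc i j.castSucc (by rw [Fin.le_def]; simp; omega)]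
      exact h.arr _
    · rw [Fin.predAbove_of_castSucc_lt i j.castSucc (by rw [Fin.lt_def]; simpa using h2)]
      exact h.arr _
    · rw [(C.hor_unit _ _).1 k]
      change md V (F k) (fun u' => (T.level k).unit ((ξ u').obj i)) u e = _
      rw [md_comp (g := (T.level k).unit) (f := fun u' => (ξ u').obj i)
        ((T.level k).smooth_unit.smoothNear _).mdifferentiableAt (hξ.obj i).mdifferentiableAt,
        ContinuousLinearMap.comp_apply, h.obj, hg]
      congr 2
      rw [Fin.predAbove_of_le_castSucc i j.castSucc (by rw [Fin.le_def]; simp; omega)]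
      congr 1
      ext; simp; omega

end CartanConnection
end LieGroupoidTower

/-! ### Coordinate vector fields -/

section CoordinateField

variable {E X : Type*} [NormedAddCommGroup E] [NormedSpace ℝ E] [TopologicalSpace X]
  [ChartedSpace E X] [IsManifold 𝓘(ℝ, E) ∞ X]

/-- The derivative of the inverse of the chart at `x₀`; its values at `b` are a coordinate vector
field. -/
def mdSymm (x₀ x : X) : E →L[ℝ] E :=
  md E E (extChartAt 𝓘(ℝ, E) x₀).symm (extChartAt 𝓘(ℝ, E) x₀ x)

theorem mdSymm_self (x : X) : mdSymm x x = .id ℝ E := md_extChartAt_symm_self x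

theorem md_extChartAt_comp_mdSymm {x₀ x : X} (hx : x ∈ (extChartAt 𝓘(ℝ, E) x₀).source) :
    (md E E (extChartAt 𝓘(ℝ, E) x₀) x).comp (mdSymm x₀ x) = .id ℝ E := by
  have e := (extChartAt 𝓘(ℝ, E) x₀).left_inv hx
  have ht := (extChartAt 𝓘(ℝ, E) x₀).map_source hx
  have h := md_comp (g := extChartAt 𝓘(ℝ, E) x₀) (f := (extChartAt 𝓘(ℝ, E) x₀).symm)
    (x := extChartAt 𝓘(ℝ, E) x₀ x) (by rw [e]; exact (smoothNear_extChartAt hx).mdifferentiableAt)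
    (smoothNear_extChartAt_symm ht).mdifferentiableAt
  rw [e] at h
  rw [mdSymm, ← h, ← md_id (E := E) (extChartAt 𝓘(ℝ, E) x₀ x)]
  refine md_congr ?_
  filter_upwards [(isOpen_extChartAt_target x₀).mem_nhds ht] with y hy
  exact (extChartAt 𝓘(ℝ, E) x₀).right_inv hy

theorem mdSymm_comp_md_extChartAt {x₀ x : X} (hx : x ∈ (extChartAt 𝓘(ℝ, E) x₀).source) :
    (mdSymm x₀ x).comp (md E E (extChartAt 𝓘(ℝ, E) x₀) x) = .id ℝ E := by
  have h := md_comp (g := (extChartAt 𝓘(ℝ, E) x₀).symm) (f := extChartAt 𝓘(ℝ, E) x₀) (x := x)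
    (smoothNear_extChartAt_symm ((extChartAt 𝓘(ℝ, E) x₀).map_source hx)).mdifferentiableAt
    (smoothNear_extChartAt hx).mdifferentiableAt
  rw [mdSymm, ← h, ← md_id (E := E) x]
  refine md_congr ?_
  filter_upwards [(isOpen_extChartAt_source (I := 𝓘(ℝ, E)) x₀).mem_nhds hx] with y hy
  exact (extChartAt 𝓘(ℝ, E) x₀).left_inv hy

/-- In the trivialization of the tangent bundle at `x₀` this field is the constant `b`. -/
theorem contMDiffAt_mdSymm {x₀ x : X} (hx : x ∈ (extChartAt 𝓘(ℝ, E) x₀).source) (b : E) :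
    ContMDiffAt 𝓘(ℝ, E) 𝓘(ℝ, E).tangent ∞
      (fun x' => (⟨x', mdSymm (E := E) x₀ x' b⟩ : TangentBundle 𝓘(ℝ, E) X)) x := by
  have : IsManifold 𝓘(ℝ, E) 1 X := .of_le (n := ∞) (by simp)
  have hc : x ∈ (chartAt E x₀).source := by rwa [extChartAt_source] at hx
  refine (Bundle.Trivialization.contMDiffAt_iff (e := trivializationAt E (TangentSpace 𝓘(ℝ, E)) x₀)
    (by rw [TangentBundle.trivializationAt_source]; exact hc)).2 ⟨contMDiffAt_id, ?_⟩
  refine (contMDiffAt_const (c := b)).congr_of_eventuallyEq ?_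
  filter_upwards [(chartAt E x₀).open_source.mem_nhds hc] with y hy
  have h1 := TangentBundle.symmL_trivializationAt (I := 𝓘(ℝ, E)) hy
  have h2 : y ∈ (trivializationAt E (TangentSpace 𝓘(ℝ, E)) x₀).baseSet := by
    rwa [TangentBundle.trivializationAt_baseSet]
  have h3 : mdSymm x₀ y b = (trivializationAt E (TangentSpace 𝓘(ℝ, E)) x₀).symm y b := by
    rw [← Bundle.Trivialization.symmL_apply (R := ℝ) _ h2, h1]
    simp [mdSymm, md]
    rfl
  rw [h3, Bundle.Trivialization.apply_mk_symm _ h2]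

omit [IsManifold 𝓘(ℝ, E) ∞ X] in
theorem tangentBundle_mk_congr {x x' : X} (h : x = x') (v : E) :
    (⟨x, v⟩ : TangentBundle 𝓘(ℝ, E) X) = ⟨x', v⟩ := by subst h; rfl

end CoordinateField

namespace LieGroupoidTower

variable {E X : Type*} {F A : ℕ → Type*} [NormedAddCommGroup E]
    [NormedSpace ℝ E] [TopologicalSpace X] [ChartedSpace E X] [∀ k, NormedAddCommGroup (F k)]
    [∀ k, NormedSpace ℝ (F k)] [∀ k, TopologicalSpace (A k)] [∀ k, ChartedSpace (F k) (A k)]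
    {T : LieGroupoidTower E X F A} {p : ℕ}
    {V : Type*} [NormedAddCommGroup V] [NormedSpace ℝ V]
    [IsManifold 𝓘(ℝ, E) ∞ X] [∀ k, IsManifold 𝓘(ℝ, F k) ∞ (A k)] [FiniteDimensional ℝ E]

/-! ### The lift of a single arrow in charts -/

namespace EhresmannConnection

variable (C : EhresmannConnection T)

/-- The map `Hc` is, near `g₀`, the component at level `k` of the horizontal lift in coordinates,
as a smooth map on level `k + n`. -/
structure IsHorChart (k n : ℕ) (g₀ : T.Arrow) (Hc : A (k + n) → E →L[ℝ] F k) : Prop where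
  smooth : ContMDiffAt 𝓘(ℝ, F (k + n)) 𝓘(ℝ, E →L[ℝ] F k) ∞ Hc (g₀.comp (k + n))
  eq : ∀ᶠ y in 𝓝 (g₀.comp (k + n)), ∀ g : T.Arrow, g.comp (k + n) = y →
    Hc y = (md (F k) (F k) (extChartAt 𝓘(ℝ, F k) (g₀.comp k)) (g.comp k)).comp
      ((C.horAt k g).comp (mdSymm (T.limit.tgt g₀) (T.limit.tgt g)))

/-- The component of the horizontal lift at level `k` is determined at level `k + n`, and is
smooth. -/
structure IsHorLevel (k n : ℕ) : Prop where
  congr : ∀ g g' : T.Arrow, g.comp (k + n) = g'.comp (k + n) → C.horAt k g = C.horAt k g'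
  exists_isHorChart : ∀ g₀, ∃ Hc, C.IsHorChart k n g₀ Hc

/-- Every vector is the target component of its own lift, so the bundle map in the smoothness
condition is forced to equal the lift. It therefore provides both the factorization through level `k
+ n` and the coordinate expression. -/
theorem exists_isHorLevel (k : ℕ) : ∃ n, C.IsHorLevel k n := by
  have : IsManifold 𝓘(ℝ, E) 1 X := .of_le (n := ∞) (by simp)
  have : ∀ k, IsManifold 𝓘(ℝ, F k) 1 (A k) := fun k => .of_le (n := ∞) (by simp)
  obtain ⟨n, h, hs, hh⟩ := C.smooth k
  have hm : ∀ g : T.Arrow, ∀ v : E, (h (g.comp (k + n)) v : F k) = C.horAt k g v := fun g v => by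
    have := hh g _ (C.hor_mem g v)
    rwa [C.dTgt_hor] at this
  refine ⟨n, fun g g' e => ?_, fun g₀ => ⟨_, hs (g₀.comp (k + n)), ?_⟩⟩
  · ext v
    rw [← hm, ← hm, e]
  · have ht : ∀ g : T.Arrow, (T.level (k + n)).tgt (g.comp (k + n)) = T.limit.tgt g :=
      fun g => g.tgt_comp _
    filter_upwards [(smoothNear_tgt (T := T) (k + n) (g₀.comp (k + n))).continuousAt.eventually
        ((chartAt E _).open_source.mem_nhds (mem_chart_source E _)),
      (smoothNear_projAdd (T := T) k n (g₀.comp (k + n))).continuousAt.eventually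
        ((chartAt (F k) _).open_source.mem_nhds (mem_chart_source (F k) _))] with y h1 h2 g hg
    rw [inTangentCoordinates_eq_mfderiv_comp h1 h2]
    subst hg
    ext v
    have e1 : mfderivWithin 𝓘(ℝ, E) 𝓘(ℝ, E) (extChartAt 𝓘(ℝ, E) ((T.level (k + n)).tgt
        (g₀.comp (k + n)))).symm (Set.range 𝓘(ℝ, E)) (extChartAt 𝓘(ℝ, E) ((T.level (k + n)).tgt
        (g₀.comp (k + n))) ((T.level (k + n)).tgt (g.comp (k + n)))) v =
        mdSymm (E := E) (T.limit.tgt g₀) (T.limit.tgt g) v := by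
      simp only [modelWithCornersSelf_coe, Set.range_id, mfderivWithin_univ]
      rw [ht, ht]
      rfl
    have e2 : ∀ w : F k, mfderiv 𝓘(ℝ, F k) 𝓘(ℝ, F k) (extChartAt 𝓘(ℝ, F k) (T.projAdd k n
        (g₀.comp (k + n)))) (T.projAdd k n (g.comp (k + n))) w =
        md (F k) (F k) (extChartAt 𝓘(ℝ, F k) (g₀.comp k)) (g.comp k) w := by
      intro w
      rw [projAdd_comp, projAdd_comp]
      rfl
    refine (e2 _).trans ?_
    refine (congrArg (md (F k) (F k) (extChartAt 𝓘(ℝ, F k) (g₀.comp k)) (g.comp k))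
      (hm g _)).trans ?_
    exact congrArg (fun w => md (F k) (F k) (extChartAt 𝓘(ℝ, F k) (g₀.comp k)) (g.comp k)
      (C.horAt k g w)) e1

end EhresmannConnection
end LieGroupoidTower
namespace LieGroupoidTower

variable {E X : Type*} {F A : ℕ → Type*} [NormedAddCommGroup E]
    [NormedSpace ℝ E] [TopologicalSpace X] [ChartedSpace E X] [∀ k, NormedAddCommGroup (F k)]
    [∀ k, NormedSpace ℝ (F k)] [∀ k, TopologicalSpace (A k)] [∀ k, ChartedSpace (F k) (A k)]
    {T : LieGroupoidTower E X F A} {p : ℕ}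
    {V : Type*} [NormedAddCommGroup V] [NormedSpace ℝ V]
    [IsManifold 𝓘(ℝ, E) ∞ X] [∀ k, IsManifold 𝓘(ℝ, F k) ∞ (A k)] [FiniteDimensional ℝ E]

/-! ### Flatness as a symmetry of derivatives -/

namespace EhresmannConnection

variable (C : EhresmannConnection T)

/-- The horizontal lift of a coordinate vector field. -/
def coordLift (x₀ : X) (b : E) (g : T.Arrow) : T.TangentSeq g :=
  C.hor g (mdSymm x₀ (T.limit.tgt g) b)

theorem isSectionOn_coordLift (x₀ : X) (b : E) :
    C.IsSectionOn {g | g.comp 0 ∈ (T.level 0).tgt ⁻¹' (extChartAt 𝓘(ℝ, E) x₀).source}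
      (C.coordLift x₀ b) := by
  refine ⟨fun g _ => C.hor_mem g _, fun k => ?_⟩
  obtain ⟨n, h, hs, hh⟩ := C.smooth k
  have hm : ∀ g : T.Arrow, ∀ v : E, (h (g.comp (k + n)) v : F k) = C.horAt k g v := fun g v => by
    have := hh g _ (C.hor_mem g v)
    rwa [C.dTgt_hor] at this
  refine ⟨n, fun y => ⟨T.projAdd k n y, h y (mdSymm (E := E) x₀ ((T.level (k + n)).tgt y) b)⟩,
    fun g hg => ⟨?_, ?_⟩⟩
  · have e1 : (h (g.comp (k + n)) (mdSymm (E := E) x₀ ((T.level (k + n)).tgt (g.comp (k + n))) b) :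
        F k) = C.horAt k g (mdSymm x₀ (T.limit.tgt g) b) := by
      rw [hm, g.tgt_comp]
      rfl
    refine (tangentBundle_mk_congr (projAdd_comp k n g) _).trans ?_
    exact congrArg (fun w : F k => (⟨g.comp k, w⟩ : TangentBundle 𝓘(ℝ, F k) (A k))) e1
  · refine ContMDiffAt.clm_apply_of_inCoordinates (IB₁ := 𝓘(ℝ, E)) (IB₂ := 𝓘(ℝ, F k))
      (hs (g.comp (k + n)))
      (v := fun y => mdSymm (E := E) x₀ ((T.level (k + n)).tgt y) b) ?_
      (smoothNear_projAdd k n _).contMDiffAt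
    have ht : (T.level (k + n)).tgt (g.comp (k + n)) ∈ (extChartAt 𝓘(ℝ, E) x₀).source := by
      rw [g.tgt_comp]; exact hg
    exact (contMDiffAt_mdSymm ht b).comp (g.comp (k + n)) (smoothNear_tgt (k + n) _).contMDiffAt

variable {C}

/-- The bracket projects to the bracket of two coordinate fields, which is zero. Being horizontal as
well, it vanishes. -/
theorem eq_zero_of_isLieBracketAt_coordLift {g₀ : T.Arrow} {b₁ b₂ : E} {z : T.TangentSeq g₀}
    (hz : z ∈ C.carrier g₀) (h : IsLieBracketAt (C.coordLift (T.limit.tgt g₀) b₁)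
      (C.coordLift (T.limit.tgt g₀) b₂) g₀ z) : z = 0 := by
  have : IsManifold 𝓘(ℝ, E) 1 X := .of_le (n := ∞) (by simp)
  have hd : T.dTgt g₀ z = 0 := by
    refine SeparatingDual.eq_zero_of_forall_dual_eq_zero (R := ℝ) fun ℓ => ?_
    let φ := extChartAt 𝓘(ℝ, E) (T.limit.tgt g₀)
    -- A linear function of the coordinates of the target. Its derivative along the lift of the
    -- coordinate field `b` is the constant `ℓ b`, so both iterated derivatives in the bracket are
    -- zero.
    let f : A 0 → ℝ := fun y => ℓ (φ ((T.level 0).tgt y))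
    have hN : ∀ᶠ y in 𝓝 (g₀.comp 0), (T.level 0).tgt y ∈ φ.source :=
      (smoothNear_tgt (T := T) 0 _).continuousAt.eventually
        (extChartAt_source_mem_nhds (I := 𝓘(ℝ, E)) (T.limit.tgt g₀))
    have hf : ∀ y, (T.level 0).tgt y ∈ φ.source → SmoothNear (F 0) ℝ f y ∧
        ∀ v, md (F 0) ℝ f y v = ℓ (md E E φ ((T.level 0).tgt y) (md (F 0) E (T.level 0).tgt y v)) := by
      intro y hy
      have s1 : SmoothNear (F 0) E (fun y => φ ((T.level 0).tgt y)) y :=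
        SmoothNear.comp (smoothNear_extChartAt hy) (smoothNear_tgt 0 y)
      refine ⟨SmoothNear.comp (g := ℓ) (ℓ.contDiff.smoothNear _) s1, fun v => ?_⟩
      rw [md_comp (g := ℓ) (f := fun y => φ ((T.level 0).tgt y)) (ℓ.contDiff.smoothNear
          (E' := ℝ) _).mdifferentiableAt s1.mdifferentiableAt,
        md_comp (g := φ) (f := (T.level 0).tgt) (smoothNear_extChartAt hy).mdifferentiableAt
          (smoothNear_tgt 0 y).mdifferentiableAt, md_eq_fderiv, ℓ.fderiv]
      rfl
    have hc : ∀ b, ∀ᶠ y in 𝓝 (g₀.comp 0), ∀ g' : T.Arrow, g'.comp 0 = y →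
        ℓ b = md (F 0) ℝ f (g'.comp 0) (C.coordLift (T.limit.tgt g₀) b g' 0) := by
      intro b
      filter_upwards [hN] with y hy g' hg'
      subst hg'
      refine Eq.trans ?_ ((hf _ hy).2 _).symm
      have e1 := C.md_tgt_horAt 0 g' (mdSymm (T.limit.tgt g₀) (T.limit.tgt g') b)
      change _ = ℓ (md E E φ _ (md (F 0) E (T.level 0).tgt (g'.comp 0) (C.horAt 0 g' _)))
      rw [e1]
      exact congrArg ℓ (DFunLike.congr_fun (md_extChartAt_comp_mdSymm hy) b).symm
    have h1 := h 0 f ⟨_, hN, fun y hy => ((hf y hy).1.contMDiffAt).contMDiffWithinAt⟩ 0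
      (fun _ => ℓ b₂) (fun _ => ℓ b₁) mdifferentiableAt_const mdifferentiableAt_const
      ((hc b₂).and (hc b₁) |>.mono fun y hy g' hg' => ⟨hy.1 g' hg', hy.2 g' hg'⟩)
    have h2 : md (F 0) ℝ f (g₀.comp 0) (z 0) = 0 := by
      refine h1.trans ?_
      simp only [mfderiv_const]
      exact sub_zero (0 : ℝ)
    replace h2 := ((hf _ hN.self_of_nhds).2 (z 0)).symm.trans h2
    have e3 : md E E φ ((T.level 0).tgt (g₀.comp 0)) = .id ℝ E := md_extChartAt_self _
    rw [e3] at h2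
    exact h2
  rw [C.eq_hor hz, hd, map_zero]

/-- Read in coordinates of level `k`, the vanishing of the bracket of the lifts of the coordinate
fields `b₁`, `b₂` says that the derivative of the coefficients of the second along the first equals
that of the first along the second. The coefficients are functions on level `k + n`, so the
directions of differentiation are the lifts at that level. -/
theorem IsHorChart.fderiv_symm (hC : C.IsInvolutive) {k n : ℕ} {g₀ : T.Arrow}
    {Hc : A (k + n) → E →L[ℝ] F k} (h : C.IsHorChart k n g₀ Hc) {σ : V → A (k + n)} {u : V}
    (hσ : SmoothNear V (F (k + n)) σ u) (hu : σ u = g₀.comp (k + n)) {e₁ e₂ : V} {b₁ b₂ : E}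
    (h₁ : md V (F (k + n)) σ u e₁ = C.horAt (k + n) g₀ b₁)
    (h₂ : md V (F (k + n)) σ u e₂ = C.horAt (k + n) g₀ b₂) :
    fderiv ℝ (fun x => Hc (σ x)) u e₁ b₂ = fderiv ℝ (fun x => Hc (σ x)) u e₂ b₁ := by
  obtain ⟨z, hz, hb⟩ := hC 0 _ ((T.level 0).submersion_tgt.contMDiff.continuous.isOpen_preimage _
    (isOpen_extChartAt_source (I := 𝓘(ℝ, E)) (T.limit.tgt g₀))) _ _
    (C.isSectionOn_coordLift (T.limit.tgt g₀) b₁) (C.isSectionOn_coordLift (T.limit.tgt g₀) b₂) g₀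
    (mem_extChartAt_source _)
  have hz0 := eq_zero_of_isLieBracketAt_coordLift hz hb
  have hHd : MDifferentiableAt 𝓘(ℝ, F (k + n)) 𝓘(ℝ, E →L[ℝ] F k) Hc (σ u) := by
    rw [hu]; exact h.smooth.mdifferentiableAt (by simp)
  have hcomp : md V (E →L[ℝ] F k) (fun x => Hc (σ x)) u =
    (md (F (k + n)) (E →L[ℝ] F k) Hc (σ u)).comp (md V (F (k + n)) σ u) :=
    md_comp hHd hσ.mdifferentiableAt
  rw [← md_eq_fderiv, hcomp, ContinuousLinearMap.comp_apply, ContinuousLinearMap.comp_apply, h₁, h₂,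
    hu, ← sub_eq_zero]
  refine SeparatingDual.eq_zero_of_forall_dual_eq_zero (R := ℝ) fun ℓ => ?_
  let ψ := extChartAt 𝓘(ℝ, F k) (g₀.comp k)
  let f : A k → ℝ := fun y => ℓ (ψ y)
  have hf : ∀ y ∈ ψ.source, SmoothNear (F k) ℝ f y ∧
      ∀ v, md (F k) ℝ f y v = ℓ (md (F k) (F k) ψ y v) := by
    intro y hy
    refine ⟨SmoothNear.comp (g := ℓ) (ℓ.contDiff.smoothNear _) (smoothNear_extChartAt hy),
      fun v => ?_⟩
    rw [md_comp (g := ℓ) (f := ψ) (ℓ.contDiff.smoothNear (E' := ℝ) _).mdifferentiableAt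
      (smoothNear_extChartAt hy).mdifferentiableAt, md_eq_fderiv, ℓ.fderiv]
    rfl
  have hψ : ∀ᶠ y in 𝓝 (g₀.comp (k + n)), T.projAdd k n y ∈ ψ.source :=
    (smoothNear_projAdd (T := T) k n _).continuousAt.eventually
      (by rw [projAdd_comp]; exact extChartAt_source_mem_nhds (I := 𝓘(ℝ, F k)) (g₀.comp k))
  have hc : ∀ b, ∀ᶠ y in 𝓝 (g₀.comp (k + n)), ∀ g' : T.Arrow, g'.comp (k + n) = y →
      ℓ (Hc y b) = md (F k) ℝ f (g'.comp k) (C.coordLift (T.limit.tgt g₀) b g' k) := by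
    intro b
    filter_upwards [hψ, h.eq] with y hy hy' g' hg'
    rw [hy' g' hg']
    exact ((hf _ (by rw [← hg', projAdd_comp] at hy; exact hy)).2 _).symm
  have hd : ∀ b, MDifferentiableAt 𝓘(ℝ, F (k + n)) 𝓘(ℝ, ℝ) (fun y => ℓ (Hc y b)) (g₀.comp (k + n)) ∧
      ∀ v, md (F (k + n)) ℝ (fun y => ℓ (Hc y b)) (g₀.comp (k + n)) v =
        ℓ (md (F (k + n)) (E →L[ℝ] F k) Hc (g₀.comp (k + n)) v b) := by
    intro b
    let L : (E →L[ℝ] F k) →L[ℝ] ℝ := ℓ.comp (ContinuousLinearMap.apply ℝ (F k) b)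
    rw [hu] at hHd
    have hL : MDifferentiableAt 𝓘(ℝ, E →L[ℝ] F k) 𝓘(ℝ, ℝ) L (Hc (g₀.comp (k + n))) :=
      L.differentiableAt.mdifferentiableAt
    refine ⟨hL.comp _ hHd, fun v => ?_⟩
    have := md_comp (g := L) hL hHd
    rw [md_eq_fderiv, L.fderiv] at this
    exact DFunLike.congr_fun this v
  have h3 := hb k f ⟨_, extChartAt_source_mem_nhds (I := 𝓘(ℝ, F k)) (g₀.comp k),
    fun y hy => ((hf y hy).1.contMDiffAt).contMDiffWithinAt⟩ n (fun y => ℓ (Hc y b₂))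
    (fun y => ℓ (Hc y b₁)) (hd b₂).1 (hd b₁).1
    ((hc b₂).and (hc b₁) |>.mono fun y hy g' hg' => ⟨hy.1 g' hg', hy.2 g' hg'⟩)
  have h4 : ∀ b, (C.coordLift (T.limit.tgt g₀) b g₀ (k + n) : F (k + n)) =
      C.horAt (k + n) g₀ b := fun b => by
    rw [coordLift, mdSymm_self]
    rfl
  have h5 : (md (F k) ℝ f (g₀.comp k) (z k) : ℝ) =
      md (F (k + n)) ℝ (fun y => ℓ (Hc y b₂)) (g₀.comp (k + n)) (C.horAt (k + n) g₀ b₁) -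
      md (F (k + n)) ℝ (fun y => ℓ (Hc y b₁)) (g₀.comp (k + n)) (C.horAt (k + n) g₀ b₂) := by
    rw [← h4, ← h4]
    exact h3
  rw [(hd _).2, (hd _).2, hz0] at h5
  rw [map_sub, ← h5]
  exact map_zero _

end EhresmannConnection
end LieGroupoidTower
namespace LieGroupoidTower

variable {E X : Type*} {F A : ℕ → Type*} [NormedAddCommGroup E]
    [NormedSpace ℝ E] [TopologicalSpace X] [ChartedSpace E X] [∀ k, NormedAddCommGroup (F k)]
    [∀ k, NormedSpace ℝ (F k)] [∀ k, TopologicalSpace (A k)] [∀ k, ChartedSpace (F k) (A k)]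
    {T : LieGroupoidTower E X F A} {p : ℕ}
    {V : Type*} [NormedAddCommGroup V] [NormedSpace ℝ V]
    [IsManifold 𝓘(ℝ, E) ∞ X] [∀ k, IsManifold 𝓘(ℝ, F k) ∞ (A k)] [FiniteDimensional ℝ E]

omit [IsManifold 𝓘(ℝ, E) ∞ X] [∀ k, IsManifold 𝓘(ℝ, F k) ∞ (A k)] [FiniteDimensional ℝ E] in
theorem PlotAt.eventually_obj_mem {k : ℕ} {ξ : V → T.limit.Nerve p} {u : V} (h : T.PlotAt k ξ u)
    (i : Fin (p + 1)) : ∀ᶠ x in 𝓝 u, (ξ x).obj i ∈ (extChartAt 𝓘(ℝ, E) ((ξ u).obj i)).source :=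
  (h.obj i).continuousAt.eventually (extChartAt_source_mem_nhds (I := 𝓘(ℝ, E)) _)

omit [IsManifold 𝓘(ℝ, E) ∞ X] [∀ k, IsManifold 𝓘(ℝ, F k) ∞ (A k)] [FiniteDimensional ℝ E] in
theorem PlotAt.eventually_arr_mem {k : ℕ} {ξ : V → T.limit.Nerve p} {u : V} (h : T.PlotAt k ξ u)
    (i : Fin p) : ∀ᶠ x in 𝓝 u,
      ((ξ x).arr i).comp k ∈ (extChartAt 𝓘(ℝ, F k) (((ξ u).arr i).comp k)).source :=
  (h.arr i).continuousAt.eventually (extChartAt_source_mem_nhds (I := 𝓘(ℝ, F k)) _)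

/-! ### The lift to a string in coordinates, along a plot -/

namespace EhresmannConnection

variable (C : EhresmannConnection T)

theorem IsHorizontalAt.of_add {C : EhresmannConnection T} {k n : ℕ} {ξ : V → T.limit.Nerve p}
    {u e : V} {v : E} (h : C.IsHorizontalAt (k + n) ξ u e (ξ u) v) (hξ : T.PlotAt (k + n) ξ u) :
    C.IsHorizontalAt k ξ u e (ξ u) v := by
  refine ⟨h.obj, fun i => ?_⟩
  have h1 := md_comp (g := T.projAdd k n) (f := fun x => ((ξ x).arr i).comp (k + n)) (x := u)
    (smoothNear_projAdd k n _).mdifferentiableAt (hξ.arr i).mdifferentiableAt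
  simp only [projAdd_comp] at h1
  rw [h1, ContinuousLinearMap.comp_apply, h.arr]
  exact C.md_projAdd_horAt k n _ _

/-- The horizontal lift to strings near `g₀` in coordinates: the components at the objects. -/
def baseChart (g₀ g : T.limit.Nerve p) (i : Fin (p + 1)) : E →L[ℝ] E :=
  (md E E (extChartAt 𝓘(ℝ, E) (g₀.obj i)) (g.obj i)).comp
    ((C.hbase g i).comp (mdSymm (g₀.obj 0) (g.obj 0)))

/-- The horizontal lift to strings near `g₀` in coordinates: the components at the arrows. -/
def vecChart (k : ℕ) (g₀ g : T.limit.Nerve p) (i : Fin p) : E →L[ℝ] F k :=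
  (md (F k) (F k) (extChartAt 𝓘(ℝ, F k) ((g₀.arr i).comp k)) ((g.arr i).comp k)).comp
    ((C.hvec k g i).comp (mdSymm (g₀.obj 0) (g.obj 0)))

theorem baseChart_self (g : T.limit.Nerve p) (i : Fin (p + 1)) :
    C.baseChart g g i = C.hbase g i := by
  have : IsManifold 𝓘(ℝ, E) 1 X := .of_le (n := ∞) (by simp)
  rw [baseChart, mdSymm_self, md_extChartAt_self]
  rfl

theorem vecChart_self (k : ℕ) (g : T.limit.Nerve p) (i : Fin p) :
    C.vecChart k g g i = C.hvec k g i := by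
  have : IsManifold 𝓘(ℝ, F k) 1 (A k) := .of_le (n := ∞) (by simp)
  rw [vecChart, mdSymm_self, md_extChartAt_self]
  rfl

theorem baseChart_zero {g₀ g : T.limit.Nerve p}
    (h : g.obj 0 ∈ (extChartAt 𝓘(ℝ, E) (g₀.obj 0)).source) :
    C.baseChart g₀ g 0 = .id ℝ E := md_extChartAt_comp_mdSymm h

/-- The source map of level `k` in coordinates near `a`. -/
def srcChart (T : LieGroupoidTower E X F A) (k : ℕ) (a : A k) : F k → E := fun z =>
  extChartAt 𝓘(ℝ, E) ((T.level k).src a) ((T.level k).src ((extChartAt 𝓘(ℝ, F k) a).symm z))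

omit [FiniteDimensional ℝ E] in
theorem smoothNear_srcChart (k : ℕ) (a : A k) :
    SmoothNear (F k) E (srcChart T k a) (extChartAt 𝓘(ℝ, F k) a a) := by
  have e := (extChartAt 𝓘(ℝ, F k) a).left_inv (mem_extChartAt_source a)
  refine SmoothNear.comp (g := extChartAt 𝓘(ℝ, E) ((T.level k).src a)) ?_
    (SmoothNear.comp (smoothNear_src k _) (smoothNear_extChartAt_symm (mem_extChartAt_target a)))
  rw [e]
  exact smoothNear_extChartAt (mem_extChartAt_source _)

omit [FiniteDimensional ℝ E] in
theorem fderiv_srcChart {k : ℕ} {a b : A k} (hb : b ∈ (extChartAt 𝓘(ℝ, F k) a).source)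
    (hb' : (T.level k).src b ∈ (extChartAt 𝓘(ℝ, E) ((T.level k).src a)).source) :
    fderiv ℝ (srcChart T k a) (extChartAt 𝓘(ℝ, F k) a b) =
      (md E E (extChartAt 𝓘(ℝ, E) ((T.level k).src a)) ((T.level k).src b)).comp
        ((md (F k) E (T.level k).src b).comp (mdSymm a b)) := by
  have e := (extChartAt 𝓘(ℝ, F k) a).left_inv hb
  have hs := smoothNear_extChartAt_symm ((extChartAt 𝓘(ℝ, F k) a).map_source hb)
  have h1 : SmoothNear (F k) E (fun z => (T.level k).src ((extChartAt 𝓘(ℝ, F k) a).symm z))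
    (extChartAt 𝓘(ℝ, F k) a b) := SmoothNear.comp (smoothNear_src k _) hs
  have h2 := md_comp (g := extChartAt 𝓘(ℝ, E) ((T.level k).src a))
    (f := fun z => (T.level k).src ((extChartAt 𝓘(ℝ, F k) a).symm z))
    (x := extChartAt 𝓘(ℝ, F k) a b)
    (by rw [e]; exact (smoothNear_extChartAt hb').mdifferentiableAt) h1.mdifferentiableAt
  rw [md_comp (g := (T.level k).src) (f := (extChartAt 𝓘(ℝ, F k) a).symm)
    (smoothNear_src k _).mdifferentiableAt hs.mdifferentiableAt, e] at h2
  rw [← md_eq_fderiv]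
  exact h2

variable {C}

/-- One half of the recursion along the string: the component at an arrow is the lift of the
component at its target. The two coordinate changes at that object cancel. -/
theorem IsHorChart.eventually_vecChart {k n : ℕ} {ξ : V → T.limit.Nerve p} {u : V}
    (hξ : T.PlotAt (k + n) ξ u) {i : Fin p} {Hc} (h : C.IsHorChart k n ((ξ u).arr i) Hc) :
    ∀ᶠ x in 𝓝 u, C.vecChart k (ξ u) (ξ x) i =
      (Hc (((ξ x).arr i).comp (k + n))).comp (C.baseChart (ξ u) (ξ x) i.castSucc) := by
  filter_upwards [(hξ.arr i).continuousAt.eventually h.eq, hξ.eventually_obj_mem i.castSucc]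
    with x h1 h2
  rw [h1 _ rfl, (ξ u).tgt_arr, (ξ x).tgt_arr, baseChart, vecChart, hvec]
  have e := mdSymm_comp_md_extChartAt h2
  ext v
  have e' := DFunLike.congr_fun e
    (C.hbase (ξ x) i.castSucc (mdSymm ((ξ u).obj 0) ((ξ x).obj 0) v))
  simp only [ContinuousLinearMap.comp_apply, ContinuousLinearMap.id_apply] at e' ⊢
  rw [e']

/-- The other half of the recursion: the component at the next object is the derivative of the
source map applied to the component at the arrow. -/
theorem eventually_baseChart_succ {k : ℕ} {ξ : V → T.limit.Nerve p} {u : V}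
    (hξ : T.PlotAt k ξ u) (i : Fin p) :
    ∀ᶠ x in 𝓝 u, C.baseChart (ξ u) (ξ x) i.succ =
      (fderiv ℝ (srcChart T k (((ξ u).arr i).comp k)) (extChartAt 𝓘(ℝ, F k) (((ξ u).arr i).comp k)
        (((ξ x).arr i).comp k))).comp (C.vecChart k (ξ u) (ξ x) i) := by
  have hs : ∀ x, (T.level k).src (((ξ x).arr i).comp k) = (ξ x).obj i.succ := fun x =>
    (Arrow.src_comp _ k).trans ((ξ x).src_arr i)
  filter_upwards [hξ.eventually_arr_mem i, hξ.eventually_obj_mem i.succ] with x h1 h2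
  rw [fderiv_srcChart h1 (by rw [hs, hs]; exact h2), hs, hs, baseChart, vecChart]
  have e := mdSymm_comp_md_extChartAt h1
  ext v
  have e' := DFunLike.congr_fun e
    (C.hvec k (ξ x) i (mdSymm ((ξ u).obj 0) ((ξ x).obj 0) v))
  simp only [ContinuousLinearMap.comp_apply, ContinuousLinearMap.id_apply] at e' ⊢
  rw [e']
  congr 1
  exact (C.md_src_hvec k (ξ x) _ i).symm

theorem IsHorLevel.contDiffAt_vecChart_of {k n : ℕ} (hn : C.IsHorLevel k n)
    {ξ : V → T.limit.Nerve p} {u : V} (hξ : T.PlotAt (k + n) ξ u) {i : Fin p}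
    (h : ContDiffAt ℝ ∞ (fun x => C.baseChart (ξ u) (ξ x) i.castSucc) u) :
    ContDiffAt ℝ ∞ (fun x => C.vecChart k (ξ u) (ξ x) i) u := by
  obtain ⟨Hc, hH⟩ := hn.exists_isHorChart ((ξ u).arr i)
  have h1 : ContDiffAt ℝ ∞ (fun x => Hc (((ξ x).arr i).comp (k + n))) u :=
    contMDiffAt_iff_contDiffAt.1 (hH.smooth.comp u (hξ.arr i).contMDiffAt)
  exact (h1.clm_comp h).congr_of_eventuallyEq (hH.eventually_vecChart hξ)

/-- Induction along the string by the two halves of the recursion. In the centre's own chart the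
component at the first object is the identity. -/
theorem IsHorLevel.contDiffAt_baseChart {k n : ℕ} (hn : C.IsHorLevel k n)
    {ξ : V → T.limit.Nerve p} {u : V} (hξ : T.PlotAt (k + n) ξ u) (i : Fin (p + 1)) :
    ContDiffAt ℝ ∞ (fun x => C.baseChart (ξ u) (ξ x) i) u := by
  induction i using Fin.induction with
  | zero =>
    refine contDiffAt_const (c := .id ℝ E) |>.congr_of_eventuallyEq ?_
    filter_upwards [hξ.eventually_obj_mem 0] with x hx using C.baseChart_zero hx
  | succ i ih =>
    refine ContDiffAt.congr_of_eventuallyEq (ContDiffAt.clm_comp ?_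
      (hn.contDiffAt_vecChart_of hξ ih)) (eventually_baseChart_succ hξ.of_add i)
    let κ : V → F k := fun x => extChartAt 𝓘(ℝ, F k) (((ξ u).arr i).comp k) (((ξ x).arr i).comp k)
    have h1 : SmoothNear V (F k) κ u :=
      SmoothNear.comp (smoothNear_extChartAt (mem_extChartAt_source _)) (hξ.of_add.arr i)
    exact (SmoothNear.comp (g := fderiv ℝ (srcChart T k (((ξ u).arr i).comp k))) (f := κ)
      (smoothNear_srcChart k _).fderiv h1).contDiffAt

theorem IsHorLevel.contDiffAt_vecChart {k n : ℕ} (hn : C.IsHorLevel k n)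
    {ξ : V → T.limit.Nerve p} {u : V} (hξ : T.PlotAt (k + n) ξ u) (i : Fin p) :
    ContDiffAt ℝ ∞ (fun x => C.vecChart k (ξ u) (ξ x) i) u :=
  hn.contDiffAt_vecChart_of hξ (hn.contDiffAt_baseChart hξ _)

theorem fderiv_clm_comp_apply {V E F G : Type*} [NormedAddCommGroup V] [NormedSpace ℝ V]
    [NormedAddCommGroup E] [NormedSpace ℝ E] [NormedAddCommGroup F] [NormedSpace ℝ F]
    [NormedAddCommGroup G] [NormedSpace ℝ G] {c : V → F →L[ℝ] G} {d : V → E →L[ℝ] F} {x : V}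
    (hc : DifferentiableAt ℝ c x) (hd : DifferentiableAt ℝ d x) (a : V) (b : E) :
    fderiv ℝ (fun y => (c y).comp (d y)) x a b = c x (fderiv ℝ d x a b) +
      fderiv ℝ c x a (d x b) := by
  rw [(hc.hasFDerivAt.clm_comp hd.hasFDerivAt).fderiv]
  simp

/-- For a flat connection, the derivatives of the horizontal lift along horizontal plots are
symmetric. -/
theorem IsHorLevel.fderiv_vecChart_symm_of (hC : C.IsInvolutive) {k n : ℕ} (hn : C.IsHorLevel k n)
    {ξ : V → T.limit.Nerve p} {u : V} (hξ : T.PlotAt (k + n) ξ u) {β : V → V →L[ℝ] E}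
    (hβ : DifferentiableAt ℝ β u)
    (hh : ∀ v, C.IsHorizontalAt (k + n) ξ u v (ξ u) (β u v)) {i : Fin p}
    (h : ∀ a b, fderiv ℝ (fun x => (C.baseChart (ξ u) (ξ x) i.castSucc).comp (β x)) u a b =
      fderiv ℝ (fun x => (C.baseChart (ξ u) (ξ x) i.castSucc).comp (β x)) u b a) (a b : V) :
    fderiv ℝ (fun x => (C.vecChart k (ξ u) (ξ x) i).comp (β x)) u a b =
      fderiv ℝ (fun x => (C.vecChart k (ξ u) (ξ x) i).comp (β x)) u b a := by
  obtain ⟨Hc, hH⟩ := hn.exists_isHorChart ((ξ u).arr i)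
  have h1 : DifferentiableAt ℝ (fun x => Hc (((ξ x).arr i).comp (k + n))) u :=
    (contMDiffAt_iff_contDiffAt.1
      (hH.smooth.comp u (hξ.arr i).contMDiffAt)).differentiableAt (by simp)
  have h2 : DifferentiableAt ℝ (fun x => (C.baseChart (ξ u) (ξ x) i.castSucc).comp (β x)) u :=
    ((hn.contDiffAt_baseChart hξ i.castSucc).differentiableAt (by simp)).clm_comp hβ
  have h3 := hH.fderiv_symm hC (hξ.arr i) rfl (((hh a).arr i)) (((hh b).arr i))
  have e : (fun x => (C.vecChart k (ξ u) (ξ x) i).comp (β x)) =ᶠ[𝓝 u] fun x =>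
      (Hc (((ξ x).arr i).comp (k + n))).comp
        ((C.baseChart (ξ u) (ξ x) i.castSucc).comp (β x)) := by
    filter_upwards [hH.eventually_vecChart hξ] with x hx
    -- The product rule splits the derivative in two: one term is symmetric by the hypothesis on the
    -- previous object, the other by flatness for the single arrow.
    rw [hx, ContinuousLinearMap.comp_assoc]
  rw [e.fderiv_eq, fderiv_clm_comp_apply h1 h2, fderiv_clm_comp_apply h1 h2, h a b,
    C.baseChart_self]
  exact congrArg _ h3

/-- The induction alternates between flatness, at an arrow, and the symmetry of second derivatives
of the source map, at an object. The latter applies because the plot is horizontal at `u`: its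
velocity at the arrow is the same vector `hvec (β u v)` that the derivative of the source map is
applied to. -/
theorem IsHorLevel.fderiv_baseChart_symm (hC : C.IsInvolutive) {k n : ℕ} (hn : C.IsHorLevel k n)
    {ξ : V → T.limit.Nerve p} {u : V} (hξ : T.PlotAt (k + n) ξ u) {β : V → V →L[ℝ] E}
    (hβ : DifferentiableAt ℝ β u) (hβs : ∀ a b, fderiv ℝ β u a b = fderiv ℝ β u b a)
    (hh : ∀ v, C.IsHorizontalAt (k + n) ξ u v (ξ u) (β u v)) (i : Fin (p + 1)) (a b : V) :
    fderiv ℝ (fun x => (C.baseChart (ξ u) (ξ x) i).comp (β x)) u a b =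
      fderiv ℝ (fun x => (C.baseChart (ξ u) (ξ x) i).comp (β x)) u b a := by
  have : ∀ k, IsManifold 𝓘(ℝ, F k) 1 (A k) := fun k => .of_le (n := ∞) (by simp)
  induction i using Fin.induction generalizing a b with
  | zero =>
    have e : (fun x => (C.baseChart (ξ u) (ξ x) 0).comp (β x)) =ᶠ[𝓝 u] β := by
      filter_upwards [hξ.eventually_obj_mem 0] with x hx
      rw [C.baseChart_zero hx, ContinuousLinearMap.id_comp]
    rw [e.fderiv_eq, hβs]
  | succ i ih =>
    let κ : V → F k := fun x => extChartAt 𝓘(ℝ, F k) (((ξ u).arr i).comp k) (((ξ x).arr i).comp k)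
    have hκ : SmoothNear V (F k) κ u :=
      SmoothNear.comp (smoothNear_extChartAt (mem_extChartAt_source _)) (hξ.of_add.arr i)
    have hS := smoothNear_srcChart (T := T) k (((ξ u).arr i).comp k)
    have dκ : ∀ v, fderiv ℝ κ u v = C.hvec k (ξ u) i (β u v) := fun v => by
      rw [← md_eq_fderiv, md_comp (g := extChartAt 𝓘(ℝ, F k) (((ξ u).arr i).comp k))
        (mdifferentiableAt_extChartAt_self _) (hξ.of_add.arr i).mdifferentiableAt,
        md_extChartAt_self]
      exact ((hh v).of_add hξ).arr i
    have h1 : DifferentiableAt ℝ (fun x => fderiv ℝ (srcChart T k (((ξ u).arr i).comp k)) (κ x)) u :=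
      (SmoothNear.comp (g := fderiv ℝ (srcChart T k (((ξ u).arr i).comp k))) (f := κ)
        hS.fderiv hκ).contDiffAt.differentiableAt (by simp)
    have h2 : DifferentiableAt ℝ (fun x => (C.vecChart k (ξ u) (ξ x) i).comp (β x)) u :=
      ((hn.contDiffAt_vecChart hξ i).differentiableAt (by simp)).clm_comp hβ
    have h3 : ∀ v, fderiv ℝ (fun x => fderiv ℝ (srcChart T k (((ξ u).arr i).comp k)) (κ x)) u v =
        fderiv ℝ (fderiv ℝ (srcChart T k (((ξ u).arr i).comp k))) (κ u)
          (C.hvec k (ξ u) i (β u v)) := by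
      intro v
      rw [← dκ, ← ContinuousLinearMap.comp_apply, ← fderiv_comp u
        (hS.fderiv.contDiffAt.differentiableAt (by simp)) (hκ.contDiffAt.differentiableAt (by simp))]
      rfl
    have h4 : IsSymmSndFDerivAt ℝ (srcChart T k (((ξ u).arr i).comp k)) (κ u) :=
      hS.contDiffAt.isSymmSndFDerivAt (by
        rw [minSmoothness_of_isRCLikeNormedField]; exact WithTop.coe_le_coe.2 le_top)
    have e : (fun x => (C.baseChart (ξ u) (ξ x) i.succ).comp (β x)) =ᶠ[𝓝 u] fun x =>
        (fderiv ℝ (srcChart T k (((ξ u).arr i).comp k)) (κ x)).comp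
          ((C.vecChart k (ξ u) (ξ x) i).comp (β x)) := by
      filter_upwards [eventually_baseChart_succ hξ.of_add i] with x hx
      rw [hx, ContinuousLinearMap.comp_assoc]
    rw [e.fderiv_eq, fderiv_clm_comp_apply h1 h2, fderiv_clm_comp_apply h1 h2, h3, h3,
      C.vecChart_self, hn.fderiv_vecChart_symm_of hC hξ hβ hh (fun a b => ih a b) a b]
    simp only [ContinuousLinearMap.comp_apply]
    rw [h4]

theorem IsHorLevel.fderiv_vecChart_symm (hC : C.IsInvolutive) {k n : ℕ} (hn : C.IsHorLevel k n)
    {ξ : V → T.limit.Nerve p} {u : V} (hξ : T.PlotAt (k + n) ξ u) {β : V → V →L[ℝ] E}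
    (hβ : DifferentiableAt ℝ β u) (hβs : ∀ a b, fderiv ℝ β u a b = fderiv ℝ β u b a)
    (hh : ∀ v, C.IsHorizontalAt (k + n) ξ u v (ξ u) (β u v)) (i : Fin p) (a b : V) :
    fderiv ℝ (fun x => (C.vecChart k (ξ u) (ξ x) i).comp (β x)) u a b =
      fderiv ℝ (fun x => (C.vecChart k (ξ u) (ξ x) i).comp (β x)) u b a :=
  hn.fderiv_vecChart_symm_of hC hξ hβ hh (hn.fderiv_baseChart_symm hC hξ hβ hβs hh _) a b

end EhresmannConnection
end LieGroupoidTower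
namespace LieGroupoidTower

variable {E X : Type*} {F A : ℕ → Type*} [NormedAddCommGroup E]
    [NormedSpace ℝ E] [TopologicalSpace X] [ChartedSpace E X] [∀ k, NormedAddCommGroup (F k)]
    [∀ k, NormedSpace ℝ (F k)] [∀ k, TopologicalSpace (A k)] [∀ k, ChartedSpace (F k) (A k)]
    {T : LieGroupoidTower E X F A} {p q : ℕ}
    {V : Type*} [NormedAddCommGroup V] [NormedSpace ℝ V]
    {c c' : T.limit.Nerve p → E [⋀^Fin q]→L[ℝ] ℝ}

/-! ## Smooth forms on the inverse limit -/

variable (T) in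
/-- The pull-back of a horizontal form on the inverse limit along a map from a normed space. -/
def lpull (c : T.limit.Nerve p → E [⋀^Fin q]→L[ℝ] ℝ) (ξ : V → T.limit.Nerve p) (u : V) :
    V [⋀^Fin q]→L[ℝ] ℝ :=
  (c (ξ u)).compContinuousLinearMap (md V E (fun u' => (ξ u').obj 0) u)

theorem IsRepresentedBy.lpull_eq {k : ℕ} {θ} (h : T.IsRepresentedBy c k θ)
    (ξ : V → T.limit.Nerve p) :
    T.lpull c ξ = (T.level k).pull θ (fun u => T.nerveComp k (ξ u)) := by
  funext u
  rw [lpull, h.2]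
  rfl

variable (T) in
/-- The form `c` comes from a smooth form at level `k`. -/
def IsSmoothAt (k : ℕ) (c : T.limit.Nerve p → E [⋀^Fin q]→L[ℝ] ℝ) : Prop :=
  ∃ θ, T.IsRepresentedBy c k θ

theorem IsSmoothAt.contDiffAt_lpull [FiniteDimensional ℝ V] {k : ℕ} (h : T.IsSmoothAt k c)
    {ξ : V → T.limit.Nerve p} {u : V} (hξ : T.PlotAt k ξ u) : ContDiffAt ℝ ∞ (T.lpull c ξ) u := by
  obtain ⟨θ, h⟩ := h
  rw [h.lpull_eq]
  exact h.1.contDiffAt_pull hξ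

/-- A criterion without an explicit representative: composing with any set-theoretic section of the
projection to level `k` yields one, and its smoothness is tested on plots lifted by that section. -/
theorem isSmoothAt_of {k : ℕ} (h : ∀ g g', T.nerveComp k g = T.nerveComp k g' → c g = c g')
    (hs : ∀ (n : ℕ) (ξ : EuclideanSpace ℝ (Fin n) → T.limit.Nerve p) u, T.PlotAt k ξ u →
      ContDiffAt ℝ ∞ (T.lpull c ξ) u) : T.IsSmoothAt k c := by
  obtain ⟨s, e⟩ := (nerveComp_surjective (T := T) k p).hasRightInverse
  refine ⟨fun y => c (s y), LieGroupoid.isSmoothForm_of_contDiffAt_pull fun n ξ u hξ => ?_,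
    fun g => h _ _ (e _).symm⟩
  have h1 := hs n (fun u => s (ξ u)) u (by simpa only [PlotAt, e _] using hξ)
  have h2 : (fun u => (s (ξ u)).obj 0) = fun u => (ξ u).obj 0 :=
    funext fun u => congrArg (fun y : (T.level k).Nerve p => y.obj 0) (e (ξ u))
  rwa [show T.lpull c (fun u => s (ξ u)) = (T.level k).pull (fun y => c (s y)) ξ by
    funext u; rw [lpull, h2]; rfl] at h1

theorem IsSmoothAt.congr {k : ℕ} (h : T.IsSmoothAt k c) {g g' : T.limit.Nerve p}
    (e : T.nerveComp k g = T.nerveComp k g') : c g = c g' := by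
  obtain ⟨θ, h⟩ := h
  rw [h.2, h.2, e]

theorem IsSmoothAt.add_right {k : ℕ} (h : T.IsSmoothAt k c) (m : ℕ) : T.IsSmoothAt (k + m) c :=
  h.choose_spec.add m

theorem IsSmoothAt.add_left {k : ℕ} (h : T.IsSmoothAt k c) (m : ℕ) : T.IsSmoothAt (m + k) c :=
  Nat.add_comm k m ▸ h.add_right m

theorem exists_isSmoothAt {r : ℕ} (a : T.Cochain p q) (b : T.Cochain p r) :
    ∃ k, T.IsSmoothAt k a.1 ∧ T.IsSmoothAt k b.1 := by
  obtain ⟨k, h⟩ := a.2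
  obtain ⟨l, h'⟩ := b.2
  exact ⟨k + l, IsSmoothAt.add_right h l, IsSmoothAt.add_left h' k⟩

theorem lpull_wedge {r : ℕ} (a : T.limit.Nerve p → E [⋀^Fin q]→L[ℝ] ℝ)
    (b : T.limit.Nerve p → E [⋀^Fin r]→L[ℝ] ℝ) (ξ : V → T.limit.Nerve p) :
    T.lpull (fun g => wedge (a g) (b g)) ξ = fun u => wedge (T.lpull a ξ u) (T.lpull b ξ u) :=
  funext fun _ => wedge_compContinuousLinearMap _ _ _

theorem IsSmoothAt.wedge {r k : ℕ} {a : T.limit.Nerve p → E [⋀^Fin q]→L[ℝ] ℝ}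
    {b : T.limit.Nerve p → E [⋀^Fin r]→L[ℝ] ℝ} (ha : T.IsSmoothAt k a) (hb : T.IsSmoothAt k b) :
    T.IsSmoothAt k fun g => Haefliger.wedge (a g) (b g) := by
  refine isSmoothAt_of (fun g g' e => by rw [ha.congr e, hb.congr e]) fun n ξ u hξ => ?_
  rw [lpull_wedge]
  exact ContDiffAt.wedge (ha.contDiffAt_lpull hξ) (hb.contDiffAt_lpull hξ)

theorem isSmoothAt_one (k : ℕ) :
    T.IsSmoothAt k fun _ : T.limit.Nerve p => ContinuousAlternatingMap.constOfIsEmpty ℝ E (Fin 0) (1 : ℝ) :=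
  isSmoothAt_of (fun _ _ _ => rfl) fun _ _ _ _ =>
    contDiffAt_const (c := ContinuousAlternatingMap.constOfIsEmpty ℝ _ (Fin 0) (1 : ℝ))

theorem lpull_degen (c : T.limit.Nerve (p + 1) → E [⋀^Fin q]→L[ℝ] ℝ) (i : Fin (p + 1))
    (ξ : V → T.limit.Nerve p) :
    T.lpull c (fun u => T.limit.degen i (ξ u)) = T.lpull (fun g => c (T.limit.degen i g)) ξ := by
  have e : (fun u => (T.limit.degen i (ξ u)).obj 0) = fun u => (ξ u).obj 0 := by
    funext u
    change (ξ u).obj _ = _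
    rw [Fin.predAbove_right_zero]
  funext u
  rw [lpull, e]
  rfl

theorem IsSmoothAt.degen {k : ℕ} {c : T.limit.Nerve (p + 1) → E [⋀^Fin q]→L[ℝ] ℝ}
    (h : T.IsSmoothAt k c) (i : Fin (p + 1)) :
    T.IsSmoothAt k fun g => c (T.limit.degen i g) := by
  refine isSmoothAt_of (fun g g' e => h.congr ?_) fun n ξ u hξ => ?_
  · rw [nerveComp_degen, nerveComp_degen, e]
  · rw [← lpull_degen]
    exact h.contDiffAt_lpull (hξ.degen i)

variable [IsManifold 𝓘(ℝ, E) ∞ X] [∀ k, IsManifold 𝓘(ℝ, F k) ∞ (A k)]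

/-- The pull-back of a form along a local parametrization of the manifold of strings. -/
theorem IsRepresentedBy.pull_nerveParam {k : ℕ} {θ} (h : T.IsRepresentedBy c k θ)
    {g₀ : (T.level k).Nerve p} {g : T.limit.Nerve p}
    (hg : (T.level k).IsNear g₀ (T.nerveComp k g)) :
    (T.level k).pull θ ((T.level k).nerveParam g₀) ((T.level k).nerveChart g₀ (T.nerveComp k g)) =
      (c g).compContinuousLinearMap ((mdSymm (E := E) (g₀.obj 0) (g.obj 0)).comp
        (.fst ℝ E (Fin p → F k))) := by
  have h1 := md_comp (g := (extChartAt 𝓘(ℝ, E) (g₀.obj 0)).symm) (f := Prod.fst)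
    (x := (T.level k).nerveChart g₀ (T.nerveComp k g))
    (smoothNear_extChartAt_symm ((extChartAt 𝓘(ℝ, E) (g₀.obj 0)).map_source
      hg.obj_mem)).mdifferentiableAt differentiableAt_fst.mdifferentiableAt
  rw [md_eq_fderiv, fderiv_fst] at h1
  rw [LieGroupoid.pull, hg.param_chart.self_of_nhds, ← h.2, md_congr hg.obj_zero, h1]
  rfl

variable [FiniteDimensional ℝ E] [∀ k, FiniteDimensional ℝ (F k)]

/-! ### The differential `d_C` -/

namespace EhresmannConnection

variable (C : EhresmannConnection T)

/-- A chosen horizontal plot. -/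
def horizontalPlot (k : ℕ) (g : T.limit.Nerve p) : E → T.limit.Nerve p :=
  (C.exists_isHorizontalPlot k g).choose

omit [∀ k, FiniteDimensional ℝ (F k)] in
theorem isHorizontalPlot (k : ℕ) (g : T.limit.Nerve p) :
    C.IsHorizontalPlot k g (C.horizontalPlot k g) := (C.exists_isHorizontalPlot k g).choose_spec

open Classical in
/-- The differential `d_C` of a form that is smooth at some level. -/
def dHor (c : T.limit.Nerve p → E [⋀^Fin q]→L[ℝ] ℝ) (g : T.limit.Nerve p) :
    E [⋀^Fin (q + 1)]→L[ℝ] ℝ :=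
  if h : ∃ k, T.IsSmoothAt k c then
    extDeriv (T.lpull c (C.horizontalPlot h.choose g)) (extChartAt 𝓘(ℝ, E) (g.obj 0) (g.obj 0))
  else 0

variable {C}

omit [∀ k, FiniteDimensional ℝ (F k)] in
theorem IsHorizontalAt.of_add_of_eq {k n : ℕ} {ξ : V → T.limit.Nerve p} {u e : V} {v : E}
    {g : T.limit.Nerve p} (h : C.IsHorizontalAt (k + n) ξ u e g v) (hg : ξ u = g)
    (hξ : T.PlotAt (k + n) ξ u) : C.IsHorizontalAt k ξ u e g v := by
  subst hg; exact h.of_add hξ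

theorem IsHorizontalAt.extDeriv_pull {k : ℕ} {θ} (h : T.IsRepresentedBy c k θ)
    {ξ : V → T.limit.Nerve p} {u : V} {g : T.limit.Nerve p} (hg : ξ u = g) (hξ : T.PlotAt k ξ u)
    (e : Fin (q + 1) → V) {v : Fin (q + 1) → E} (hh : ∀ j, C.IsHorizontalAt k ξ u (e j) g (v j)) :
    extDeriv (T.lpull c ξ) u e =
      extDeriv ((T.level k).pull θ ((T.level k).nerveParam (T.nerveComp k g)))
        ((T.level k).nerveChart (T.nerveComp k g) (T.nerveComp k g))
        fun j => (v j, fun i => C.hvec k g i (v j)) := by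
  rw [h.lpull_eq]
  exact h.1.extDeriv_pull_apply hξ (congrArg _ hg) e (fun j => (hh j).obj 0)
    fun j i => (hh j).arr i

/-- A horizontal plot at level `k + l` is horizontal at both levels `k` and `l`, and the pull-back
of `c` along it does not refer to a representative. -/
theorem extDeriv_pull_nerveParam_congr (C : EhresmannConnection T) {k l : ℕ} {θ θ'}
    (h : T.IsRepresentedBy c k θ) (h' : T.IsRepresentedBy c l θ') (g : T.limit.Nerve p)
    (v : Fin (q + 1) → E) :
    extDeriv ((T.level k).pull θ ((T.level k).nerveParam (T.nerveComp k g)))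
        ((T.level k).nerveChart (T.nerveComp k g) (T.nerveComp k g))
        (fun j => (v j, fun i => C.hvec k g i (v j))) =
      extDeriv ((T.level l).pull θ' ((T.level l).nerveParam (T.nerveComp l g)))
        ((T.level l).nerveChart (T.nerveComp l g) (T.nerveComp l g))
        fun j => (v j, fun i => C.hvec l g i (v j)) := by
  obtain ⟨ξ, H⟩ := C.exists_isHorizontalPlot (k + l) g
  have hp : T.PlotAt (l + k) ξ (extChartAt 𝓘(ℝ, E) (g.obj 0) (g.obj 0)) :=
    Nat.add_comm k l ▸ H.plotAt
  have hh : ∀ v, C.IsHorizontalAt (l + k) ξ (extChartAt 𝓘(ℝ, E) (g.obj 0) (g.obj 0)) v g v :=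
    Nat.add_comm k l ▸ H.isHorizontalAt
  rw [← IsHorizontalAt.extDeriv_pull h H.self H.plotAt.of_add v
      fun j => (H.isHorizontalAt (v j)).of_add_of_eq H.self H.plotAt,
    ← IsHorizontalAt.extDeriv_pull h' H.self hp.of_add v fun j => (hh (v j)).of_add_of_eq H.self hp]

/-- This makes `d_C` well defined: the level, the representative and the plot chosen in the
definition may be replaced by any others with the same horizontal tangent vectors. -/
theorem dHor_apply {k : ℕ} {θ} (h : T.IsRepresentedBy c k θ)
    {ξ : V → (T.level k).Nerve p} {u : V} {g : T.limit.Nerve p} (hξ : (T.level k).PlotAt ξ u)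
    (hg : ξ u = T.nerveComp k g) (e : Fin (q + 1) → V) {v : Fin (q + 1) → E}
    (hb : ∀ j, md V E (fun u' => (ξ u').obj 0) u (e j) = v j)
    (hv : ∀ j i, md V (F k) (fun u' => (ξ u').arr i) u (e j) = C.hvec k g i (v j)) :
    C.dHor c g v = extDeriv ((T.level k).pull θ ξ) u e := by
  have hc : ∃ k, T.IsSmoothAt k c := ⟨k, θ, h⟩
  rw [h.1.extDeriv_pull_apply hξ hg e hb hv, dHor, dif_pos hc]
  have h' := hc.choose_spec.choose_spec
  have H := C.isHorizontalPlot hc.choose g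
  rw [IsHorizontalAt.extDeriv_pull h' H.self H.plotAt v (fun j => H.isHorizontalAt (v j)),
    C.extDeriv_pull_nerveParam_congr h h']

/-- The differential is that of the pull-back along a plot with horizontal tangent vectors. -/
theorem IsHorizontalAt.dHor_apply {k : ℕ} (h : T.IsSmoothAt k c)
    {ξ : V → T.limit.Nerve p} {u : V} {g : T.limit.Nerve p} (hg : ξ u = g) (hξ : T.PlotAt k ξ u)
    (e : Fin (q + 1) → V) {v : Fin (q + 1) → E} (hh : ∀ j, C.IsHorizontalAt k ξ u (e j) g (v j)) :
    C.dHor c g v = extDeriv (T.lpull c ξ) u e := by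
  obtain ⟨θ, h⟩ := h
  rw [h.lpull_eq]
  exact EhresmannConnection.dHor_apply h hξ (congrArg _ hg) e (fun j => (hh j).obj 0)
    fun j i => (hh j).arr i

theorem IsHorizontalPlot.dHor_eq {k : ℕ} (h : T.IsSmoothAt k c) {g : T.limit.Nerve p}
    {ξ : E → T.limit.Nerve p} (H : C.IsHorizontalPlot k g ξ) :
    C.dHor c g = extDeriv (T.lpull c ξ) (extChartAt 𝓘(ℝ, E) (g.obj 0) (g.obj 0)) := by
  ext v
  exact IsHorizontalAt.dHor_apply h H.self H.plotAt v fun j => H.isHorizontalAt (v j)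

/-- The differential in terms of a parametrization of the manifold of strings at level `k`. -/
theorem dHor_eq_of_isNear {k : ℕ} {θ} (h : T.IsRepresentedBy c k θ) {g₀ : (T.level k).Nerve p}
    {g : T.limit.Nerve p} (hg : (T.level k).IsNear g₀ (T.nerveComp k g)) :
    C.dHor c g = (extDeriv ((T.level k).pull θ ((T.level k).nerveParam g₀))
      ((T.level k).nerveChart g₀ (T.nerveComp k g))).compContinuousLinearMap
        ((md E E (extChartAt 𝓘(ℝ, E) (g₀.obj 0)) (g.obj 0)).prod (.pi fun i =>
          (md (F k) (F k) (extChartAt 𝓘(ℝ, F k) (g₀.arr i)) ((g.arr i).comp k)).comp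
            (C.hvec k g i))) := by
  have H := C.isHorizontalPlot k g
  have e := congrArg (T.nerveComp k) H.self
  rw [H.dHor_eq ⟨θ, h⟩, h.lpull_eq, LieGroupoid.IsNear.extDeriv_pull h.1 (by rwa [e]) H.plotAt, e]
  congr 1
  ext1 v
  rw [LieGroupoid.IsNear.fderiv_nerveChart (by rwa [e]) H.plotAt, e]
  refine Prod.ext ?_ (funext fun i => ?_)
  · exact congrArg (md E E (extChartAt 𝓘(ℝ, E) (g₀.obj 0)) (g.obj 0)) ((H.isHorizontalAt v).obj 0)
  · exact congrArg (md (F k) (F k) (extChartAt 𝓘(ℝ, F k) (g₀.arr i)) ((g.arr i).comp k))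
      ((H.isHorizontalAt v).arr i)

end EhresmannConnection
end LieGroupoidTower
namespace LieGroupoidTower

variable {E X : Type*} {F A : ℕ → Type*} [NormedAddCommGroup E]
    [NormedSpace ℝ E] [TopologicalSpace X] [ChartedSpace E X] [∀ k, NormedAddCommGroup (F k)]
    [∀ k, NormedSpace ℝ (F k)] [∀ k, TopologicalSpace (A k)] [∀ k, ChartedSpace (F k) (A k)]
    {T : LieGroupoidTower E X F A} {p q : ℕ}
    {V : Type*} [NormedAddCommGroup V] [NormedSpace ℝ V]
    {c : T.limit.Nerve p → E [⋀^Fin q]→L[ℝ] ℝ}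

theorem nerveComp_eq_of_add {k n : ℕ} {g g' : T.limit.Nerve p}
    (h : T.nerveComp (k + n) g = T.nerveComp (k + n) g') : T.nerveComp k g = T.nerveComp k g' := by
  ext i
  · exact congrArg (fun y : (T.level (k + n)).Nerve p => y.obj i) h
  · change (g.arr i).comp k = (g'.arr i).comp k
    rw [← projAdd_comp k n, ← projAdd_comp k n]
    exact congrArg (fun y : (T.level (k + n)).Nerve p => T.projAdd k n (y.arr i)) h

variable [IsManifold 𝓘(ℝ, E) ∞ X] [∀ k, IsManifold 𝓘(ℝ, F k) ∞ (A k)] [FiniteDimensional ℝ E]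

/-! ### Pull-backs by the lift, and `d_C² = 0` -/

namespace EhresmannConnection

variable {C : EhresmannConnection T}

theorem IsHorLevel.hbase_congr {k n : ℕ} (hn : C.IsHorLevel k n) {g g' : T.limit.Nerve p}
    (h : T.nerveComp (k + n) g = T.nerveComp (k + n) g') (i : Fin (p + 1)) :
    C.hbase g i = C.hbase g' i := by
  induction i using Fin.induction with
  | zero => rfl
  | succ i ih =>
    have h1 : (g.arr i).comp (k + n) = (g'.arr i).comp (k + n) :=
      congrArg (fun y : (T.level (k + n)).Nerve p => y.arr i) h
    have h2 : C.lam (g.arr i) = C.lam (g'.arr i) := by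
      ext v
      rw [← C.md_src_horAt k, ← C.md_src_horAt k, hn.congr _ _ h1, ← projAdd_comp k n, h1,
        projAdd_comp]
    rw [C.hbase_succ, C.hbase_succ, ih, h2]

theorem IsHorLevel.hvec_congr {k n : ℕ} (hn : C.IsHorLevel k n) {g g' : T.limit.Nerve p}
    (h : T.nerveComp (k + n) g = T.nerveComp (k + n) g') (i : Fin p) :
    C.hvec k g i = C.hvec k g' i := by
  have h1 : (g.arr i).comp (k + n) = (g'.arr i).comp (k + n) :=
    congrArg (fun y : (T.level (k + n)).Nerve p => y.arr i) h
  rw [hvec, hvec, hn.congr _ _ h1, hn.hbase_congr h]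

variable (C) in
/-- The horizontal lift to strings near `g₀` in the coordinates of level `k`. -/
def liftChart (k : ℕ) (g₀ g : T.limit.Nerve p) : E →L[ℝ] E × (Fin p → F k) :=
  (ContinuousLinearMap.id ℝ E).prod (.pi fun i => C.vecChart k g₀ g i)

theorem IsHorLevel.contDiffAt_liftChart {k n : ℕ} (hn : C.IsHorLevel k n)
    {ξ : V → T.limit.Nerve p} {u : V} (hξ : T.PlotAt (k + n) ξ u) :
    ContDiffAt ℝ ∞ (fun x => C.liftChart k (ξ u) (ξ x)) u := by
  have h1 : ContDiff ℝ ∞ fun f : (E →L[ℝ] E) × (Fin p → (E →L[ℝ] F k)) =>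
      f.1.prod (ContinuousLinearMap.pi f.2) := by
    refine contDiff_clm_apply_iff.2 fun y => (contDiff_fst.clm_apply contDiff_const).prodMk
      (contDiff_pi.2 fun i => ContDiff.clm_apply ?_ contDiff_const)
    exact (contDiff_apply ℝ (E →L[ℝ] F k) i).comp contDiff_snd
  exact h1.contDiffAt.comp u (contDiffAt_const.prodMk
    (contDiffAt_pi.2 fun i => hn.contDiffAt_vecChart hξ i))

/-- The chart at level `k` around the string `ξ u`, along `ξ`. -/
def plotChart (k : ℕ) (ξ : V → T.limit.Nerve p) (u x : V) : E × (Fin p → F k) :=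
  (T.level k).nerveChart (T.nerveComp k (ξ u)) (T.nerveComp k (ξ x))

omit [FiniteDimensional ℝ E] in
theorem contDiffAt_plotChart {k : ℕ} {ξ : V → T.limit.Nerve p} {u : V} (hξ : T.PlotAt k ξ u) :
    ContDiffAt ℝ ∞ (plotChart k ξ u) u :=
  (LieGroupoid.IsNear.smoothNear_nerveChart (ξ := fun x => T.nerveComp k (ξ x))
    (LieGroupoid.isNear_self (T.nerveComp k (ξ u))) hξ).contDiffAt

theorem apply_fderiv_clm_comp {V E F G : Type*} [NormedAddCommGroup V] [NormedSpace ℝ V]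
    [NormedAddCommGroup E] [NormedSpace ℝ E] [NormedAddCommGroup F] [NormedSpace ℝ F]
    [NormedAddCommGroup G] [NormedSpace ℝ G] (P : F →L[ℝ] G) {d : V → E →L[ℝ] F} {x : V}
    (hd : DifferentiableAt ℝ d x) (a : V) (b : E) :
    P (fderiv ℝ d x a b) = fderiv ℝ (fun y => P.comp (d y)) x a b := by
  rw [fderiv_clm_comp_apply (c := fun _ => P) (differentiableAt_const _) hd]
  simp

/-- The pull-back along the horizontal lift of a flat connection commutes with the exterior
derivative. -/
theorem IsHorLevel.extDeriv_comp_liftChart (hC : C.IsInvolutive) {k n : ℕ} (hn : C.IsHorLevel k n)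
    {ξ : V → T.limit.Nerve p} {u : V} (hξ : T.PlotAt (k + n) ξ u) {β : V → V →L[ℝ] E}
    (hβ : DifferentiableAt ℝ β u) (hβs : ∀ a b, fderiv ℝ β u a b = fderiv ℝ β u b a)
    (hh : ∀ v, C.IsHorizontalAt (k + n) ξ u v (ξ u) (β u v))
    {μ : E × (Fin p → F k) → (E × (Fin p → F k)) [⋀^Fin q]→L[ℝ] ℝ}
    (hμ : DifferentiableAt ℝ μ (plotChart k ξ u u)) :
    extDeriv (fun x => (μ (plotChart k ξ u x)).compContinuousLinearMap
        ((C.liftChart k (ξ u) (ξ x)).comp (β x))) u =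
      (extDeriv μ (plotChart k ξ u u)).compContinuousLinearMap
        ((C.liftChart k (ξ u) (ξ u)).comp (β u)) := by
  have hL : DifferentiableAt ℝ (fun x => (C.liftChart k (ξ u) (ξ x)).comp (β x)) u :=
    ((hn.contDiffAt_liftChart hξ).differentiableAt (by simp)).clm_comp hβ
  have hκ := (contDiffAt_plotChart hξ.of_add).differentiableAt (by simp)
  refine extDeriv_compContinuousLinearMap
    (L := fun x => (C.liftChart k (ξ u) (ξ x)).comp (β x)) hμ ?_ hL.hasFDerivAt fun a b => ?_
  -- At `u` itself the plot is horizontal, so the lift of `β u v` is the velocity of the plot.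
  · convert hκ.hasFDerivAt using 1
    ext1 v
    refine Eq.trans ?_ (LieGroupoid.fderiv_nerveChart_self (G := T.level k) hξ.of_add v).symm
    have h1 := (hh v).of_add hξ
    refine Prod.ext (h1.obj 0).symm (funext fun i => ?_)
    refine Eq.trans ?_ (h1.arr i).symm
    rw [← C.vecChart_self]
    rfl
  · refine Prod.ext ?_ (funext fun i => ?_)
    · have h1 := apply_fderiv_clm_comp (.fst ℝ E (Fin p → F k)) hL
      exact ((h1 a b).trans (hβs a b)).trans (h1 b a).symm
    · have h1 := apply_fderiv_clm_comp
        ((ContinuousLinearMap.proj i).comp (.snd ℝ E (Fin p → F k))) hL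
      exact ((h1 a b).trans (hn.fderiv_vecChart_symm hC hξ hβ hβs hh i a b)).trans (h1 b a).symm

/-- The differential of `t ∘ ξ` at `x`, in the chart at the target of `ξ u`. -/
def tgtDeriv (ξ : V → T.limit.Nerve p) (u x : V) : V →L[ℝ] E :=
  fderiv ℝ (fun y => extChartAt 𝓘(ℝ, E) ((ξ u).obj 0) ((ξ y).obj 0)) x


omit [∀ k, IsManifold 𝓘(ℝ, F k) ∞ (A k)] [FiniteDimensional ℝ E] in
theorem contDiffAt_tgtDeriv {k : ℕ} {ξ : V → T.limit.Nerve p} {u : V} (hξ : T.PlotAt k ξ u) :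
    ContDiffAt ℝ ∞ (tgtDeriv ξ u) u :=
  (SmoothNear.comp (g := extChartAt 𝓘(ℝ, E) ((ξ u).obj 0)) (f := fun y => (ξ y).obj 0)
    (smoothNear_extChartAt (mem_extChartAt_source _)) (hξ.obj 0)).fderiv.contDiffAt

omit [∀ k, IsManifold 𝓘(ℝ, F k) ∞ (A k)] [FiniteDimensional ℝ E] in
theorem tgtDeriv_eq {k : ℕ} {ξ : V → T.limit.Nerve p} {u x : V} (hξ : T.PlotAt k ξ x)
    (hx : (ξ x).obj 0 ∈ (extChartAt 𝓘(ℝ, E) ((ξ u).obj 0)).source) :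
    tgtDeriv ξ u x = (md E E (extChartAt 𝓘(ℝ, E) ((ξ u).obj 0)) ((ξ x).obj 0)).comp
      (md V E (fun y => (ξ y).obj 0) x) := by
  rw [tgtDeriv, ← md_eq_fderiv, md_comp (f := fun y => (ξ y).obj 0)
    (smoothNear_extChartAt hx).mdifferentiableAt (hξ.obj 0).mdifferentiableAt]

/-- The target of such a plot is the inverse chart near the centre, not just to first order. So the
differential of the target drops out of formulas that are about to be differentiated. -/
theorem IsHorizontalPlot.tgtDeriv_eq {k : ℕ} {g : T.limit.Nerve p} {ξ : E → T.limit.Nerve p}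
    (H : C.IsHorizontalPlot k g ξ) :
    ∀ᶠ x in 𝓝 (extChartAt 𝓘(ℝ, E) (g.obj 0) (g.obj 0)),
      tgtDeriv ξ (extChartAt 𝓘(ℝ, E) (g.obj 0) (g.obj 0)) x = .id ℝ E := by
  filter_upwards [H.obj_zero.eventually_nhds, (isOpen_extChartAt_target (g.obj 0)).eventually_mem
    (mem_extChartAt_target (I := 𝓘(ℝ, E)) (g.obj 0))] with x h1 h2
  rw [tgtDeriv, H.self]
  have : (fun y => extChartAt 𝓘(ℝ, E) (g.obj 0) ((ξ y).obj 0)) =ᶠ[𝓝 x] fun y => y := by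
    filter_upwards [h1, (isOpen_extChartAt_target (g.obj 0)).eventually_mem h2] with y h3 h4
    rw [h3, (extChartAt 𝓘(ℝ, E) (g.obj 0)).right_inv h4]
  rw [this.fderiv_eq, fderiv_fun_id]

/-- The form `θ` in the coordinates at level `k` around the string `g`. -/
def localForm (k : ℕ) (θ : (T.level k).Nerve p → E [⋀^Fin q]→L[ℝ] ℝ) (g : T.limit.Nerve p) :
    E × (Fin p → F k) → (E × (Fin p → F k)) [⋀^Fin q]→L[ℝ] ℝ :=
  (T.level k).pull θ ((T.level k).nerveParam (T.nerveComp k g))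

variable [∀ k, FiniteDimensional ℝ (F k)]

omit [NormedAddCommGroup V] [NormedSpace ℝ V] in
theorem contDiffAt_localForm {k : ℕ} {θ} (h : T.IsRepresentedBy c k θ) (ξ : V → T.limit.Nerve p)
    (u : V) : ContDiffAt ℝ ∞ (localForm k θ (ξ u)) (plotChart k ξ u u) :=
  h.1.contDiffAt_pull (LieGroupoid.isNear_self _).plotAt

/-- At every nearby point, whether or not the plot is horizontal there, `d_C c` is the exterior
derivative of the local form evaluated on the lift of the velocity of the target. This is the shape
to which `extDeriv_comp_liftChart` applies. -/
theorem eventually_lpull_dHor {k : ℕ} {θ} (h : T.IsRepresentedBy c k θ)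
    {ξ : V → T.limit.Nerve p} {u : V} (hξ : T.PlotAt k ξ u) :
    ∀ᶠ x in 𝓝 u, T.lpull (C.dHor c) ξ x =
      (extDeriv (localForm k θ (ξ u)) (plotChart k ξ u x)).compContinuousLinearMap
        ((C.liftChart k (ξ u) (ξ x)).comp (tgtDeriv ξ u x)) := by
  filter_upwards [LieGroupoid.PlotAt.eventually hξ, hξ.eventually_obj_mem 0,
    (LieGroupoid.PlotAt.continuousAt hξ).eventually
      (LieGroupoid.eventually_isNear (T.nerveComp k (ξ u)))] with x h1 h2 h3
  rw [lpull, dHor_eq_of_isNear h h3]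
  change (ContinuousAlternatingMap.compContinuousLinearMap _ _).compContinuousLinearMap _ = _
  rw [tgtDeriv_eq (k := k) h1 h2]
  ext v
  simp only [ContinuousAlternatingMap.compContinuousLinearMap_apply]
  refine congrArg _ (funext fun j => Prod.ext rfl (funext fun i => ?_))
  have e := DFunLike.congr_fun (mdSymm_comp_md_extChartAt h2)
    (md V E (fun y => (ξ y).obj 0) x (v j))
  simp only [ContinuousLinearMap.comp_apply, ContinuousLinearMap.id_apply] at e
  exact congrArg (fun w => md (F k) (F k) (extChartAt 𝓘(ℝ, F k) (((ξ u).arr i).comp k))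
    (((ξ x).arr i).comp k) (C.hvec k (ξ x) i w)) e.symm

/-- The form is differentiated at level `k`, but evaluated on lifts, whose components at level `k`
are smooth functions on level `k + n`. -/
theorem IsHorLevel.isSmoothAt_dHor {k n : ℕ} (hn : C.IsHorLevel k n) (h : T.IsSmoothAt k c) :
    T.IsSmoothAt (k + n) (C.dHor c) := by
  obtain ⟨θ, h⟩ := h
  refine isSmoothAt_of (fun g g' e => ?_) fun m ξ u hξ => ?_
  · have e' := nerveComp_eq_of_add e
    have h1 := LieGroupoid.isNear_self (T.nerveComp k g)
    rw [dHor_eq_of_isNear h h1, dHor_eq_of_isNear h (g₀ := T.nerveComp k g) (by rwa [← e']), ← e']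
    have e0 : ∀ i, g.obj i = g'.obj i := fun i =>
      congrArg (fun y : (T.level (k + n)).Nerve p => y.obj i) e
    have e1 : ∀ i, (g.arr i).comp k = (g'.arr i).comp k := fun i =>
      congrArg (fun y : (T.level k).Nerve p => y.arr i) e'
    simp only [e0, e1, hn.hvec_congr e]
  · refine ContDiffAt.congr_of_eventuallyEq ?_ (eventually_lpull_dHor h hξ.of_add)
    exact ContDiffAt.alternating_compContinuousLinearMap
      ((ContDiffAt.extDeriv (contDiffAt_localForm h ξ u)).comp u (contDiffAt_plotChart hξ.of_add))
      ((hn.contDiffAt_liftChart hξ).clm_comp (contDiffAt_tgtDeriv hξ))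

/-- Along a horizontal plot, `d_C c` is `dμ` composed with the lift. By flatness the exterior
derivative passes through the lift, and the result is `d dμ = 0`. Multiplicativity plays no part. -/
theorem dHor_dHor (hC : C.IsInvolutive) (h : ∃ k, T.IsSmoothAt k c) : C.dHor (C.dHor c) = 0 := by
  obtain ⟨k, h⟩ := h
  obtain ⟨n, hn⟩ := C.exists_isHorLevel k
  funext g
  obtain ⟨ξ, H⟩ := C.exists_isHorizontalPlot (k + n) g
  rw [H.dHor_eq (hn.isSmoothAt_dHor h)]
  obtain ⟨θ, h⟩ := h
  set u := extChartAt 𝓘(ℝ, E) (g.obj 0) (g.obj 0)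
  have e : T.lpull (C.dHor c) ξ =ᶠ[𝓝 u] fun x =>
      (extDeriv (localForm k θ (ξ u)) (plotChart k ξ u x)).compContinuousLinearMap
        ((C.liftChart k (ξ u) (ξ x)).comp (.id ℝ E)) := by
    filter_upwards [eventually_lpull_dHor h H.plotAt.of_add, H.tgtDeriv_eq] with x h1 h2
    rw [h1, h2]
  rw [e.extDeriv_eq]
  refine (hn.extDeriv_comp_liftChart hC H.plotAt (β := fun _ => .id ℝ E)
    (differentiableAt_const _) (by simp) (fun v => by rw [H.self]; exact H.isHorizontalAt v)
    ((ContDiffAt.extDeriv (contDiffAt_localForm h ξ u)).differentiableAt (by simp))).trans ?_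
  rw [extDeriv_extDeriv_apply (contDiffAt_localForm h ξ u)
    (by rw [minSmoothness_of_isRCLikeNormedField]; exact WithTop.coe_le_coe.2 le_top)]
  rfl

end EhresmannConnection

end LieGroupoidTower
namespace LieGroupoidTower

variable {E X : Type*} {F A : ℕ → Type*} [NormedAddCommGroup E]
    [NormedSpace ℝ E] [TopologicalSpace X] [ChartedSpace E X] [∀ k, NormedAddCommGroup (F k)]
    [∀ k, NormedSpace ℝ (F k)] [∀ k, TopologicalSpace (A k)] [∀ k, ChartedSpace (F k) (A k)]
    {T : LieGroupoidTower E X F A} {p q : ℕ}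
    {V : Type*} [NormedAddCommGroup V] [NormedSpace ℝ V]
    {c : T.limit.Nerve p → E [⋀^Fin q]→L[ℝ] ℝ}
    [IsManifold 𝓘(ℝ, E) ∞ X] [∀ k, IsManifold 𝓘(ℝ, F k) ∞ (A k)] [FiniteDimensional ℝ E]

/-! ### Pull-back along faces; linearity and the Leibniz rule -/

namespace EhresmannConnection

variable (C : EhresmannConnection T)

/-- The pull-back of a form along a face map, restricted to horizontal vectors. -/
def faceForm (i : Fin (p + 2)) (c : T.limit.Nerve p → E [⋀^Fin q]→L[ℝ] ℝ)
    (g : T.limit.Nerve (p + 1)) : E [⋀^Fin q]→L[ℝ] ℝ :=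
  (c (T.limit.face i g)).compContinuousLinearMap (C.hbase g (i.succAbove 0))

variable {C}

/-- The local form is horizontal, so only the first component of the linear map inserted into it
matters. The freedom in `J` is used twice: with zero arrow components for smoothness, and with the
horizontal lift for the comparison with `d_C`. -/
theorem eventually_lpull_faceForm {k : ℕ} {θ} (h : T.IsRepresentedBy c k θ) (i : Fin (p + 2))
    {ξ : V → T.limit.Nerve (p + 1)} {u : V} (hξ : T.PlotAt k ξ u) :
    ∀ᶠ x in 𝓝 u, ∀ J : V →L[ℝ] E × (Fin p → F k),
      (ContinuousLinearMap.fst ℝ E (Fin p → F k)).comp J =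
        (C.baseChart (ξ u) (ξ x) (i.succAbove 0)).comp (tgtDeriv ξ u x) →
      T.lpull (C.faceForm i c) ξ x = (localForm k θ (T.limit.face i (ξ u))
        (plotChart k (fun y => T.limit.face i (ξ y)) u x)).compContinuousLinearMap J := by
  filter_upwards [LieGroupoid.PlotAt.eventually hξ, hξ.eventually_obj_mem 0,
    hξ.eventually_obj_mem (i.succAbove 0), (LieGroupoid.PlotAt.continuousAt (hξ.face i)).eventually
      (LieGroupoid.eventually_isNear (T.nerveComp k (T.limit.face i (ξ u))))]
    with x h1 h2 h3 h4 J hJ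
  rw [localForm, plotChart, h.pull_nerveParam h4]
  rw [tgtDeriv_eq (k := k) h1 h2] at hJ
  ext v
  simp only [lpull, faceForm, ContinuousAlternatingMap.compContinuousLinearMap_apply]
  refine congrArg _ (funext fun j => ?_)
  have e := DFunLike.congr_fun hJ (v j)
  have e1 := DFunLike.congr_fun (mdSymm_comp_md_extChartAt h2)
    (md V E (fun y => (ξ y).obj 0) x (v j))
  have e2 := DFunLike.congr_fun (mdSymm_comp_md_extChartAt h3)
    (C.hbase (ξ x) (i.succAbove 0) (md V E (fun y => (ξ y).obj 0) x (v j)))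
  simp only [baseChart, ContinuousLinearMap.comp_apply, ContinuousLinearMap.id_apply] at e e1 e2
  rw [e1] at e
  exact (e2.symm.trans (congrArg (mdSymm (E := E) ((ξ u).obj (i.succAbove 0))
    ((ξ x).obj (i.succAbove 0))) e.symm))

variable [∀ k, FiniteDimensional ℝ (F k)]

theorem IsHorLevel.isSmoothAt_faceForm {k n : ℕ} (hn : C.IsHorLevel k n) (h : T.IsSmoothAt k c)
    (i : Fin (p + 2)) : T.IsSmoothAt (k + n) (C.faceForm i c) := by
  refine isSmoothAt_of (fun g g' e => ?_) fun m ξ u hξ => ?_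
  · rw [faceForm, faceForm, hn.hbase_congr e, h.congr (g := T.limit.face i g)
      (g' := T.limit.face i g') (by rw [nerveComp_face, nerveComp_face, nerveComp_eq_of_add e])]
  · obtain ⟨θ, h⟩ := h
    have e : T.lpull (C.faceForm i c) ξ =ᶠ[𝓝 u] fun x => (localForm k θ (T.limit.face i (ξ u))
        (plotChart k (fun y => T.limit.face i (ξ y)) u x)).compContinuousLinearMap
        ((ContinuousLinearMap.inl ℝ E (Fin p → F k)).comp
          ((C.baseChart (ξ u) (ξ x) (i.succAbove 0)).comp (tgtDeriv ξ u x))) := by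
      filter_upwards [eventually_lpull_faceForm (C := C) h i hξ.of_add] with x hx using hx _ rfl
    refine ContDiffAt.congr_of_eventuallyEq ?_ e
    exact ContDiffAt.alternating_compContinuousLinearMap
      ((contDiffAt_localForm h (fun y => T.limit.face i (ξ y)) u).comp u
        (contDiffAt_plotChart (hξ.of_add.face i)))
      (contDiffAt_const.clm_comp
        ((hn.contDiffAt_baseChart hξ _).clm_comp (contDiffAt_tgtDeriv hξ)))

theorem dHor_eq_liftChart {k : ℕ} {θ} (h : T.IsRepresentedBy c k θ) (g : T.limit.Nerve p) :
    C.dHor c g = (extDeriv (localForm k θ g)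
      ((T.level k).nerveChart (T.nerveComp k g) (T.nerveComp k g))).compContinuousLinearMap
        (C.liftChart k g g) := by
  have : IsManifold 𝓘(ℝ, E) 1 X := .of_le (n := ∞) (by simp)
  have : IsManifold 𝓘(ℝ, F k) 1 (A k) := .of_le (n := ∞) (by simp)
  rw [dHor_eq_of_isNear h (LieGroupoid.isNear_self _), liftChart]
  refine congrArg _ (ContinuousLinearMap.ext fun v => Prod.ext ?_ (funext fun i => ?_))
  · exact DFunLike.congr_fun (md_extChartAt_self (E := E) (g.obj 0)) v
  · refine Eq.trans ?_ (DFunLike.congr_fun (C.vecChart_self k g i) v).symm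
    exact DFunLike.congr_fun (md_extChartAt_self (E := F k) ((g.arr i).comp k)) _

theorem dHor_add {c c' : T.limit.Nerve p → E [⋀^Fin q]→L[ℝ] ℝ} {k : ℕ} (h : T.IsSmoothAt k c)
    (h' : T.IsSmoothAt k c') : C.dHor (c + c') = C.dHor c + C.dHor c' := by
  funext g
  have H := C.isHorizontalPlot k g
  have hs : T.IsSmoothAt k (c + c') :=
    isSmoothAt_of (fun g g' e => congrArg₂ (· + ·) (h.congr e) (h'.congr e))
      fun _ _ _ hξ => (h.contDiffAt_lpull hξ).add (h'.contDiffAt_lpull hξ)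
  rw [Pi.add_apply, H.dHor_eq h, H.dHor_eq h', H.dHor_eq hs, ← extDeriv_add
    ((h.contDiffAt_lpull H.plotAt).differentiableAt (by simp))
    ((h'.contDiffAt_lpull H.plotAt).differentiableAt (by simp))]
  rfl

theorem dHor_smul {k : ℕ} (r : ℝ) (h : T.IsSmoothAt k c) :
    C.dHor (r • c) = r • C.dHor c := by
  funext g
  have H := C.isHorizontalPlot k g
  have hs : T.IsSmoothAt k (r • c) :=
    isSmoothAt_of (fun g g' e => congrArg (r • ·) (h.congr e))
      fun _ _ _ hξ => (h.contDiffAt_lpull hξ).const_smul r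
  rw [Pi.smul_apply, H.dHor_eq h, H.dHor_eq hs, ← extDeriv_smul]
  rfl

theorem dHor_wedge_apply {r k : ℕ} {a : T.limit.Nerve p → E [⋀^Fin q]→L[ℝ] ℝ}
    {b : T.limit.Nerve p → E [⋀^Fin r]→L[ℝ] ℝ} (ha : T.IsSmoothAt k a) (hb : T.IsSmoothAt k b)
    (g : T.limit.Nerve p) (v : Fin (q + r + 1) → E) :
    C.dHor (fun g => wedge (a g) (b g)) g v =
      wedge (C.dHor a g) (b g) (v ∘ Fin.cast (Nat.add_right_comm q 1 r)) +
        (-1) ^ q * wedge (a g) (C.dHor b g) v := by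
  have H := C.isHorizontalPlot k g
  -- The target of a horizontal plot has derivative the identity at its centre, so pulling back does
  -- not change the form there.
  have e : ∀ {s : ℕ} (c : T.limit.Nerve p → E [⋀^Fin s]→L[ℝ] ℝ),
      T.lpull c (C.horizontalPlot k g) (extChartAt 𝓘(ℝ, E) (g.obj 0) (g.obj 0)) = c g := by
    intro s c
    ext v
    rw [lpull, H.self, ContinuousAlternatingMap.compContinuousLinearMap_apply]
    exact congrArg _ (funext fun j => (H.isHorizontalAt (v j)).obj 0)
  rw [H.dHor_eq (ha.wedge hb), lpull_wedge, extDeriv_wedge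
    ((ha.contDiffAt_lpull H.plotAt).differentiableAt (by simp))
    ((hb.contDiffAt_lpull H.plotAt).differentiableAt (by simp)), H.dHor_eq ha, H.dHor_eq hb, e, e]

end EhresmannConnection

/-! ### Faces and degeneracies commute with `d_C` -/

namespace CartanConnection

open EhresmannConnection

variable {C : CartanConnection T} [∀ k, FiniteDimensional ℝ (F k)]

/-- A plot through `g` is horizontal at one point only. The pull-back of the face form uses lifts at
all its points, so it is not the pull-back of `c` along the composite with the face; the two agree
at the centre but may differ to first order. Flatness removes the difference after
antisymmetrisation. Multiplicativity ensures that the composite with the face is again horizontal at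
the centre. -/
theorem faceForm_dHor (hC : C.IsInvolutive) (h : ∃ k, T.IsSmoothAt k c) (i : Fin (p + 2)) :
    C.faceForm i (C.dHor c) = C.dHor (C.faceForm i c) := by
  obtain ⟨k, h⟩ := h
  obtain ⟨n, hn⟩ := C.exists_isHorLevel k
  funext g
  obtain ⟨ξ, H⟩ := C.exists_isHorizontalPlot (k + n) g
  rw [H.dHor_eq (hn.isSmoothAt_faceForm h i)]
  obtain ⟨θ, h⟩ := h
  rw [faceForm, dHor_eq_liftChart h]
  have Hs := H.self
  have Hh : ∀ v, C.IsHorizontalAt (k + n) ξ (extChartAt 𝓘(ℝ, E) (g.obj 0) (g.obj 0)) v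
    (ξ (extChartAt 𝓘(ℝ, E) (g.obj 0) (g.obj 0))) v := fun v => by
      rw [H.self]; exact H.isHorizontalAt v
  have Hp := H.plotAt
  have Ht := H.tgtDeriv_eq
  generalize extChartAt 𝓘(ℝ, E) (g.obj 0) (g.obj 0) = u at *
  subst Hs
  -- The full lift is taken for `J`, though any arrow components would do here: this choice makes
  -- the linear map agree with the derivative of the coordinates of the plot at the centre.
  have e : T.lpull (C.faceForm i c) ξ =ᶠ[𝓝 u] fun x => (localForm k θ (T.limit.face i (ξ u))
      (plotChart k (fun y => T.limit.face i (ξ y)) u x)).compContinuousLinearMap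
      ((C.liftChart k (T.limit.face i (ξ u)) (T.limit.face i (ξ x))).comp
        (C.baseChart (ξ u) (ξ x) (i.succAbove 0))) := by
    filter_upwards [eventually_lpull_faceForm (C := C.toEhresmannConnection) h i Hp.of_add, Ht]
      with x h1 h2
    refine h1 _ ?_
    rw [h2]
    rfl
  rw [e.extDeriv_eq]
  refine Eq.trans ?_ (hn.extDeriv_comp_liftChart hC (Hp.face i)
    (β := fun x => C.baseChart (ξ u) (ξ x) (i.succAbove 0))
    ((hn.contDiffAt_baseChart Hp _).differentiableAt (by simp)) (fun a b => ?_) (fun v => ?_)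
    ((contDiffAt_localForm h (fun y => T.limit.face i (ξ y)) u).differentiableAt (by simp))).symm
  · rw [C.baseChart_self]
    rfl
  · exact hn.fderiv_baseChart_symm hC Hp (β := fun _ => .id ℝ E) (differentiableAt_const _)
      (by simp) Hh (i.succAbove 0) a b
  · rw [C.baseChart_self]
    exact CartanConnection.IsHorizontalAt.face (Hh v) Hp rfl i

/-- A degeneracy does not change the target, so the two pull-backs agree identically and a plot
horizontal at one point suffices. Flatness is not needed. -/
theorem dHor_degen {c : T.limit.Nerve (p + 1) → E [⋀^Fin q]→L[ℝ] ℝ} (h : ∃ k, T.IsSmoothAt k c)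
    (i : Fin (p + 1)) (g : T.limit.Nerve p) :
    C.dHor (fun g => c (T.limit.degen i g)) g = C.dHor c (T.limit.degen i g) := by
  obtain ⟨k, h⟩ := h
  obtain ⟨ξ, H⟩ := C.exists_isHorizontalPlot k g
  ext v
  rw [H.dHor_eq (h.degen i), EhresmannConnection.IsHorizontalAt.dHor_apply h
    (ξ := fun x => T.limit.degen i (ξ x)) (congrArg _ H.self) (H.plotAt.degen i) v
    fun j => CartanConnection.IsHorizontalAt.degen (H.isHorizontalAt (v j)) H.plotAt H.self i,
    lpull_degen]

end CartanConnection
end LieGroupoidTower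
end Haefliger
-- Index arithmetic for the simplicial identities
namespace Fin

variable {p : ℕ}

theorem val_succAbove {n : ℕ} (i : Fin (n + 1)) (j : Fin n) :
    (i.succAbove j : ℕ) = if (j : ℕ) < i then (j : ℕ) else j + 1 := by
  simp only [Fin.succAbove, Fin.lt_def, Fin.val_castSucc]
  split_ifs <;> rfl

theorem val_predAbove {n : ℕ} (i : Fin n) (j : Fin (n + 1)) :
    (i.predAbove j : ℕ) = if (i : ℕ) < j then (j : ℕ) - 1 else j := by
  simp only [Fin.predAbove, Fin.lt_def, Fin.val_castSucc]
  split_ifs <;> rfl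

theorem succ_succAbove_succAbove_of_le {i j : Fin (p + 2)} (h : i ≤ j) (l : Fin (p + 1)) :
    j.succ.succAbove (i.succAbove l) = i.castSucc.succAbove (j.succAbove l) := by
  rw [Fin.le_def] at h
  ext
  simp only [val_succAbove, val_succ, val_castSucc] at *
  split_ifs <;> omega

theorem succ_predAbove_castSucc_succAbove {i : Fin (p + 2)} {j : Fin (p + 1)} (h : i ≤ j.castSucc)
    (l : Fin (p + 2)) :
    j.succ.predAbove (i.castSucc.succAbove l) = i.succAbove (j.predAbove l) := by
  rw [Fin.le_def] at h
  ext
  simp only [val_succAbove, val_predAbove, val_succ, val_castSucc] at *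
  split_ifs <;> omega

theorem predAbove_castSucc_succAbove (i l : Fin (p + 1)) :
    i.predAbove (i.castSucc.succAbove l) = l := by
  ext
  simp only [val_succAbove, val_predAbove, val_castSucc] at *
  split_ifs <;> omega

theorem predAbove_succ_succAbove (i l : Fin (p + 1)) :
    i.predAbove (i.succ.succAbove l) = l := by
  ext
  simp only [val_succAbove, val_predAbove, val_succ] at *
  split_ifs <;> omega

theorem castSucc_predAbove_succ_succAbove {i : Fin (p + 2)} {j : Fin (p + 1)} (h : j.castSucc < i)
    (l : Fin (p + 2)) :
    j.castSucc.predAbove (i.succ.succAbove l) = i.succAbove (j.predAbove l) := by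
  rw [Fin.lt_def] at h
  ext
  simp only [val_succAbove, val_predAbove, val_succ, val_castSucc] at *
  split_ifs <;> omega

theorem castSucc_predAbove_predAbove_of_le {i j : Fin (p + 1)} (h : i ≤ j) (l : Fin (p + 3)) :
    j.predAbove (i.castSucc.predAbove l) = i.predAbove (j.succ.predAbove l) := by
  rw [Fin.le_def] at h
  ext
  simp only [val_predAbove, val_succ, val_castSucc] at *
  split_ifs <;> omega

end Fin

namespace Haefliger

/-! ## The simplicial identities of the nerve -/

namespace SetGroupoid

variable {X A : Type*} {G : SetGroupoid X A} {p : ℕ}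

theorem mul_unit_of (g : G.Nerve p) {l : Fin p} {x : Fin (p + 1)} (h : x = l.succ) :
    G.mul (g.arr l) (G.unit (g.obj x)) = g.arr l := by
  rw [h, ← g.src_arr, G.mul_unit]

theorem unit_mul_of (g : G.Nerve p) {l : Fin p} {x : Fin (p + 1)} (h : x = l.castSucc) :
    G.mul (G.unit (g.obj x)) (g.arr l) = g.arr l := by
  rw [h, ← g.tgt_arr, G.unit_mul]

theorem face_face (i j : Fin (p + 2)) (h : i ≤ j) (g : G.Nerve (p + 2)) :
    G.face i (G.face j.succ g) = G.face j (G.face i.castSucc g) := by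
  have hc : ∀ l : Fin (p + 1), G.src (g.arr l.castSucc) = G.tgt (g.arr l.succ) := fun l => by
    rw [g.src_arr, g.tgt_arr, Fin.succ_castSucc]
  ext l
  · exact congrArg g.obj (Fin.succ_succAbove_succAbove_of_le h l)
  · simp only [Fin.le_def, face, Fin.val_succ, Fin.val_castSucc] at *
    -- Associativity is needed only where the two faces fuse three consecutive arrows into one.
    split_ifs <;> first | omega | rfl | exact (G.mul_assoc _ _ _ (hc l.castSucc) (hc l.succ)).symm

theorem face_castSucc_degen_succ (i : Fin (p + 2)) (j : Fin (p + 1)) (h : i ≤ j.castSucc)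
    (g : G.Nerve (p + 1)) :
    G.face i.castSucc (G.degen j.succ g) = G.degen j (G.face i g) := by
  ext l
  · exact congrArg g.obj (Fin.succ_predAbove_castSucc_succAbove h l)
  · simp only [Fin.le_def, face, degen, Fin.val_succ, Fin.val_castSucc] at *
    split_ifs <;> first
      | omega
      | exact congrArg g.arr (Fin.ext (by simp; try omega))
      | exact congrArg (fun x => G.unit (g.obj x)) (Fin.ext (by
          simp only [Fin.val_succAbove, Fin.val_succ]
          split_ifs <;> omega))
      | exact mul_unit_of g (Fin.ext (by simp; try omega))
      | exact unit_mul_of g (Fin.ext (by simp; try omega))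
      | exact congrArg₂ G.mul (congrArg g.arr (Fin.ext (by simp; try omega)))
          (congrArg g.arr (Fin.ext (by simp; try omega)))

theorem face_castSucc_degen (i : Fin (p + 1)) (g : G.Nerve p) :
    G.face i.castSucc (G.degen i g) = g := by
  ext l
  · exact congrArg g.obj (Fin.predAbove_castSucc_succAbove i l)
  · simp only [face, degen, Fin.val_succ, Fin.val_castSucc] at *
    split_ifs <;> first
      | omega
      | exact congrArg g.arr (Fin.ext (by simp; try omega))
      | exact mul_unit_of g (Fin.ext (by simp; try omega))

theorem face_succ_degen (i : Fin (p + 1)) (g : G.Nerve p) :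
    G.face i.succ (G.degen i g) = g := by
  ext l
  · exact congrArg g.obj (Fin.predAbove_succ_succAbove i l)
  · simp only [face, degen, Fin.val_succ, Fin.val_castSucc] at *
    split_ifs <;> first
      | omega
      | exact congrArg g.arr (Fin.ext (by simp; try omega))
      | exact unit_mul_of g (Fin.ext (by simp; try omega))

theorem face_succ_degen_castSucc (i : Fin (p + 2)) (j : Fin (p + 1)) (h : j.castSucc < i)
    (g : G.Nerve (p + 1)) :
    G.face i.succ (G.degen j.castSucc g) = G.degen j (G.face i g) := by
  ext l
  · exact congrArg g.obj (Fin.castSucc_predAbove_succ_succAbove h l)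
  · simp only [Fin.lt_def, face, degen, Fin.val_succ, Fin.val_castSucc] at *
    split_ifs <;> first
      | omega
      | exact congrArg g.arr (Fin.ext (by simp; try omega))
      | exact congrArg (fun x => G.unit (g.obj x)) (Fin.ext (by
          simp only [Fin.val_succAbove, Fin.val_castSucc]
          split_ifs; omega))
      | exact mul_unit_of g (Fin.ext (by simp; try omega))
      | exact unit_mul_of g (Fin.ext (by simp; try omega))
      | exact congrArg₂ G.mul (congrArg g.arr (Fin.ext (by simp; try omega)))
          (congrArg g.arr (Fin.ext (by simp; try omega)))

theorem degen_degen (i j : Fin (p + 1)) (h : i ≤ j) (g : G.Nerve p) :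
    G.degen i.castSucc (G.degen j g) = G.degen j.succ (G.degen i g) := by
  ext l
  · exact congrArg g.obj (Fin.castSucc_predAbove_predAbove_of_le h l)
  · simp only [Fin.le_def, degen, Fin.val_succ, Fin.val_castSucc] at *
    split_ifs <;> first
      | omega
      | exact congrArg g.arr (Fin.ext (by simp; try omega))
      | exact congrArg (fun x => G.unit (g.obj x)) (Fin.ext (by
          simp only [Fin.val_predAbove, Fin.val_succ, Fin.val_castSucc]
          split_ifs <;> omega))

end SetGroupoid
-- The cosimplicial DGA of cochains
namespace LieGroupoidTower

variable {E X : Type*} {F A : ℕ → Type*} [NormedAddCommGroup E]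
    [NormedSpace ℝ E] [TopologicalSpace X] [ChartedSpace E X] [∀ k, NormedAddCommGroup (F k)]
    [∀ k, NormedSpace ℝ (F k)] [∀ k, TopologicalSpace (A k)] [∀ k, ChartedSpace (F k) (A k)]
    {T : LieGroupoidTower E X F A}

theorem degCast_apply {p q q' : ℕ} (hq : q = q') (a : T.Cochain p q) (g : T.limit.Nerve p)
    (v : Fin q' → E) :
    (degCast (C := T.Cochain) rfl hq a).1 g v = a.1 g (v ∘ Fin.cast hq) := by
  subst hq; rfl

/-- The wedge product of cochains. -/
def wedgeHom {p q r : ℕ} : T.Cochain p q →ₗ[ℝ] T.Cochain p r →ₗ[ℝ] T.Cochain p (q + r) :=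
  LinearMap.mk₂ ℝ (fun a b => ⟨fun g => wedge (a.1 g) (b.1 g), by
      obtain ⟨k, h, h'⟩ := exists_isSmoothAt a b
      exact ⟨k, h.wedge h'⟩⟩)
    (fun _ _ _ => Subtype.ext (funext fun _ => wedge_add_left _ _ _))
    (fun _ _ _ => Subtype.ext (funext fun _ => wedge_smul_left _ _ _))
    (fun _ _ _ => Subtype.ext (funext fun _ => wedge_add_right _ _ _))
    (fun _ _ _ => Subtype.ext (funext fun _ => wedge_smul_right _ _ _))

variable (T) in
/-- The constant function `1`. -/
def oneCochain (p : ℕ) : T.Cochain p 0 :=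
  ⟨fun _ => .constOfIsEmpty ℝ E (Fin 0) (1 : ℝ), 0, isSmoothAt_one 0⟩

/-- The pull-back of cochains along a degeneracy map. -/
def degenHom {p q : ℕ} (i : Fin (p + 1)) : T.Cochain (p + 1) q →ₗ[ℝ] T.Cochain p q where
  toFun c := ⟨fun g => c.1 (T.limit.degen i g), c.2.imp fun _ h => IsSmoothAt.degen h i⟩
  map_add' _ _ := rfl
  map_smul' _ _ := rfl

variable [IsManifold 𝓘(ℝ, E) ∞ X] [∀ k, IsManifold 𝓘(ℝ, F k) ∞ (A k)] [FiniteDimensional ℝ E]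
  [∀ k, FiniteDimensional ℝ (F k)]

namespace EhresmannConnection

variable (C : EhresmannConnection T)

/-- The differential `d_C` on cochains. -/
def dHom {p q : ℕ} : T.Cochain p q →ₗ[ℝ] T.Cochain p (q + 1) where
  toFun c := ⟨C.dHor c.1, by
    obtain ⟨k, h⟩ := c.2
    obtain ⟨n, hn⟩ := C.exists_isHorLevel k
    exact ⟨k + n, hn.isSmoothAt_dHor h⟩⟩
  map_add' c c' := by
    obtain ⟨k, h, h'⟩ := exists_isSmoothAt c c'
    exact Subtype.ext (dHor_add h h')
  map_smul' r c := by
    obtain ⟨k, h⟩ := c.2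
    exact Subtype.ext (dHor_smul r h)

/-- The pull-back of cochains along a face map, restricted to horizontal vectors. -/
def faceHom {p q : ℕ} (i : Fin (p + 2)) : T.Cochain p q →ₗ[ℝ] T.Cochain (p + 1) q where
  toFun c := ⟨C.faceForm i c.1, by
    obtain ⟨k, h⟩ := c.2
    obtain ⟨n, hn⟩ := C.exists_isHorLevel k
    exact ⟨k + n, hn.isSmoothAt_faceForm h i⟩⟩
  map_add' _ _ := rfl
  map_smul' _ _ := rfl

end EhresmannConnection

namespace CartanConnection

open EhresmannConnection

variable (C : CartanConnection T)

theorem faceHom_apply {p q : ℕ} (i : Fin (p + 2)) (c : T.Cochain p q) (g : T.limit.Nerve (p + 1))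
    (v : Fin q → E) : (C.faceHom i c).1 g v =
      c.1 (T.limit.face i g) fun j => C.hbase g (i.succAbove 0) (v j) := rfl

omit [IsManifold 𝓘(ℝ, E) ∞ X] [∀ k, IsManifold 𝓘(ℝ, F k) ∞ (A k)] [FiniteDimensional ℝ E]
  [∀ k, FiniteDimensional ℝ (F k)] in
theorem degenHom_apply {p q : ℕ} (i : Fin (p + 1)) (c : T.Cochain (p + 1) q)
    (g : T.limit.Nerve p) : (degenHom i c).1 g = c.1 (T.limit.degen i g) := rfl

omit [IsManifold 𝓘(ℝ, E) ∞ X] [∀ k, IsManifold 𝓘(ℝ, F k) ∞ (A k)] [FiniteDimensional ℝ E]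
  [∀ k, FiniteDimensional ℝ (F k)] in
theorem cochain_ext {p q : ℕ} {c c' : T.Cochain p q} (h : ∀ g v, c.1 g v = c'.1 g v) : c = c' :=
  Subtype.ext (funext fun g => ContinuousAlternatingMap.ext (h g))

/-- The Haefliger complex of a flat Cartan groupoid. -/
def complex (hC : C.IsInvolutive) : CosimplicialDGA T.Cochain where
  wedge := wedgeHom
  one := T.oneCochain
  d := C.dHom
  face := C.faceHom
  degen := degenHom
  wedge_assoc a b c := cochain_ext fun g v => by
    rw [degCast_apply]
    exact wedge_assoc_apply (a.1 g) (b.1 g) (c.1 g) v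
  one_wedge a := cochain_ext fun g v => by
    rw [degCast_apply]
    exact (constOfIsEmpty_wedge_apply _ _ v).trans (one_mul _)
  wedge_one a := Subtype.ext (funext fun g =>
    (wedge_constOfIsEmpty_right (a.1 g) 1).trans (one_smul _ _))
  d_d a := Subtype.ext (dHor_dHor hC a.2)
  d_wedge {p q r} a b := cochain_ext fun g v => by
    obtain ⟨k, h, h'⟩ := exists_isSmoothAt a b
    have e1 := degCast_apply (Nat.add_right_comm q 1 r) (wedgeHom (C.dHom a) b) g v
    have e2 := degCast_apply (Nat.add_assoc q r 1).symm (wedgeHom a (C.dHom b)) g v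
    exact (dHor_wedge_apply (C := C.toEhresmannConnection) h h' g v).trans
      (congrArg₂ (· + ·) e1.symm (congrArg ((-1) ^ q * ·) e2.symm))
  face_wedge i a b := Subtype.ext (funext fun g => wedge_compContinuousLinearMap _ _ _)
  face_one i := rfl
  face_d i a := Subtype.ext (faceForm_dHor hC a.2 i)
  degen_wedge i a b := rfl
  degen_one i := rfl
  degen_d i a := Subtype.ext (funext fun g => (dHor_degen a.2 i g).symm)
  face_face i j h a := cochain_ext fun g v => by
    -- Each side applies two successive base maps, and `hbase_face` turns either composite into the
    -- base map at the first object that survives both faces. The two surviving indices agree.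
    simp only [faceHom_apply, ← ContinuousLinearMap.comp_apply, C.hbase_face,
      SetGroupoid.face_face i j h, Fin.succ_succAbove_succAbove_of_le h]
  degen_face_of_le i j h a := cochain_ext fun g v => by
    simp only [faceHom_apply, degenHom_apply, C.hbase_degen,
      SetGroupoid.face_castSucc_degen_succ i j h, Fin.succ_predAbove_castSucc_succAbove h,
      Fin.predAbove_right_zero]
  degen_face_self i a := cochain_ext fun g v => by
    simp only [faceHom_apply, degenHom_apply, C.hbase_degen,
      SetGroupoid.face_castSucc_degen i, Fin.predAbove_castSucc_succAbove, C.hbase_zero,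
      ContinuousLinearMap.id_apply]
  degen_face_succ i a := cochain_ext fun g v => by
    simp only [faceHom_apply, degenHom_apply, C.hbase_degen,
      SetGroupoid.face_succ_degen i, Fin.predAbove_succ_succAbove, C.hbase_zero,
      ContinuousLinearMap.id_apply]
  degen_face_of_gt i j h a := cochain_ext fun g v => by
    simp only [faceHom_apply, degenHom_apply, C.hbase_degen,
      SetGroupoid.face_succ_degen_castSucc i j h, Fin.castSucc_predAbove_succ_succAbove h,
      Fin.predAbove_right_zero]
  degen_degen i j h a := cochain_ext fun g v => by
    simp only [degenHom_apply, SetGroupoid.degen_degen i j h]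

theorem isHaefligerComplex_complex (hC : C.IsInvolutive) :
    C.IsHaefligerComplex (C.complex hC) where
  wedge_apply _ _ _ := rfl
  one_apply _ _ := rfl
  d_apply c g w k θ h n ξ U hξ u hu hg e hb hv := by
    refine dHor_apply (C := C.toEhresmannConnection) h (hξ.plotAt hu) hg e (fun j => hb j 0) fun j i => ?_
    exact (hv j i).trans ((w j).vec_eq i k)
  face_apply i c g w := congrArg (c.1 _) (funext fun j => ((w j).base_eq _).symm)
  degen_apply _ _ _ := rfl

/-! ### Uniqueness -/

variable {C}

-- A horizontal plot through `g`, transported from `E` to a Euclidean space, is an admissible test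
-- with prescribed base vectors, so the defining condition determines every value of the
-- differential.
omit [∀ k, FiniteDimensional ℝ (F k)] in
theorem IsHorizontalDifferential.unique {p q : ℕ} (c : T.Cochain p q)
    {η η' : T.limit.Nerve p → E [⋀^Fin (q + 1)]→L[ℝ] ℝ} (h : C.IsHorizontalDifferential c.1 η)
    (h' : C.IsHorizontalDifferential c.1 η') : η = η' := by
  obtain ⟨k, θ, hc⟩ := c.2
  funext g
  ext v
  have H := C.isHorizontalPlot k g
  let e := toEuclidean (E := E)
  let x₀ := extChartAt 𝓘(ℝ, E) (g.obj 0) (g.obj 0)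
  have hp : (T.level k).PlotAt (fun y => T.nerveComp k (C.horizontalPlot k g (e.symm y))) (e x₀) :=
    LieGroupoid.PlotAt.comp (ξ := fun x => T.nerveComp k (C.horizontalPlot k g x))
      (by rw [e.symm_apply_apply]; exact H.plotAt) (e.symm.contDiff.smoothNear _)
  obtain ⟨U, hu, hU⟩ := hp.exists_isPlot
  have hg : T.nerveComp k (C.horizontalPlot k g (e.symm (e x₀))) = T.nerveComp k g := by
    rw [e.symm_apply_apply, H.self]
  have hd : HasFDerivAt e.symm (e.symm : EuclideanSpace ℝ (Fin (Module.finrank ℝ E)) →L[ℝ] E)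
    (e x₀) := e.symm.hasFDerivAt
  have key : ∀ η, C.IsHorizontalDifferential c.1 η → η g v = _ := fun η h =>
    h g (fun j => C.horizontal g (v j)) k θ hc _ _ U hU _ hu hg (fun j => e (v j))
      (fun j i => by
        have h1 := md_comp_hasFDerivAt (r := fun x => (C.horizontalPlot k g x).obj i)
          (by rw [e.symm_apply_apply]; exact H.plotAt.obj i) hd (e (v j))
        refine h1.trans ?_
        rw [e.symm_apply_apply]
        refine Eq.trans ?_ ((H.isHorizontalAt (v j)).obj i)
        exact congrArg _ (e.symm_apply_apply (v j)))
      (fun j i => by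
        have h1 := md_comp_hasFDerivAt (r := fun x => ((C.horizontalPlot k g x).arr i).comp k)
          (by rw [e.symm_apply_apply]; exact H.plotAt.arr i) hd (e (v j))
        refine h1.trans ?_
        rw [e.symm_apply_apply]
        refine Eq.trans ?_ ((H.isHorizontalAt (v j)).arr i)
        exact congrArg _ (e.symm_apply_apply (v j)))
  rw [key η h, key η' h']

omit [∀ k, FiniteDimensional ℝ (F k)] in
theorem IsHaefligerComplex.unique {Ω Ω' : CosimplicialDGA T.Cochain} (h : C.IsHaefligerComplex Ω)
    (h' : C.IsHaefligerComplex Ω') : Ω = Ω' := by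
  refine CosimplicialDGA.ext ?_ ?_ ?_ ?_ ?_
  · funext p q r
    refine LinearMap.ext₂ fun a b => Subtype.ext (funext fun g => ?_)
    rw [h.wedge_apply, h'.wedge_apply]
  · funext p
    exact cochain_ext fun g v => by rw [h.one_apply, h'.one_apply]
  · funext p q
    exact LinearMap.ext fun c => Subtype.ext
      (IsHorizontalDifferential.unique c (h.d_apply c) (h'.d_apply c))
  · funext p q i
    refine LinearMap.ext fun c => cochain_ext fun g v => ?_
    exact (h.face_apply i c g fun j => C.horizontal g (v j)).trans
      (h'.face_apply i c g fun j => C.horizontal g (v j)).symm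
  · funext p q i
    refine LinearMap.ext fun c => Subtype.ext (funext fun g => ?_)
    rw [h.degen_apply, h'.degen_apply]

end CartanConnection
end LieGroupoidTower
end Haefliger

theorem mainTheorem11 {E X : Type*} {F A : ℕ → Type*}
    [NormedAddCommGroup E] [NormedSpace ℝ E] [FiniteDimensional ℝ E]
    [TopologicalSpace X] [ChartedSpace E X] [IsManifold 𝓘(ℝ, E) ∞ X]
    [∀ k, NormedAddCommGroup (F k)] [∀ k, NormedSpace ℝ (F k)] [∀ k, FiniteDimensional ℝ (F k)]
    [∀ k, TopologicalSpace (A k)] [∀ k, ChartedSpace (F k) (A k)]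
    [∀ k, IsManifold 𝓘(ℝ, F k) ∞ (A k)]
    (T : Haefliger.LieGroupoidTower E X F A) (C : T.CartanConnection) (hC : C.IsInvolutive) :
    ∃ Ω : Haefliger.CosimplicialDGA T.Cochain,
      C.IsHaefligerComplex Ω ∧ (∀ Ω', C.IsHaefligerComplex Ω' → Ω' = Ω) ∧ Ω.IsDoubleDGA := by
  exact ⟨C.complex hC, C.isHaefligerComplex_complex hC,
    fun _ h => h.unique (C.isHaefligerComplex_complex hC),
    Haefliger.CosimplicialDGA.isDoubleDGA _⟩
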